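/- Fix an integer $k\ge 1$. For $N\ge 1$ let $n=N^k$, let $z_1,\dots,z_n$ enumerate the grid $\{1,\dots,N\}^k$, and let $D_{ij}=\|z_i-z_j\|$ (Euclidean distance). For $\theta\in\Theta=(0,\infty)$ let $P_\theta=\mathcal N(0,\Sigma_\theta)$ on $\mathbb R^n$ with $(\Sigma_\theta)_{ij}=\exp(-\theta D_{ij})$, and let $$f(x;\theta)=\frac{1}{(2\pi)^{n/2}\det(\Sigma_\theta)^{1/2}}e^{-x^\top\Sigma_\theta^{-1}x/2},\quad \mathcal L(\theta;x)=-\log f(x;\theta),\quad \mathcal L(\theta;x,w)=\mathcal L(\theta;x)+\sigma_N w\theta,\quad H(\theta;x)=-\partial_\theta^2\log f(x;\theta),$$ where the noise levels $\sigma_N>0$ satisfy $\sigma_N=O(n^{1/2})$ as $N\to\infty$. Let $\rho_N>0$ be radii with $\rho_N\to0$ and $\sqrt{\log n/n}=o(\rho_N)$ (for example $\rho_N=n^{-1/4}$). Let $E$ be the set of ordered pairs $(i,j)$ with $D_{ij}=1$, put $m(x)=|E|^{-1}\sum_{(i,j)\in E}x_ix_j$ (with $m(x)=0$ if $E=\emptyset$),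 and, where $m(x)>0$, let $\widehat\theta_{\mathrm{init}}(x)=-\log m(x)$. An \emph{admissible estimator} is a (Lebesgue) measurable map $\widehat\theta:\mathbb R^n\times\mathbb R\to\Theta$ such that, for every $(x,w)$ for which $m(x)>0$ and $B(x)=[\widehat\theta_{\mathrm{init}}(x)-\rho_N,\widehat\theta_{\mathrm{init}}(x)+\rho_N]\subseteq\Theta$, the value $\widehat\theta(x,w)$ is a first-order stationary point of the problem of minimizing $\mathcal L(\cdot;x,w)$ over $B(x)$, i.e. $\widehat\theta(x,w)\in B(x)$ and $\partial_\theta\mathcal L(\widehat\theta(x,w);x,w)\,(t-\widehat\theta(x,w))\ge0$ for all $t\in B(x)$; elsewhere its values in $\Theta$ are arbitrary. Then there are functions $r_N,\delta_N,\varepsilon_N:\Theta\to\mathbb R$ with $r_N>0$ such that, for each fixed $\theta_0\in\Theta$, as $N\to\infty$, $$r_N(\theta_0)=\widetilde O(n^{-1/2}),\qquad \delta_N(\theta_0)=O(n^{-1}),\qquad \varepsilon_N(\theta_0)=\widetilde O(n^{-1/2})$$ (where $\widetilde O(v)$ means $O(v\,(\log n)^p)$ for some power $p$), and such that for every $N\ge1$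 admissible estimators exist and the following hold. 1. (Regularity.) $\Theta$ is convex and open; for each $\theta\in\Theta$, $P_\theta$ has the measurable density $f(\cdot;\theta)>0$ with respect to Lebesgue measure; and for each $x$ the map $\theta\mapsto\mathcal L(\theta;x)$ is twice continuously differentiable on $\Theta$. 2. (Estimator.) For every admissible estimator $\widehat\theta$ and every $\theta_0\in\Theta$, if $(X,W)\sim P_{\theta_0}\times\mathcal N(0,1)$, then with probability at least $1-\delta_N(\theta_0)$ we have $|\widehat\theta(X,W)-\theta_0|\le r_N(\theta_0)$ and $\widehat\theta=\widehat\theta(X,W)$ is a strict second-order stationary point, that is, $\partial_\theta\mathcal L(\widehat\theta;X,W)=0$ and $\partial_\theta^2\mathcal L(\widehat\theta;X,W)>0$. 3. (Hessian.) For every $\theta_0\in\Theta$, with $S=[\theta_0-r_N(\theta_0),\theta_0+r_N(\theta_0)]\cap\Theta$, the expectation $H(\theta)=\mathbb E_{\theta_0}[H(\theta;X)]$ exists for all $\theta\in S$, and $$\mathbb E_{\theta_0}\Big[\sup_{\theta\in S}r_N(\theta_0)^2\big(H(\theta)-H(\theta;X)\big)_+\Big]\le\varepsilon_N(\theta_0),\qquad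 \mathbb E_{\theta_0}\Big[\exp\Big\{\sup_{\theta\in S}r_N(\theta_0)^2\big(H(\theta;X)-H(\theta)\big)_+\Big\}\Big]\le e^{\varepsilon_N(\theta_0)}.$$ -/

import Mathlib

open MeasureTheory ProbabilityTheory Filter Asymptotics Topology
open scoped ENNReal

noncomputable section

namespace ACSS

/-! ### Parametric families with a scalar parameter

A family is given by laws `P θ` on a data space `X`, densities `f θ x`, a penalty `R` and a
parameter set `Θ ⊆ ℝ`. The parameter has dimension `d = 1`, so that gradients and Hessians in the
parameter are first and second derivatives, `λ_max` of a Hessian is the Hessian itself, and the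
perturbation `N(0, I_d / d)` is `N(0, 1)`. -/

section General

variable {X : Type*}

/-- The penalized negative log-likelihood `ℒ(θ; x) = -log f(x; θ) + R(θ)`. -/
def loss (f : ℝ → X → ℝ) (R : ℝ → ℝ) (θ : ℝ) (x : X) : ℝ :=
  -Real.log (f θ x) + R θ

/-- The perturbed objective `ℒ(θ; x, w) = ℒ(θ; x) + σ w θ`. -/
def noisyLoss (f : ℝ → X → ℝ) (R : ℝ → ℝ) (σ : ℝ) (θ : ℝ) (x : X) (w : ℝ) : ℝ :=
  loss f R θ x + σ * w * θ

/-- `θ` is a strict second-order stationary point of `ℒ(·; x, w)`. -/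
def IsSSOSP (f : ℝ → X → ℝ) (R : ℝ → ℝ) (σ : ℝ) (x : X) (w θ : ℝ) : Prop :=
  deriv (fun t => noisyLoss f R σ t x w) θ = 0 ∧
    0 < iteratedDeriv 2 (fun t => noisyLoss f R σ t x w) θ

/-- `θ` is a first-order stationary point of the problem of minimizing `ℒ(·; x, w)` over the
convex set `B`. -/
def IsConstrainedFOSP (f : ℝ → X → ℝ) (R : ℝ → ℝ) (σ : ℝ) (x : X) (w : ℝ) (B : Set ℝ)
    (θ : ℝ) : Prop :=
  θ ∈ B ∧ ∀ t ∈ B, 0 ≤ deriv (fun s => noisyLoss f R σ s x w) θ * (t - θ)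

/-- The observed information `H(θ; x) = -∂²/∂θ² log f(x; θ)`. -/
def hess (f : ℝ → X → ℝ) (θ : ℝ) (x : X) : ℝ :=
  -iteratedDeriv 2 (fun t => Real.log (f t x)) θ

variable [MeasurableSpace X]

/-- The expectation `H(θ) = E_{θ₀}[H(θ; X)]`. -/
def meanHess (P : ℝ → Measure X) (f : ℝ → X → ℝ) (θ₀ θ : ℝ) : ℝ :=
  ∫ x, hess f θ x ∂(P θ₀)

/-- Regularity conditions on the family and the penalty. -/
structure RegularityAssumption (ν : Measure X) (P : ℝ → Measure X) (f : ℝ → X → ℝ)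
    (R : ℝ → ℝ) (Θ : Set ℝ) : Prop where
  convex : Convex ℝ Θ
  isOpen : IsOpen Θ
  measurable_density : ∀ θ ∈ Θ, Measurable (f θ)
  density_pos : ∀ θ ∈ Θ, ∀ x, 0 < f θ x
  law_eq : ∀ θ ∈ Θ, P θ = ν.withDensity (fun x => ENNReal.ofReal (f θ x))
  contDiffOn : ∀ x, ContDiffOn ℝ 2 (fun θ => loss f R θ x) Θ

/-- For every `θ₀ ∈ Θ`, if `(X, W) ∼ P_{θ₀} × N(0, 1)` then, with probability at least
`1 - δ(θ₀)`, the estimator is within `r(θ₀)` of `θ₀` and is a strict second-order stationary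
point. -/
def EstimatorAssumption (P : ℝ → Measure X) (f : ℝ → X → ℝ) (R : ℝ → ℝ) (Θ : Set ℝ)
    (σ : ℝ) (est : X → ℝ → ℝ) (r δ : ℝ → ℝ) : Prop :=
  ∀ θ₀ ∈ Θ, 1 - δ θ₀ ≤ ((P θ₀).prod (gaussianReal 0 1)).real
    {p | |est p.1 p.2 - θ₀| ≤ r θ₀ ∧ IsSSOSP f R σ p.1 p.2 (est p.1 p.2)}

/-- `sup_{θ ∈ 𝔹(θ₀, ρ) ∩ Θ} ρ² (s (H(θ; x) - H(θ)))₊`, with value in `[0, ∞]`; the sign `s` is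
`1` or `-1`. -/
def hessSup (P : ℝ → Measure X) (f : ℝ → X → ℝ) (Θ : Set ℝ) (θ₀ ρ s : ℝ) (x : X) : ℝ≥0∞ :=
  ⨆ θ ∈ Metric.closedBall θ₀ ρ ∩ Θ,
    ENNReal.ofReal (ρ ^ 2 * max (s * (hess f θ x - meanHess P f θ₀ θ)) 0)

/-- Concentration of the Hessian: for every `θ₀ ∈ Θ` the expectation `H(θ)` exists on
`𝔹(θ₀, r(θ₀)) ∩ Θ`, and
`E_{θ₀}[sup r² (H(θ) - H(θ; X))₊] ≤ ε` and `E_{θ₀}[exp (sup r² (H(θ; X) - H(θ))₊)] ≤ exp ε`. -/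
def HessianAssumption (P : ℝ → Measure X) (f : ℝ → X → ℝ) (Θ : Set ℝ) (r ε : ℝ → ℝ) : Prop :=
  ∀ θ₀ ∈ Θ,
    (∀ θ ∈ Metric.closedBall θ₀ (r θ₀) ∩ Θ, Integrable (hess f θ) (P θ₀)) ∧
    ∫⁻ x, hessSup P f Θ θ₀ (r θ₀) (-1) x ∂(P θ₀) ≤ ENNReal.ofReal (ε θ₀) ∧
    ∫⁻ x, EReal.exp (hessSup P f Θ θ₀ (r θ₀) 1 x : EReal) ∂(P θ₀) ≤
      ENNReal.ofReal (Real.exp (ε θ₀))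

end General

/-- `u = Õ(v)` along the sample sizes `n`: `u = O(v · (log n)^p)` for some power `p`. -/
def IsSoftO (n u v : ℕ → ℝ) : Prop :=
  ∃ p : ℕ, u =O[atTop] fun N => v N * Real.log (n N) ^ p

/-! ### The Gaussian spatial process on the grid `{1, …, N}^k` -/

/-- The data space `ℝⁿ`, `n = N^k`, with coordinates indexed by the points of the grid. -/
abbrev GridData (k N : ℕ) : Type := EuclideanSpace ℝ (Fin k → Fin N)

/-- The sample size `n = N^k`. -/
def sampleSize (k N : ℕ) : ℝ := (N : ℝ) ^ k

/-- The location `z_i ∈ {1, …, N}^k ⊆ ℝ^k` of a grid point. -/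
def gridPoint {k N : ℕ} (i : Fin k → Fin N) : EuclideanSpace ℝ (Fin k) :=
  WithLp.toLp 2 fun a => ((i a : ℕ) : ℝ) + 1

/-- The Euclidean distance `D_ij = ‖z_i - z_j‖`. -/
def gridDist {k N : ℕ} (i j : Fin k → Fin N) : ℝ := ‖gridPoint i - gridPoint j‖

/-- The covariance matrix `(Σ_θ)_ij = exp (-θ D_ij)`. -/
def spatialCov (k N : ℕ) (θ : ℝ) : Matrix (Fin k → Fin N) (Fin k → Fin N) ℝ :=
  Matrix.of fun i j => Real.exp (-θ * gridDist i j)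

/-- The law `N(0, Σ_θ)`. -/
def spatialLaw (k N : ℕ) (θ : ℝ) : Measure (GridData k N) :=
  multivariateGaussian 0 (spatialCov k N θ)

/-- The density of `N(0, Σ_θ)` with respect to Lebesgue measure. -/
def spatialDensity (k N : ℕ) (θ : ℝ) (x : GridData k N) : ℝ :=
  1 / ((2 * Real.pi) ^ (sampleSize k N / 2) * √(spatialCov k N θ).det) *
    Real.exp (-(x.ofLp ⬝ᵥ ((spatialCov k N θ)⁻¹.mulVec x.ofLp)) / 2)

open Classical in
/-- The set `E` of ordered pairs of neighbors, i.e. pairs at distance `1`. -/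
def neighborPairs (k N : ℕ) : Finset ((Fin k → Fin N) × (Fin k → Fin N)) :=
  Finset.univ.filter fun p => gridDist p.1 p.2 = 1

/-- The average `|E|⁻¹ ∑_{(i,j) ∈ E} x_i x_j` of the products of neighbors. -/
def neighborMean {k N : ℕ} (x : GridData k N) : ℝ :=
  (∑ p ∈ neighborPairs k N, x p.1 * x p.2) / ((neighborPairs k N).card : ℝ)

/-- The neighbor-product initial estimator `-log (|E|⁻¹ ∑_{(i,j) ∈ E} x_i x_j)`, meaningful
where the average is positive. -/
def initEstimator {k N : ℕ} (x : GridData k N) : ℝ := -Real.log (neighborMean x)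

/-- `est` is a Lebesgue measurable map to `Θ = (0, ∞)` which, whenever the initial estimate is
defined and the ball of radius `rad` around it lies in `Θ`, returns a first-order stationary
point of the perturbed negative log-likelihood constrained to that ball (elsewhere its values in
`Θ` are arbitrary). -/
structure IsLocalEstimator (k N : ℕ) (σ rad : ℝ) (est : GridData k N → ℝ → ℝ) : Prop where
  aemeasurable : AEMeasurable (Function.uncurry est)
    ((volume : Measure (GridData k N)).prod (volume : Measure ℝ))
  mem : ∀ x w, est x w ∈ Set.Ioi (0 : ℝ)
  stationary : ∀ x w, 0 < neighborMean x →
    Metric.closedBall (initEstimator x) rad ⊆ Set.Ioi 0 →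
    IsConstrainedFOSP (spatialDensity k N) 0 σ x w
      (Metric.closedBall (initEstimator x) rad) (est x w)

end ACSS

end

/-!
The observed information at a parameter `θ` is `H(θ; x) = tr T_θ + xᵀ A_θ x`, and the derivative of
the loss is `tr(Σ⁻¹Σ')/2 - xᵀ B_θ x / 2`, where `T_θ`, `A_θ` and `B_θ` are built from products of
`Σ_θ⁻¹`, `Σ_θ'` and `Σ_θ''`. Everything follows from bounds on the operator norms of these matrices,
uniform in the size of the grid, and from the concentration of Gaussian quadratic forms.

*Uniform norms.* The derivatives of `Σ_θ` in `θ` decay exponentially with the distance, so that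
Schur's test bounds their norms (`exists_norm_covDeriv_le`). For `Σ_θ⁻¹`, write `exp (-θ D)` as a
mixture of Gaussian kernels `exp (-s D²)` (`integral_exp_neg_sq_sub`): all of these are positive
semidefinite, and since distinct grid points are at distance at least one, those with large `s` are
dominated by their diagonal. As they carry a fixed positive mass, the smallest eigenvalue of `Σ_θ`
is bounded away from zero (`exists_spatialCov_coercive`). Hence `T_θ`, `A_θ` and `B_θ` are bounded
and Lipschitz in `θ`, locally uniformly on `(0, ∞)` (`UnifLip`).

*Quadratic forms.* If `X` has law `N(0, S)`, then `Xᵀ A X` is, by rotation invariance, a combination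
of independent squared normal variables, so that its centred exponential moments are at most
`exp (2 t² b² n)` with `b = ‖A‖ ‖S‖`, for `|t| b ≤ 1 / 8` (`lintegral_exp_quadForm_le`). This gives
deviations of order `√(n log n)` up to probability `O(1 / n)`.

*Hessian.* By the Lipschitz bound, `r² |H(θ; X) - H(θ)|` is at most `η V` on the ball of radius `r`
around `θ₀`, where `η` is of order `r² √n + r³ n` and `V` has a bounded exponential moment.
Convexity of the exponential then bounds `E exp (η V)` by `1 + O(η)`
(`exists_hessian_concentration`). For `r` of order `√(log n / n)`, `η` is `Õ(n^{-1/2})`.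

*Estimator.* The Fisher information `tr(Σ⁻¹Σ'Σ⁻¹Σ') / 2` is at least proportional to `n`, since every
grid point has a neighbor (`exists_information_ge`). Hence, up to probability `O(1 / n)`, the loss
is strongly convex near `θ₀` with a constant proportional to `n`, its perturbed gradient at `θ₀` is
`O(√(n log n))`, and the initial estimate is within half the radius of the ball from `θ₀`. A
constrained stationary point is then interior and within `O(√(log n / n))` of `θ₀`
(`exists_estimator_rate`). Admissible estimators exist because the first nonnegative point of the
gradient in the ball is a measurable choice (`exists_isLocalEstimator`).

For the finitely many small grids the estimator is not controlled; there `δ` is `1`, and `r` is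
chosen so small that the bounds on the Hessian hold (`exists_radius`).
-/

noncomputable section

namespace ACSS

/-! ### Gaussian vectors: density and exponential moments of quadratic forms -/

section Gaussian

open Matrix WithLp
open scoped MatrixOrder Matrix.Norms.L2Operator

variable {ι : Type*} [Fintype ι]

/-- The quadratic form `x ↦ xᵀ A x`. -/
def quadForm (A : Matrix ι ι ℝ) (x : EuclideanSpace ℝ ι) : ℝ := x.ofLp ⬝ᵥ A.mulVec x.ofLp

lemma continuous_quadForm (A : Matrix ι ι ℝ) : Continuous (quadForm A) := by
  unfold quadForm
  fun_prop

lemma quadForm_one [DecidableEq ι] (x : EuclideanSpace ℝ ι) :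
    quadForm (1 : Matrix ι ι ℝ) x = ‖x‖ ^ 2 := by
  rw [quadForm, one_mulVec, EuclideanSpace.real_norm_sq_eq, dotProduct]
  exact Finset.sum_congr rfl fun i _ => (sq _).symm

lemma quadForm_sub (A B : Matrix ι ι ℝ) (x : EuclideanSpace ℝ ι) :
    quadForm (A - B) x = quadForm A x - quadForm B x := by
  simp only [quadForm, sub_mulVec, dotProduct_sub]

lemma quadForm_smul (c : ℝ) (A : Matrix ι ι ℝ) (x : EuclideanSpace ℝ ι) :
    quadForm (c • A) x = c * quadForm A x := by
  simp only [quadForm, smul_mulVec, dotProduct_smul, smul_eq_mul]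

variable [DecidableEq ι]

lemma quadForm_toEuclideanCLM (A Q : Matrix ι ι ℝ) (x : EuclideanSpace ℝ ι) :
    quadForm A (toEuclideanCLM (𝕜 := ℝ) Q x) = quadForm (Qᵀ * A * Q) x := by
  simp only [quadForm, ofLp_toEuclideanCLM, ← mulVec_mulVec]
  rw [dotProduct_mulVec _ Qᵀ, vecMul_transpose]

lemma abs_quadForm_le (A : Matrix ι ι ℝ) (x : EuclideanSpace ℝ ι) :
    |quadForm A x| ≤ ‖A‖ * ‖x‖ ^ 2 := by
  have h : quadForm A x = inner ℝ x (toEuclideanCLM (𝕜 := ℝ) A x) :=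
    (inner_toEuclideanCLM A x x).symm
  rw [h]
  calc |inner ℝ x (toEuclideanCLM (𝕜 := ℝ) A x)|
      ≤ ‖x‖ * ‖toEuclideanCLM (𝕜 := ℝ) A x‖ := abs_real_inner_le_norm _ _
    _ ≤ ‖x‖ * (‖toEuclideanCLM (𝕜 := ℝ) A‖ * ‖x‖) := by
        gcongr; exact ContinuousLinearMap.le_opNorm _ _
    _ = ‖A‖ * ‖x‖ ^ 2 := by rw [← cstar_norm_def]; ring

omit [DecidableEq ι] in
/-- The density of the standard Gaussian measure, obtained by comparing characteristic functions. -/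
lemma stdGaussian_eq_withDensity :
    stdGaussian (EuclideanSpace ℝ ι) = volume.withDensity fun x =>
      ENNReal.ofReal ((2 * Real.pi) ^ (-(Fintype.card ι : ℝ) / 2) * Real.exp (-‖x‖ ^ 2 / 2)) := by
  set c : ℝ := (2 * Real.pi) ^ (-(Fintype.card ι : ℝ) / 2) with hc
  have hc0 : 0 < c := by positivity
  have hint : Integrable fun x : EuclideanSpace ℝ ι => c * Real.exp (-‖x‖ ^ 2 / 2) := by
    have := (GaussianFourier.integrable_cexp_neg_mul_sq_norm_add (V := EuclideanSpace ℝ ι)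
      (b := 1 / 2) (by norm_num) 0 0).norm
    refine Integrable.const_mul (this.congr (Eventually.of_forall fun x => ?_)) c
    simp only [Complex.norm_exp]
    congr 1
    have : (-(1 / 2 : ℂ) * (‖x‖ : ℂ) ^ 2 + 0 * ((inner ℝ 0 x : ℝ) : ℂ))
      = ((-‖x‖ ^ 2 / 2 : ℝ) : ℂ) := by push_cast; ring
    rw [this, Complex.ofReal_re]
  have : IsFiniteMeasure ((volume : Measure (EuclideanSpace ℝ ι)).withDensity fun x =>
      ENNReal.ofReal (c * Real.exp (-‖x‖ ^ 2 / 2))) :=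
    isFiniteMeasure_withDensity_ofReal hint.2
  refine Measure.ext_of_charFun (funext fun t => ?_)
  rw [charFun_stdGaussian, charFun_apply,
    integral_withDensity_eq_integral_toReal_smul (by fun_prop) (by simp)]
  have key := GaussianFourier.integral_cexp_neg_mul_sq_norm_add (V := EuclideanSpace ℝ ι)
      (b := 1 / 2) (by norm_num) Complex.I t
  have h1 : ∀ x : EuclideanSpace ℝ ι,
      (ENNReal.ofReal (c * Real.exp (-‖x‖ ^ 2 / 2))).toReal • Complex.exp ((inner ℝ x t : ℝ) * Complex.I)
      = (c : ℂ) * Complex.exp (-(1 / 2) * ‖x‖ ^ 2 + Complex.I * (inner ℝ t x : ℝ)) := by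
    intro x
    rw [ENNReal.toReal_ofReal (by positivity), Complex.real_smul, Complex.exp_add,
      real_inner_comm]
    push_cast
    rw [show -(‖x‖ : ℂ) ^ 2 / 2 = -(1 / 2) * ‖x‖ ^ 2 by ring, mul_comm _ Complex.I]
    ring
  simp_rw [h1]
  rw [integral_const_mul, key, finrank_euclideanSpace, hc, ← mul_assoc,
    show (Real.pi / (1 / 2) : ℂ) = ((2 * Real.pi : ℝ) : ℂ) by push_cast; ring,
    Complex.ofReal_cpow (by positivity), ← Complex.cpow_add]
  · have : (((-(Fintype.card ι : ℝ) / 2 : ℝ) : ℂ) + (Fintype.card ι : ℂ) / 2) = 0 := by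
      push_cast; ring
    rw [this, Complex.cpow_zero, one_mul]
    congr 1
    simp [Complex.I_sq]
    ring
  · exact_mod_cast (by positivity : (2 * Real.pi) ≠ 0)

/-- The density of `N(0, S)`, by the change of variables `x ↦ S^{1/2} x`. -/
theorem multivariateGaussian_eq_withDensity {S : Matrix ι ι ℝ} (hS : S.PosDef) :
    multivariateGaussian 0 S = volume.withDensity fun x : EuclideanSpace ℝ ι =>
      ENNReal.ofReal (1 / ((2 * Real.pi) ^ ((Fintype.card ι : ℝ) / 2) * √S.det) *
        Real.exp (-(quadForm S⁻¹ x) / 2)) := by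
  set Q := CFC.sqrt S with hQ
  have hQQ : Q * Q = S := CFC.sqrt_mul_sqrt_self S hS.posSemidef.nonneg
  have hQt : Qᵀ = Q := by
    have := (CFC.sqrt_nonneg S).posSemidef.isHermitian
    rwa [IsHermitian, conjTranspose_eq_transpose_of_trivial] at this
  have hdet : Q.det = √S.det := by
    rw [hQ, hS.posSemidef.det_sqrt, RCLike.sqrt_of_nonneg hS.det_pos.le]
    simp
  have hSd : 0 < S.det := hS.det_pos
  have hQd : 0 < Q.det := hdet ▸ Real.sqrt_pos.2 hSd
  have hQSQ : Q * S⁻¹ * Q = 1 := by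
    rw [← hQQ, Matrix.mul_inv_rev, ← mul_assoc, Matrix.mul_nonsing_inv _ hQd.ne'.isUnit, one_mul,
      Matrix.nonsing_inv_mul _ hQd.ne'.isUnit]
  set f := toEuclideanCLM (𝕜 := ℝ) Q with hf
  have hfdet : LinearMap.det (f : EuclideanSpace ℝ ι →ₗ[ℝ] EuclideanSpace ℝ ι) = Q.det := by
    rw [hf, coe_toEuclideanCLM_eq_toEuclideanLin, toEuclideanLin_eq_toLin_orthonormal,
      LinearMap.det_toLin]
  have hmap : (volume : Measure (EuclideanSpace ℝ ι)).map f =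
      ENNReal.ofReal (Q.det)⁻¹ • volume := by
    have := Measure.map_linearMap_addHaar_eq_smul_addHaar
      (volume : Measure (EuclideanSpace ℝ ι)) (f := (f : EuclideanSpace ℝ ι →ₗ[ℝ] _))
      (by rw [hfdet]; exact hQd.ne')
    rw [hfdet, abs_of_pos (inv_pos.2 hQd)] at this
    exact this
  have hdens : Measurable fun x : EuclideanSpace ℝ ι =>
      ENNReal.ofReal (1 / ((2 * Real.pi) ^ ((Fintype.card ι : ℝ) / 2) * √S.det) *
        Real.exp (-(quadForm S⁻¹ x) / 2)) := by
    have := (continuous_quadForm (S⁻¹)).measurable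
    fun_prop
  have hfun : (fun x : EuclideanSpace ℝ ι => 0 + toEuclideanCLM (𝕜 := ℝ) Q x) = f := by
    ext x; simp [hf]
  rw [multivariateGaussian, hfun, stdGaussian_eq_withDensity]
  ext s hs
  rw [Measure.map_apply f.continuous.measurable hs,
    withDensity_apply _ (f.continuous.measurable hs), withDensity_apply _ hs,
    ← lintegral_indicator (f.continuous.measurable hs), ← lintegral_indicator hs]
  have hvol : (volume : Measure (EuclideanSpace ℝ ι)) = ENNReal.ofReal Q.det • volume.map f := by
    rw [hmap, smul_smul, ← ENNReal.ofReal_mul hQd.le, mul_inv_cancel₀ hQd.ne', ENNReal.ofReal_one,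
      one_smul]
  conv_rhs => rw [hvol]
  rw [lintegral_smul_measure, lintegral_map (hdens.indicator hs) f.continuous.measurable,
    smul_eq_mul, ← lintegral_const_mul' _ _ ENNReal.ofReal_ne_top]
  refine lintegral_congr fun x => ?_
  by_cases hx : f x ∈ s
  · rw [Set.indicator_of_mem (by exact hx), Set.indicator_of_mem hx,
      ← ENNReal.ofReal_mul hQd.le, hf, quadForm_toEuclideanCLM, hQt, hQSQ, quadForm_one, ← hdet,
      neg_div (2 : ℝ) (Fintype.card ι : ℝ), Real.rpow_neg (by positivity)]
    congr 1
    field_simp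
  · rw [Set.indicator_of_notMem (by exact hx), Set.indicator_of_notMem hx, mul_zero]

/-- The centred square of a standard Gaussian variable is sub-exponential. -/
lemma integral_exp_sq_sub_one_gaussianReal {y : ℝ} (hy : |y| ≤ 1 / 8) :
    Integrable (fun x => Real.exp (y * (x ^ 2 - 1))) (gaussianReal 0 1) ∧
      ∫ x, Real.exp (y * (x ^ 2 - 1)) ∂(gaussianReal 0 1) ≤ Real.exp (2 * y ^ 2) := by
  obtain ⟨hy1, hy2⟩ := abs_le.1 hy
  have hb : 0 < 1 / 2 - y := by linarith
  have hpt : ∀ x : ℝ, gaussianPDFReal 0 1 x • Real.exp (y * (x ^ 2 - 1)) =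
      ((√(2 * Real.pi))⁻¹ * Real.exp (-y)) * Real.exp (-(1 / 2 - y) * x ^ 2) := by
    intro x
    simp only [gaussianPDFReal, smul_eq_mul, NNReal.coe_one, mul_one, sub_zero]
    rw [mul_assoc, mul_assoc, ← Real.exp_add, ← Real.exp_add]
    congr 2
    ring
  constructor
  · rw [gaussianReal_of_var_ne_zero 0 one_ne_zero,
      integrable_withDensity_iff_integrable_smul' (measurable_gaussianPDF _ _)
        (Eventually.of_forall fun x => ENNReal.ofReal_lt_top)]
    refine ((integrable_exp_neg_mul_sq hb).const_mul
      ((√(2 * Real.pi))⁻¹ * Real.exp (-y))).congr (Eventually.of_forall fun x => ?_)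
    simp only
    rw [← hpt, toReal_gaussianPDF]
  · rw [integral_gaussianReal_eq_integral_smul one_ne_zero]
    simp_rw [hpt]
    rw [integral_const_mul, integral_gaussian]
    have h1 : (√(2 * Real.pi))⁻¹ * Real.exp (-y) * √(Real.pi / (1 / 2 - y)) =
        Real.exp (-y) * √((1 - 2 * y)⁻¹) := by
      have : Real.pi / (1 / 2 - y) = (2 * Real.pi) * (1 - 2 * y)⁻¹ := by
        field_simp
      have h0 : √(2 * Real.pi) ≠ 0 := by positivity
      rw [this, Real.sqrt_mul (show 0 ≤ 2 * Real.pi by positivity), mul_comm _ (Real.exp (-y)), mul_assoc,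
        inv_mul_cancel_left₀ h0]
    have h2 : √((1 - 2 * y)⁻¹) ≤ Real.exp (y + 2 * y ^ 2) := by
      rw [Real.sqrt_le_left (Real.exp_pos _).le, ← Real.exp_nat_mul,
        inv_le_comm₀ (by linarith) (Real.exp_pos _), ← Real.exp_neg]
      have hlt : 0 < 1 - 2 * y := by linarith
      -- `1 + z + z² / 2 ≤ exp z` for `z ≥ 0`, and `1 + z ≤ exp z` in general, at `z = 2y + 4y²`
      rw [Real.exp_neg, inv_le_comm₀ (Real.exp_pos _) hlt, inv_le_iff_one_le_mul₀ hlt]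
      rcases le_or_gt 0 y with h | h
      · have := Real.quadratic_le_exp_of_nonneg
          (show 0 ≤ ((2 : ℕ) : ℝ) * (y + 2 * y ^ 2) by positivity)
        push_cast at this ⊢
        nlinarith [pow_nonneg h 2, pow_nonneg h 3, pow_nonneg h 4,
          mul_nonneg (pow_nonneg h 2) (sub_nonneg.2 hy2)]
      · have := Real.add_one_le_exp (((2 : ℕ) : ℝ) * (y + 2 * y ^ 2))
        push_cast at this ⊢
        have h3 : 0 < (-y) ^ 3 := by have := neg_pos.2 h; positivity
        nlinarith
    rw [h1]
    calc Real.exp (-y) * √((1 - 2 * y)⁻¹) ≤ Real.exp (-y) * Real.exp (y + 2 * y ^ 2) := by gcongr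
      _ = Real.exp (2 * y ^ 2) := by rw [← Real.exp_add]; congr 1; ring

lemma abs_eigenvalues_le_norm {M : Matrix ι ι ℝ} (hM : M.IsHermitian) (i : ι) :
    |hM.eigenvalues i| ≤ ‖M‖ := by
  have h := hM.mulVec_eigenvectorBasis i
  have h2 : toEuclideanCLM (𝕜 := ℝ) M (hM.eigenvectorBasis i) =
      hM.eigenvalues i • hM.eigenvectorBasis i := by
    apply (WithLp.ofLp_injective 2)
    simpa using h
  have h3 := (toEuclideanCLM (𝕜 := ℝ) M).le_opNorm (hM.eigenvectorBasis i)
  rw [h2, norm_smul, hM.eigenvectorBasis.norm_eq_one, mul_one, mul_one] at h3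
  exact h3

/-- A symmetric quadratic form is diagonal in the coordinates of an eigenbasis. -/
lemma quadForm_sum_eigenvectorBasis {M : Matrix ι ι ℝ} (hM : M.IsHermitian) (x : ι → ℝ) :
    quadForm M (∑ i, x i • hM.eigenvectorBasis i) = ∑ i, hM.eigenvalues i * x i ^ 2 := by
  have h2 : ∀ i, toEuclideanCLM (𝕜 := ℝ) M (hM.eigenvectorBasis i) =
      hM.eigenvalues i • hM.eigenvectorBasis i := by
    intro i
    apply (WithLp.ofLp_injective 2)
    simpa using hM.mulVec_eigenvectorBasis i
  rw [show quadForm M (∑ i, x i • hM.eigenvectorBasis i) = inner ℝ _ _ from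
    (inner_toEuclideanCLM M _ _).symm, map_sum]
  simp only [map_smul, h2]
  rw [sum_inner]
  refine Finset.sum_congr rfl fun i _ => ?_
  rw [inner_sum, Finset.sum_eq_single i]
  · rw [inner_smul_left, inner_smul_right, inner_smul_right, real_inner_self_eq_norm_sq,
      hM.eigenvectorBasis.norm_eq_one]
    simp; ring
  · intro j _ hj
    rw [inner_smul_left, inner_smul_right, inner_smul_right,
      hM.eigenvectorBasis.orthonormal.2 hj.symm]
    simp
  · simp

/-- A centred quadratic form in a Gaussian vector is sub-exponential, with variance proxy
proportional to the dimension. By rotation invariance the form is diagonal, so that its exponential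
moment is a product of one-dimensional ones. -/
theorem lintegral_exp_quadForm_le {A S : Matrix ι ι ℝ} (hA : Aᵀ = A) (hS : S.PosSemidef)
    {b t : ℝ} (hb : ‖A‖ * ‖S‖ ≤ b) (ht : |t| * b ≤ 1 / 8) :
    ∫⁻ x, ENNReal.ofReal (Real.exp (t * (quadForm A x - (A * S).trace)))
      ∂(multivariateGaussian 0 S) ≤
      ENNReal.ofReal (Real.exp (2 * t ^ 2 * b ^ 2 * Fintype.card ι)) := by
  set Q := CFC.sqrt S with hQ
  have hQQ : Q * Q = S := CFC.sqrt_mul_sqrt_self S hS.nonneg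
  have hQt : Qᵀ = Q := by
    have := (CFC.sqrt_nonneg S).posSemidef.isHermitian
    rwa [IsHermitian, conjTranspose_eq_transpose_of_trivial] at this
  have hM : (Q * A * Q).IsHermitian := by
    rw [IsHermitian, conjTranspose_eq_transpose_of_trivial, transpose_mul, transpose_mul, hQt, hA,
      mul_assoc]
  have hMn : ‖Q * A * Q‖ ≤ b := by
    refine le_trans ?_ hb
    have h1 : ‖Q‖ * ‖Q‖ = ‖S‖ := by
      rw [← CStarRing.norm_star_mul_self, star_eq_conjTranspose,
        conjTranspose_eq_transpose_of_trivial, hQt, hQQ]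
    calc ‖Q * A * Q‖ ≤ ‖Q‖ * ‖A‖ * ‖Q‖ :=
          (norm_mul_le _ _).trans (by gcongr; exact norm_mul_le _ _)
      _ = ‖A‖ * ‖S‖ := by rw [← h1]; ring
  have hfun : (fun x : EuclideanSpace ℝ ι => 0 + toEuclideanCLM (𝕜 := ℝ) Q x) =
      toEuclideanCLM (𝕜 := ℝ) Q := by
    ext x; simp
  have htr : (A * S).trace = ∑ i, hM.eigenvalues i := by
    have := hM.trace_eq_sum_eigenvalues
    simp only [RCLike.ofReal_real_eq_id, id] at this
    rw [← this, ← hQQ, mul_assoc, trace_mul_comm Q, mul_assoc]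
  have hmeas : Measurable fun x : EuclideanSpace ℝ ι =>
      ENNReal.ofReal (Real.exp (t * (quadForm A x - (A * S).trace))) := by
    have := (continuous_quadForm A).measurable
    fun_prop
  have hquad := (continuous_quadForm A).measurable
  -- in an eigenbasis of `S^{1/2} A S^{1/2}` the coordinates are independent standard normal
  rw [multivariateGaussian, hfun, lintegral_map hmeas (by fun_prop),
    stdGaussian_eq_map_pi_orthonormalBasis hM.eigenvectorBasis,
    lintegral_map (by fun_prop) (by fun_prop)]
  have hpt : ∀ x : ι → ℝ, Real.exp (t * (quadForm A (toEuclideanCLM (𝕜 := ℝ) Q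
      (∑ i, x i • hM.eigenvectorBasis i)) - (A * S).trace)) =
      ∏ i, Real.exp ((t * hM.eigenvalues i) * (x i ^ 2 - 1)) := by
    intro x
    rw [quadForm_toEuclideanCLM, hQt, quadForm_sum_eigenvectorBasis, htr, ← Finset.sum_sub_distrib,
      ← Real.exp_sum, Finset.mul_sum]
    congr 1
    exact Finset.sum_congr rfl fun i _ => by ring
  simp_rw [hpt]
  have hd : ∀ i, |t * hM.eigenvalues i| ≤ |t| * b := fun i => by
    rw [abs_mul]
    gcongr
    exact (abs_eigenvalues_le_norm hM i).trans hMn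
  have h1 := fun i => integral_exp_sq_sub_one_gaussianReal ((hd i).trans ht)
  have hint : Integrable (fun x : ι → ℝ => ∏ i, Real.exp ((t * hM.eigenvalues i) * (x i ^ 2 - 1)))
      (Measure.pi fun _ : ι => gaussianReal 0 1) :=
    Integrable.fintype_prod (fun i => (h1 i).1)
  rw [← ofReal_integral_eq_lintegral_ofReal hint
    (Eventually.of_forall fun x => Finset.prod_nonneg fun i _ => (Real.exp_pos _).le)]
  refine ENNReal.ofReal_le_ofReal ?_
  rw [integral_fintype_prod_eq_prod (f := fun i x =>
    Real.exp ((t * hM.eigenvalues i) * (x ^ 2 - 1)))]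
  calc ∏ i, ∫ x, Real.exp ((t * hM.eigenvalues i) * (x ^ 2 - 1)) ∂(gaussianReal 0 1)
      ≤ ∏ _i : ι, Real.exp (2 * (|t| * b) ^ 2) := by
        refine Finset.prod_le_prod (fun i _ => integral_nonneg fun x => (Real.exp_pos _).le)
          fun i _ => (h1 i).2.trans ?_
        rw [Real.exp_le_exp]
        have := pow_le_pow_left₀ (abs_nonneg _) (hd i) 2
        rw [sq_abs] at this
        linarith
    _ = Real.exp (2 * t ^ 2 * b ^ 2 * Fintype.card ι) := by
        rw [Finset.prod_const, Finset.card_univ, ← Real.exp_nat_mul, mul_pow, sq_abs]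
        congr 1; ring

end Gaussian

/-! ### The exponential kernel as a mixture of Gaussian kernels -/

section Subordination

open Set

/-- The Cauchy–Schlömilch substitution: `v ↦ v - a / v` maps `(0, ∞)` onto `ℝ`, and the inversion
`v ↦ a / v` exchanges the two parts of its derivative `1 + a / v ^ 2`. -/
lemma lintegral_exp_neg_sub_div_sq {a : ℝ} (ha : 0 < a) :
    ∫⁻ v in Ioi (0 : ℝ), ENNReal.ofReal (Real.exp (-(v - a / v) ^ 2)) =
      ENNReal.ofReal (√Real.pi / 2) := by
  set g : ℝ → ℝ≥0∞ := fun u => ENNReal.ofReal (Real.exp (-u ^ 2)) with hg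
  have hgm : Measurable g := by fun_prop
  have htot : ∫⁻ u, g u = ENNReal.ofReal √Real.pi := by
    rw [hg, ← ofReal_integral_eq_lintegral_ofReal]
    · have := integral_gaussian 1
      simp only [neg_mul, one_mul, div_one] at this
      rw [this]
    · simpa using integrable_exp_neg_mul_sq one_pos
    · exact Eventually.of_forall fun x => (Real.exp_pos _).le
  have hder1 : ∀ v ∈ Ioi (0 : ℝ),
      HasDerivWithinAt (fun v => v - a / v) (1 + a / v ^ 2) (Ioi 0) v := by
    intro v hv
    have hv0 : v ≠ 0 := (mem_Ioi.1 hv).ne'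
    have := (hasDerivAt_id v).sub ((hasDerivAt_inv hv0).const_mul a)
    refine (this.congr_deriv ?_).hasDerivWithinAt.congr (fun x _ => ?_) ?_
    · field_simp; ring
    · simp [div_eq_mul_inv]
    · simp [div_eq_mul_inv]
  have hder2 : ∀ v ∈ Ioi (0 : ℝ),
      HasDerivWithinAt (fun v => a / v) (-(a / v ^ 2)) (Ioi 0) v := by
    intro v hv
    have hv0 : v ≠ 0 := (mem_Ioi.1 hv).ne'
    have := ((hasDerivAt_inv hv0).const_mul a)
    refine (this.congr_deriv ?_).hasDerivWithinAt.congr (fun x _ => ?_) ?_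
    · field_simp
    · simp [div_eq_mul_inv]
    · simp [div_eq_mul_inv]
  have hinj1 : InjOn (fun v : ℝ => v - a / v) (Ioi 0) := by
    refine StrictMonoOn.injOn fun x hx y hy hxy => ?_
    have : a / y < a / x := div_lt_div_of_pos_left ha hx hxy
    linarith
  have hinj2 : InjOn (fun v : ℝ => a / v) (Ioi 0) := by
    refine StrictAntiOn.injOn fun x hx y hy hxy => ?_
    exact div_lt_div_of_pos_left ha hx hxy
  have him1 : (fun v : ℝ => v - a / v) '' Ioi 0 = univ := by
    refine eq_univ_of_forall fun u => ?_
    have hs : |u| < √(u ^ 2 + 4 * a) := by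
      rw [← Real.sqrt_sq_eq_abs]
      exact Real.sqrt_lt_sqrt (sq_nonneg _) (by linarith)
    have hpos : 0 < u + √(u ^ 2 + 4 * a) := by linarith [neg_abs_le u]
    refine ⟨(u + √(u ^ 2 + 4 * a)) / 2, by simpa using hpos, ?_⟩
    have hsq := Real.sq_sqrt (show 0 ≤ u ^ 2 + 4 * a by positivity)
    simp only
    field_simp
    nlinarith
  have him2 : (fun v : ℝ => a / v) '' Ioi 0 = Ioi 0 := by
    ext u
    constructor
    · rintro ⟨v, hv, rfl⟩
      exact div_pos ha hv
    · intro hu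
      exact ⟨a / u, div_pos ha hu, by have := (mem_Ioi.1 hu).ne'; field_simp⟩
  have h1 := lintegral_image_eq_lintegral_abs_deriv_mul measurableSet_Ioi hder1 hinj1 g
  have h2 := lintegral_image_eq_lintegral_abs_deriv_mul measurableSet_Ioi hder2 hinj2
    (fun v => g (v - a / v))
  rw [him1, Measure.restrict_univ, htot] at h1
  rw [him2] at h2
  have h3 : ∫⁻ v in Ioi (0 : ℝ), ENNReal.ofReal |1 + a / v ^ 2| * g (v - a / v) =
      ∫⁻ v in Ioi (0 : ℝ), g (v - a / v) + ENNReal.ofReal |-(a / v ^ 2)| * g (a / v - a / (a / v)) := by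
    refine setLIntegral_congr_fun measurableSet_Ioi fun v hv => ?_
    have hv0 : v ≠ 0 := (mem_Ioi.1 hv).ne'
    have hp : 0 ≤ a / v ^ 2 := by positivity
    have e1 : a / v - a / (a / v) = -(v - a / v) := by field_simp; ring
    have e2 : g (-(v - a / v)) = g (v - a / v) := by simp only [hg, neg_sq]
    rw [e1, e2, abs_of_nonneg (by linarith), abs_neg, abs_of_nonneg hp,
      ENNReal.ofReal_add zero_le_one hp, ENNReal.ofReal_one, add_mul, one_mul]
  rw [h3, lintegral_add_left (by fun_prop), ← h2, ← two_mul] at h1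
  change ∫⁻ v in Ioi (0 : ℝ), g (v - a / v) = _
  rw [ENNReal.ofReal_div_of_pos two_pos, h1, ENNReal.ofReal_ofNat]
  exact (ENNReal.eq_div_iff two_ne_zero ENNReal.ofNat_ne_top).2 rfl

lemma integrableOn_exp_neg_sq_sub (a : ℝ) :
    IntegrableOn (fun v : ℝ => Real.exp (-v ^ 2 - a ^ 2 / v ^ 2)) (Ioi 0) := by
  have h : Integrable (fun v : ℝ => Real.exp (-v ^ 2)) := by
    simpa using integrable_exp_neg_mul_sq one_pos
  refine Integrable.mono' h.integrableOn (by fun_prop) (Eventually.of_forall fun v => ?_)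
  rw [Real.norm_eq_abs, abs_of_pos (Real.exp_pos _), Real.exp_le_exp]
  have : 0 ≤ a ^ 2 / v ^ 2 := by positivity
  linarith

/-- `exp (-2a)` is a mixture of the Gaussians `a ↦ exp (-a² / v²)`. -/
theorem integral_exp_neg_sq_sub {a : ℝ} (ha : 0 ≤ a) :
    ∫ v in Ioi (0 : ℝ), Real.exp (-v ^ 2 - a ^ 2 / v ^ 2) = √Real.pi / 2 * Real.exp (-2 * a) := by
  rcases ha.eq_or_lt with rfl | ha
  · have := integral_gaussian_Ioi 1
    simpa using this
  · have h1 : ∫ v in Ioi (0 : ℝ), Real.exp (-(v - a / v) ^ 2) = √Real.pi / 2 := by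
      rw [integral_eq_lintegral_of_nonneg_ae (Eventually.of_forall fun v => (Real.exp_pos _).le)
        (by fun_prop), lintegral_exp_neg_sub_div_sq ha, ENNReal.toReal_ofReal (by positivity)]
    rw [← h1, ← integral_mul_const]
    refine setIntegral_congr_fun measurableSet_Ioi fun v hv => ?_
    have hv0 : v ≠ 0 := (mem_Ioi.1 hv).ne'
    rw [← Real.exp_add]
    congr 1
    field_simp
    ring

/-- The Gaussian kernel is positive semidefinite, being the characteristic function of a standard
Gaussian vector. -/
lemma sum_gaussianKernel_nonneg {ι : Type*} [Fintype ι] {k : ℕ}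
    (z : ι → EuclideanSpace ℝ (Fin k)) {s : ℝ} (hs : 0 ≤ s) (x : ι → ℝ) :
    0 ≤ ∑ i, ∑ j, x i * x j * Real.exp (-s * ‖z i - z j‖ ^ 2) := by
  set γ := stdGaussian (EuclideanSpace ℝ (Fin k))
  have hcos : ∀ t : EuclideanSpace ℝ (Fin k),
      ∫ y, Real.cos (inner ℝ y t) ∂γ = Real.exp (-‖t‖ ^ 2 / 2) := by
    intro t
    have h := charFun_stdGaussian t
    rw [charFun_apply] at h
    have hint : Integrable (fun y => Complex.exp ((inner ℝ y t : ℝ) * Complex.I)) γ := by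
      refine Integrable.of_bound (by fun_prop) 1 (Eventually.of_forall fun y => ?_)
      rw [Complex.norm_exp_ofReal_mul_I]
    have h2 := congrArg Complex.re h
    rw [← RCLike.re_eq_complex_re, ← integral_re hint] at h2
    simp only [RCLike.re_eq_complex_re, Complex.exp_ofReal_mul_I_re] at h2
    rw [h2, ← Complex.exp_ofReal_re]
    push_cast
    rfl
  have hbase : ∀ i j, Real.exp (-s * ‖z i - z j‖ ^ 2) =
      ∫ y, Real.cos (inner ℝ y (√(2 * s) • z i) - inner ℝ y (√(2 * s) • z j)) ∂γ := by
    intro i j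
    simp_rw [← inner_sub_right]
    rw [hcos, ← smul_sub, norm_smul, mul_pow, Real.norm_eq_abs, sq_abs,
      Real.sq_sqrt (by positivity)]
    congr 1; ring
  have hint : ∀ i j, Integrable (fun y : EuclideanSpace ℝ (Fin k) => x i * x j *
      Real.cos (inner ℝ y (√(2 * s) • z i) - inner ℝ y (√(2 * s) • z j))) γ := by
    intro i j
    refine Integrable.const_mul ?_ _
    refine Integrable.of_bound (by fun_prop) 1 (Eventually.of_forall fun y => ?_)
    exact Real.abs_cos_le_one _
  simp_rw [hbase, ← integral_const_mul]
  simp_rw [← integral_finsetSum _ (fun j _ => hint _ j)]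
  rw [← integral_finsetSum _ (fun i _ => integrable_finsetSum _ (fun j _ => hint i j))]
  refine integral_nonneg fun y => ?_
  -- the integrand is the squared modulus of `∑ x_i exp (i ⟨y, z_i⟩)`
  have : ∑ i, ∑ j, x i * x j *
      Real.cos (inner ℝ y (√(2 * s) • z i) - inner ℝ y (√(2 * s) • z j)) =
      (∑ i, x i * Real.cos (inner ℝ y (√(2 * s) • z i))) ^ 2 +
      (∑ i, x i * Real.sin (inner ℝ y (√(2 * s) • z i))) ^ 2 := by
    simp_rw [sq, Finset.sum_mul_sum, ← Finset.sum_add_distrib, Real.cos_sub]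
    refine Finset.sum_congr rfl fun i _ => Finset.sum_congr rfl fun j _ => by ring
  simp only [Pi.zero_apply]
  rw [this]
  positivity

end Subordination

/-! ### Matrices with summable off-diagonal decay -/

section RowSums

open Matrix
open scoped Matrix.Norms.L2Operator

/-- Schur's test for a matrix dominated by a symmetric matrix with bounded row sums. -/
lemma norm_le_of_rowSum_le {ι : Type*} [Fintype ι] [DecidableEq ι] {M R : Matrix ι ι ℝ} {K : ℝ}
    (hK : 0 < K) (hMR : ∀ i j, |M i j| ≤ R i j) (hR : ∀ i j, R i j = R j i)
    (hsum : ∀ i, ∑ j, R i j ≤ K) : ‖M‖ ≤ K := by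
  rw [cstar_norm_def]
  refine ContinuousLinearMap.opNorm_le_bound _ hK.le fun x => ?_
  set y := toEuclideanCLM (𝕜 := ℝ) M x with hy
  -- the weights in `2 |y i| |x j| ≤ y i ² / K + K x j ²` balance the two sides when `‖y‖ = K ‖x‖`
  have hR0 : ∀ i j, 0 ≤ R i j := fun i j => (abs_nonneg _).trans (hMR i j)
  have h1 : ‖y‖ ^ 2 ≤ ∑ i, ∑ j, R i j * (y i ^ 2 / K + K * x j ^ 2) / 2 := by
    have : ‖y‖ ^ 2 = ∑ i, ∑ j, y i * (M i j * x j) := by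
      rw [EuclideanSpace.real_norm_sq_eq]
      refine Finset.sum_congr rfl fun i _ => ?_
      rw [← Finset.mul_sum, sq]
      congr 1
    rw [this]
    refine Finset.sum_le_sum fun i _ => Finset.sum_le_sum fun j _ => ?_
    have e1 : y i * (M i j * x j) ≤ R i j * (|y i| * |x j|) := by
      calc y i * (M i j * x j) ≤ |y i * (M i j * x j)| := le_abs_self _
        _ = |M i j| * (|y i| * |x j|) := by rw [abs_mul, abs_mul]; ring
        _ ≤ _ := by gcongr; exact hMR i j
    have e2 : |y i| * |x j| ≤ (y i ^ 2 / K + K * x j ^ 2) / 2 := by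
      rw [← sq_abs (y i), ← sq_abs (x j)]
      have : 0 ≤ (|y i| - K * |x j|) ^ 2 / K := by positivity
      have e3 : (|y i| - K * |x j|) ^ 2 / K =
        |y i| ^ 2 / K + K * |x j| ^ 2 - 2 * (|y i| * |x j|) := by field_simp; ring
      linarith
    calc y i * (M i j * x j) ≤ R i j * (|y i| * |x j|) := e1
      _ ≤ R i j * ((y i ^ 2 / K + K * x j ^ 2) / 2) := by gcongr; exact hR0 i j
      _ = _ := by ring
  have h2 : ∑ i, ∑ j, R i j * (y i ^ 2 / K + K * x j ^ 2) / 2 ≤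
      (‖y‖ ^ 2 + K ^ 2 * ‖x‖ ^ 2) / 2 := by
    have e1 : ∑ i, ∑ j, R i j * (y i ^ 2 / K + K * x j ^ 2) / 2 =
        (∑ i, (y i ^ 2 / K) * ∑ j, R i j) / 2 + (∑ j, (K * x j ^ 2) * ∑ i, R j i) / 2 := by
      simp_rw [Finset.mul_sum]
      rw [Finset.sum_comm (f := fun j i => K * x j ^ 2 * R j i), Finset.sum_div, Finset.sum_div,
        ← Finset.sum_add_distrib]
      refine Finset.sum_congr rfl fun i _ => ?_
      rw [Finset.sum_div, Finset.sum_div, ← Finset.sum_add_distrib]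
      refine Finset.sum_congr rfl fun j _ => ?_
      rw [hR j i]; ring
    rw [e1, EuclideanSpace.real_norm_sq_eq, EuclideanSpace.real_norm_sq_eq, Finset.mul_sum, add_div]
    refine add_le_add (div_le_div_of_nonneg_right (Finset.sum_le_sum fun i _ => ?_) two_pos.le)
      (div_le_div_of_nonneg_right (Finset.sum_le_sum fun j _ => ?_) two_pos.le)
    · calc y i ^ 2 / K * ∑ j, R i j ≤ y i ^ 2 / K * K := by gcongr; exact hsum i
        _ = y i ^ 2 := by field_simp
    · calc K * x j ^ 2 * ∑ i, R j i ≤ K * x j ^ 2 * K := by gcongr; exact hsum j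
        _ = K ^ 2 * x j ^ 2 := by ring
  refine le_of_sq_le_sq ?_ (by positivity)
  rw [mul_pow]
  linarith

end RowSums

/-! ### Uniform bounds for kernels on the grid -/

section Grid

open Matrix
open scoped Matrix.Norms.L2Operator

variable {k N : ℕ}

lemma gridDist_nonneg (i j : Fin k → Fin N) : 0 ≤ gridDist i j := norm_nonneg _

lemma gridDist_comm (i j : Fin k → Fin N) : gridDist i j = gridDist j i := norm_sub_rev _ _

lemma gridDist_self (i : Fin k → Fin N) : gridDist i i = 0 := by simp [gridDist]

lemma gridDist_sq (i j : Fin k → Fin N) :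
    gridDist i j ^ 2 = ∑ a, (((i a : ℕ) : ℝ) - ((j a : ℕ) : ℝ)) ^ 2 := by
  rw [gridDist, EuclideanSpace.real_norm_sq_eq]
  refine Finset.sum_congr rfl fun a _ => ?_
  simp [gridPoint]

lemma abs_sub_le_gridDist (i j : Fin k → Fin N) (a : Fin k) :
    |((i a : ℕ) : ℝ) - ((j a : ℕ) : ℝ)| ≤ gridDist i j := by
  rw [← abs_of_nonneg (gridDist_nonneg i j), ← sq_le_sq, gridDist_sq]
  exact Finset.single_le_sum (f := fun a => (((i a : ℕ) : ℝ) - ((j a : ℕ) : ℝ)) ^ 2)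
    (fun b _ => sq_nonneg _) (Finset.mem_univ a)

lemma one_le_gridDist {i j : Fin k → Fin N} (h : i ≠ j) : 1 ≤ gridDist i j := by
  obtain ⟨a, ha⟩ := Function.ne_iff.1 h
  refine le_trans ?_ (abs_sub_le_gridDist i j a)
  have h1 : ((i a : ℕ) : ℤ) - ((j a : ℕ) : ℤ) ≠ 0 := by
    intro h0
    exact ha (Fin.ext (by omega))
  have := Int.one_le_abs h1
  exact_mod_cast this

/-- The sums `∑_j exp (-β D_ij)` are bounded uniformly in the size of the grid. -/
lemma exists_rowSum_exp_le (k : ℕ) {β : ℝ} (hβ : 0 < β) :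
    ∃ K : ℝ, 1 ≤ K ∧ ∀ (N : ℕ) (i : Fin k → Fin N),
      ∑ j, Real.exp (-β * gridDist i j) ≤ K := by
  rcases Nat.eq_zero_or_pos k with rfl | hk
  · refine ⟨1, le_rfl, fun N i => ?_⟩
    simp [Subsingleton.elim _ i, gridDist_self]
  have hk' : (0 : ℝ) < k := by exact_mod_cast hk
  set γ := β / k with hγ
  have hγ0 : 0 < γ := by positivity
  have hsum : Summable fun z : ℤ => Real.exp (-γ * |(z : ℝ)|) := by
    have h1 : Summable fun n : ℕ => Real.exp (-γ * |((n : ℤ) : ℝ)|) := by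
      have := Real.summable_exp_nat_mul_iff.2 (neg_lt_zero.2 hγ0)
      refine this.congr fun n => ?_
      rw [Int.cast_natCast, Nat.abs_cast, mul_comm]
    refine Summable.of_nat_of_neg h1 (h1.congr fun n => ?_)
    simp
  set T := ∑' z : ℤ, Real.exp (-γ * |(z : ℝ)|) with hT
  have hT1 : 1 ≤ T := by
    have := hsum.le_tsum 0 (fun z _ => (Real.exp_pos _).le)
    simpa [hT] using this
  -- the Euclidean distance is at least the `ℓ¹` distance over `k`, whose kernel is a product
  refine ⟨T ^ k, one_le_pow₀ hT1, fun N i => ?_⟩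
  calc ∑ j, Real.exp (-β * gridDist i j)
      ≤ ∑ j : Fin k → Fin N, ∏ a, Real.exp (-γ * |((i a : ℕ) : ℝ) - ((j a : ℕ) : ℝ)|) := by
        refine Finset.sum_le_sum fun j _ => ?_
        rw [← Real.exp_sum, Real.exp_le_exp, ← Finset.mul_sum]
        have : ∑ a, |((i a : ℕ) : ℝ) - ((j a : ℕ) : ℝ)| ≤ k * gridDist i j := by
          have := Finset.sum_le_sum fun a (_ : a ∈ Finset.univ) => abs_sub_le_gridDist i j a
          simpa using this
        have h2 : β = γ * k := by rw [hγ]; field_simp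
        rw [h2]
        nlinarith
    _ = ∏ a, ∑ m : Fin N, Real.exp (-γ * |((i a : ℕ) : ℝ) - ((m : ℕ) : ℝ)|) := by
        rw [Finset.prod_univ_sum, Fintype.piFinset_univ]
    _ ≤ ∏ _a : Fin k, T := by
        refine Finset.prod_le_prod (fun a _ => Finset.sum_nonneg fun _ _ => (Real.exp_pos _).le)
          fun a _ => ?_
        have hinj : Function.Injective fun m : Fin N => ((i a : ℕ) : ℤ) - ((m : ℕ) : ℤ) := by
          intro m m' h
          apply Fin.ext
          simp only at h
          omega
        have := hsum.comp_injective hinj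
        have h3 := tsum_comp_le_tsum_of_inj hsum (fun z => (Real.exp_pos _).le) hinj
        rw [tsum_fintype] at h3
        refine le_trans (le_of_eq ?_) h3
        refine Finset.sum_congr rfl fun m _ => ?_
        simp
    _ = T ^ k := by simp

/-- A kernel on the grid which decays exponentially with the distance has a bounded norm,
uniformly in the size of the grid. -/
lemma exists_norm_le_of_exp_decay (k : ℕ) {β : ℝ} (hβ : 0 < β) :
    ∃ K : ℝ, 1 ≤ K ∧ ∀ (N : ℕ) (B : ℝ) (M : Matrix (Fin k → Fin N) (Fin k → Fin N) ℝ),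
      0 ≤ B → (∀ i j, |M i j| ≤ B * Real.exp (-β * gridDist i j)) → ‖M‖ ≤ K * B := by
  obtain ⟨K, hK1, hK⟩ := exists_rowSum_exp_le k hβ
  refine ⟨K, hK1, fun N B M hB hM => ?_⟩
  -- Schur's test is stated for a positive bound, whereas `B` may vanish
  refine le_of_forall_pos_le_add fun ε hε => ?_
  have hB' : 0 < B + ε / K := by positivity
  have := norm_le_of_rowSum_le (M := M)
    (R := Matrix.of fun i j => (B + ε / K) * Real.exp (-β * gridDist i j)) (K := K * B + ε)
    (by positivity) (fun i j => (hM i j).trans ?_) (fun i j => ?_) (fun i => ?_)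
  · exact this
  · simp only [of_apply]
    gcongr
    have : 0 ≤ ε / K := by positivity
    linarith
  · simp only [of_apply, gridDist_comm i j]
  · simp only [of_apply, ← Finset.mul_sum]
    calc (B + ε / K) * ∑ j, Real.exp (-β * gridDist i j) ≤ (B + ε / K) * K := by
          gcongr; exact hK N i
      _ = K * B + ε := by field_simp

/-- A narrow Gaussian kernel is diagonally dominant, uniformly in the size of the grid. -/
lemma exists_gaussianKernel_coercive (k : ℕ) :
    ∃ s₀ : ℝ, 0 < s₀ ∧ ∀ (N : ℕ) (s : ℝ), s₀ ≤ s → ∀ x : GridData k N,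
      ‖x‖ ^ 2 / 2 ≤ ∑ i, ∑ j, x i * x j * Real.exp (-s * gridDist i j ^ 2) := by
  obtain ⟨K, hK1, hK⟩ := exists_norm_le_of_exp_decay k one_pos
  -- off the diagonal `exp (-s D²) ≤ exp (-(s - 1)) exp (-D)`, as `D ≥ 1`, and this choice of `s₀`
  -- makes the sum over a row at most `1 / 2`
  refine ⟨1 + Real.log (2 * K), by have := Real.log_nonneg (by linarith : 1 ≤ 2 * K); linarith,
    fun N s hs x => ?_⟩
  have hs1 : 0 ≤ s - 1 := by
    have := Real.log_nonneg (by linarith : 1 ≤ 2 * K)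
    linarith
  set G : Matrix (Fin k → Fin N) (Fin k → Fin N) ℝ :=
    Matrix.of fun i j => Real.exp (-s * gridDist i j ^ 2) with hG
  have hexp : Real.exp (-(s - 1)) ≤ 1 / (2 * K) := by
    rw [Real.exp_neg, one_div]
    gcongr
    rw [← Real.log_le_iff_le_exp (by positivity)]
    linarith
  have h1 : ‖G - 1‖ ≤ 1 / 2 := by
    refine (hK N (Real.exp (-(s - 1))) (G - 1) (Real.exp_pos _).le fun i j => ?_).trans ?_
    · by_cases hij : i = j
      · subst hij
        rw [Matrix.sub_apply, hG, of_apply, gridDist_self, one_apply_eq]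
        simp only [ne_eq, OfNat.ofNat_ne_zero, not_false_eq_true, zero_pow, mul_zero, Real.exp_zero,
          sub_self, abs_zero, mul_one]
        positivity
      · rw [Matrix.sub_apply, one_apply_ne hij, sub_zero, hG, of_apply, abs_of_pos (Real.exp_pos _),
          ← Real.exp_add, Real.exp_le_exp]
        have := one_le_gridDist hij
        nlinarith [mul_nonneg hs1 (sub_nonneg.2 this),
          mul_nonneg (by linarith : 0 ≤ s) (mul_nonneg (gridDist_nonneg i j) (sub_nonneg.2 this))]
    · calc K * Real.exp (-(s - 1)) ≤ K * (1 / (2 * K)) := by gcongr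
        _ = 1 / 2 := by field_simp
  have h2 := abs_quadForm_le (G - 1) x
  rw [quadForm_sub, quadForm_one] at h2
  have h3 : quadForm G x = ∑ i, ∑ j, x i * x j * Real.exp (-s * gridDist i j ^ 2) := by
    simp only [quadForm, dotProduct, mulVec, hG, of_apply, Finset.mul_sum]
    refine Finset.sum_congr rfl fun i _ => Finset.sum_congr rfl fun j _ => by ring
  rw [← h3]
  have h4 := (abs_le.1 (h2.trans (mul_le_mul_of_nonneg_right h1 (sq_nonneg _)))).1
  linarith

/-- The smallest eigenvalue of the exponential covariance is bounded below uniformly in the size of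
the grid. In the representation of `exp (-θ D)` as a mixture of Gaussian kernels, all kernels are
positive semidefinite, and the narrow ones, which carry positive mass, are diagonally dominant. -/
theorem exists_spatialCov_coercive (k : ℕ) {θ₁ : ℝ} (hθ₁ : 0 < θ₁) :
    ∃ c : ℝ, 0 < c ∧ ∀ (N : ℕ) (θ : ℝ), θ₁ ≤ θ → ∀ x : GridData k N,
      c * ‖x‖ ^ 2 ≤ quadForm (spatialCov k N θ) x := by
  obtain ⟨s₀, hs₀, hcoer⟩ := exists_gaussianKernel_coercive k
  -- the kernel at `v` is `exp (-s D²)` with `s = θ² / (4 v²)`, so that `s ≥ s₀` for `v ≤ v₀`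
  set v₀ := θ₁ / (2 * √s₀) with hv₀
  have hv₀0 : 0 < v₀ := by positivity
  refine ⟨v₀ * Real.exp (-v₀ ^ 2) / √Real.pi, by positivity, fun N θ hθ x => ?_⟩
  have hθ0 : 0 < θ := hθ₁.trans_le hθ
  set F : ℝ → ℝ := fun v =>
    ∑ i, ∑ j, x i * x j * Real.exp (-v ^ 2 - (θ * gridDist i j / 2) ^ 2 / v ^ 2) with hF
  have hFint : IntegrableOn F (Set.Ioi 0) := by
    refine integrable_finsetSum _ fun i _ => integrable_finsetSum _ fun j _ => ?_
    exact (integrableOn_exp_neg_sq_sub _).const_mul _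
  have hquad : quadForm (spatialCov k N θ) x = 2 / √Real.pi * ∫ v in Set.Ioi (0 : ℝ), F v := by
    rw [hF, integral_finsetSum _ fun i _ => integrable_finsetSum _ fun j _ =>
      (integrableOn_exp_neg_sq_sub _).const_mul _]
    simp only [quadForm, dotProduct, mulVec, spatialCov, of_apply, Finset.mul_sum]
    refine Finset.sum_congr rfl fun i _ => ?_
    rw [integral_finsetSum _ fun j _ => (integrableOn_exp_neg_sq_sub _).const_mul _,
      Finset.mul_sum]
    refine Finset.sum_congr rfl fun j _ => ?_
    have hD := gridDist_nonneg i j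
    rw [integral_const_mul, integral_exp_neg_sq_sub (by positivity),
      show -2 * (θ * gridDist i j / 2) = -θ * gridDist i j by ring]
    have : √Real.pi ≠ 0 := by positivity
    field_simp
  have hFeq : ∀ v : ℝ, F v = Real.exp (-v ^ 2) *
      ∑ i, ∑ j, x i * x j * Real.exp (-(θ ^ 2 / (4 * v ^ 2)) * gridDist i j ^ 2) := by
    intro v
    simp only [hF, Finset.mul_sum]
    refine Finset.sum_congr rfl fun i _ => Finset.sum_congr rfl fun j _ => ?_
    rw [sub_eq_add_neg, Real.exp_add]
    have : -((θ * gridDist i j / 2) ^ 2 / v ^ 2) = -(θ ^ 2 / (4 * v ^ 2)) * gridDist i j ^ 2 := by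
      field_simp; ring
    rw [this]; ring
  have hFnn : ∀ v, 0 ≤ F v := by
    intro v
    rw [hFeq]
    exact mul_nonneg (Real.exp_pos _).le
      (sum_gaussianKernel_nonneg (fun i => gridPoint i) (by positivity) _)
  have hFlow : ∀ v ∈ Set.Ioc 0 v₀, Real.exp (-v₀ ^ 2) * (‖x‖ ^ 2 / 2) ≤ F v := by
    rintro v ⟨hv0, hv⟩
    rw [hFeq]
    gcongr
    refine hcoer N _ ?_ x
    rw [le_div_iff₀ (by positivity)]
    have h1 : v * (2 * √s₀) ≤ θ₁ := by
      rwa [hv₀, le_div_iff₀ (by positivity)] at hv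
    calc s₀ * (4 * v ^ 2) = (v * (2 * √s₀)) ^ 2 := by
          rw [mul_pow, mul_pow, Real.sq_sqrt hs₀.le]; ring
      _ ≤ θ ^ 2 := by gcongr; exact h1.trans hθ
  have hint : Real.exp (-v₀ ^ 2) * (‖x‖ ^ 2 / 2) * v₀ ≤ ∫ v in Set.Ioi (0 : ℝ), F v := by
    calc Real.exp (-v₀ ^ 2) * (‖x‖ ^ 2 / 2) * v₀
        = ∫ _v in Set.Ioc 0 v₀, Real.exp (-v₀ ^ 2) * (‖x‖ ^ 2 / 2) := by
          rw [setIntegral_const]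
          simp [hv₀0.le]
          ring
      _ ≤ ∫ v in Set.Ioc 0 v₀, F v :=
          setIntegral_mono_on (integrableOn_const (by simp)) (hFint.mono_set Set.Ioc_subset_Ioi_self)
            measurableSet_Ioc hFlow
      _ ≤ _ := setIntegral_mono_set hFint (Eventually.of_forall hFnn)
          (Eventually.of_forall Set.Ioc_subset_Ioi_self)
  rw [hquad]
  calc v₀ * Real.exp (-v₀ ^ 2) / √Real.pi * ‖x‖ ^ 2
      = 2 / √Real.pi * (Real.exp (-v₀ ^ 2) * (‖x‖ ^ 2 / 2) * v₀) := by ring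
    _ ≤ _ := by gcongr

lemma isHermitian_spatialCov (k N : ℕ) (θ : ℝ) : (spatialCov k N θ).IsHermitian := by
  ext i j
  rw [conjTranspose_apply, spatialCov, of_apply, of_apply, gridDist_comm j i, star_trivial]

lemma posDef_spatialCov (k N : ℕ) {θ : ℝ} (hθ : 0 < θ) : (spatialCov k N θ).PosDef := by
  obtain ⟨c, hc, h⟩ := exists_spatialCov_coercive k hθ
  refine PosDef.of_dotProduct_mulVec_pos (isHermitian_spatialCov k N θ) fun x hx => ?_
  refine lt_of_lt_of_le ?_ (h N θ le_rfl (WithLp.toLp 2 x))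
  have : 0 < ‖WithLp.toLp 2 x‖ := norm_pos_iff.2 fun h0 => hx ((WithLp.toLp_eq_zero 2).1 h0)
  positivity

/-- The norm of the inverse of a coercive symmetric matrix. -/
lemma norm_inv_le_of_coercive {ι : Type*} [Fintype ι] [DecidableEq ι] {S : Matrix ι ι ℝ} {c : ℝ}
    (hc : 0 < c) (hS : IsUnit S.det) (h : ∀ x, c * ‖x‖ ^ 2 ≤ quadForm S x) : ‖S⁻¹‖ ≤ c⁻¹ := by
  rw [cstar_norm_def]
  refine ContinuousLinearMap.opNorm_le_bound _ (by positivity) fun x => ?_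
  set y := toEuclideanCLM (𝕜 := ℝ) S⁻¹ x with hy
  have hx : x = toEuclideanCLM (𝕜 := ℝ) S y := by
    apply WithLp.ofLp_injective 2
    rw [hy, ofLp_toEuclideanCLM, ofLp_toEuclideanCLM, mulVec_mulVec, mul_nonsing_inv _ hS,
      one_mulVec]
  have h1 := h y
  rw [show quadForm S y = inner ℝ y (toEuclideanCLM (𝕜 := ℝ) S y) from
    (inner_toEuclideanCLM S y y).symm, ← hx] at h1
  have h2 := h1.trans ((le_abs_self _).trans (abs_real_inner_le_norm y x))
  rcases (norm_nonneg y).eq_or_lt with h0 | h0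
  · rw [← h0]; positivity
  · rw [inv_mul_eq_div, le_div_iff₀ hc]
    nlinarith

end Grid

/-! ### Derivatives of the log-likelihood -/

section MatrixCalculus

open Matrix
open scoped Matrix.Norms.L2Operator

variable {ι : Type*} [Fintype ι] [DecidableEq ι]

lemma hasDerivAt_matrix_iff {M : ℝ → Matrix ι ι ℝ} {M' : Matrix ι ι ℝ} {t : ℝ} :
    HasDerivAt M M' t ↔ ∀ i j, HasDerivAt (fun s => M s i j) (M' i j) t := by
  constructor
  · intro h i j
    exact ((LinearMap.toContinuousLinearMap (Matrix.entryLinearMap ℝ ℝ i j)).hasFDerivAt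
      |>.comp_hasDerivAt t h)
  · intro h
    have h1 : ∀ A : Matrix ι ι ℝ, A = ∑ i, ∑ j, A i j • Matrix.single i j (1 : ℝ) := fun A => by
      conv_lhs => rw [Matrix.matrix_eq_sum_single A]
      simp [Matrix.smul_single]
    rw [h1 M', funext fun s => h1 (M s)]
    exact HasDerivAt.fun_sum fun i _ => HasDerivAt.fun_sum fun j _ => (h i j).smul_const _

/-- Jacobi's formula. -/
lemma hasDerivAt_det {M : ℝ → Matrix ι ι ℝ} {M' : Matrix ι ι ℝ} {t : ℝ}
    (h : HasDerivAt M M' t) :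
    HasDerivAt (fun s => (M s).det) ((M t).adjugate * M').trace t := by
  have h0 := hasDerivAt_matrix_iff.1 h
  have h1 : HasDerivAt (fun s => ∑ σ : Equiv.Perm ι, ((Equiv.Perm.sign σ : ℤ) : ℝ) *
      ∏ i, M s (σ i) i) (∑ σ : Equiv.Perm ι, ((Equiv.Perm.sign σ : ℤ) : ℝ) *
      ∑ i, (∏ j ∈ Finset.univ.erase i, M t (σ j) j) • M' (σ i) i) t :=
    HasDerivAt.fun_sum fun σ _ => HasDerivAt.const_mul _
      (HasDerivAt.fun_finsetProd fun i _ => h0 (σ i) i)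
  have h2 : (fun s => (M s).det) = fun s => ∑ σ : Equiv.Perm ι, ((Equiv.Perm.sign σ : ℤ) : ℝ) *
      ∏ i, M s (σ i) i := funext fun s => det_apply' (M s)
  rw [h2]
  refine h1.congr_deriv ?_
  have h3 : ((M t).adjugate * M').trace = ∑ i, ((M t).updateCol i (fun r => M' r i)).det := by
    refine Finset.sum_congr rfl fun i _ => ?_
    rw [← cramer_apply, cramer_eq_adjugate_mulVec]
    rfl
  rw [h3]
  simp_rw [det_apply', Finset.mul_sum]
  rw [Finset.sum_comm]
  refine Finset.sum_congr rfl fun i _ => Finset.sum_congr rfl fun σ _ => ?_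
  rw [← Finset.mul_prod_erase Finset.univ _ (Finset.mem_univ i)]
  congr 1
  rw [smul_eq_mul, mul_comm, updateCol_self]
  congr 1
  refine Finset.prod_congr rfl fun j hj => ?_
  rw [updateCol_ne (Finset.ne_of_mem_erase hj)]

lemma hasDerivAt_log_det {M : ℝ → Matrix ι ι ℝ} {M' : Matrix ι ι ℝ} {t : ℝ}
    (h : HasDerivAt M M' t) (hM : (M t).det ≠ 0) :
    HasDerivAt (fun s => Real.log (M s).det) ((M t)⁻¹ * M').trace t := by
  refine ((hasDerivAt_det h).log hM).congr_deriv ?_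
  rw [inv_def, smul_mul_assoc, trace_smul, Ring.inverse_eq_inv', smul_eq_mul, div_eq_inv_mul]

lemma hasDerivAt_matrix_inv {M : ℝ → Matrix ι ι ℝ} {M' : Matrix ι ι ℝ} {t : ℝ}
    (h : HasDerivAt M M' t) (hM : IsUnit (M t).det) :
    HasDerivAt (fun s => (M s)⁻¹) (-((M t)⁻¹ * M' * (M t)⁻¹)) t := by
  obtain ⟨u, hu⟩ := (Matrix.isUnit_iff_isUnit_det _).2 hM
  have h1 := hasFDerivAt_ringInverse (𝕜 := ℝ) u
  rw [hu] at h1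
  have h2 := h1.comp_hasDerivAt t h
  have h3 : (fun s => (M s)⁻¹) = Ring.inverse ∘ M :=
    funext fun s => nonsing_inv_eq_ringInverse (M s)
  rw [h3]
  refine h2.congr_deriv ?_
  have h4 : ((u⁻¹ : (Matrix ι ι ℝ)ˣ) : Matrix ι ι ℝ) = (M t)⁻¹ := by
    rw [← hu, Matrix.coe_units_inv]
  simp [h4]

lemma hasDerivAt_quadForm {M : ℝ → Matrix ι ι ℝ} {M' : Matrix ι ι ℝ} {t : ℝ}
    (h : HasDerivAt M M' t) (x : EuclideanSpace ℝ ι) :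
    HasDerivAt (fun s => quadForm (M s) x) (quadForm M' x) t := by
  have h0 := hasDerivAt_matrix_iff.1 h
  simp only [quadForm, dotProduct, mulVec]
  exact HasDerivAt.fun_sum fun i _ => HasDerivAt.const_mul _
    (HasDerivAt.fun_sum fun j _ => (h0 i j).mul_const _)

lemma hasDerivAt_trace {M : ℝ → Matrix ι ι ℝ} {M' : Matrix ι ι ℝ} {t : ℝ}
    (h : HasDerivAt M M' t) : HasDerivAt (fun s => (M s).trace) M'.trace t := by
  have h0 := hasDerivAt_matrix_iff.1 h
  simp only [trace, diag]
  exact HasDerivAt.fun_sum fun i _ => h0 i i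

end MatrixCalculus

section Likelihood

open Matrix
open scoped Matrix.Norms.L2Operator

variable {k N : ℕ}

/-- The `p`-th derivative in `θ` of the covariance matrix `Σ_θ`. -/
def covDeriv (k N p : ℕ) (θ : ℝ) : Matrix (Fin k → Fin N) (Fin k → Fin N) ℝ :=
  Matrix.of fun i j => (-gridDist i j) ^ p * Real.exp (-θ * gridDist i j)

/-- The precision matrix `Σ_θ⁻¹`. -/
def prec (k N : ℕ) (θ : ℝ) : Matrix (Fin k → Fin N) (Fin k → Fin N) ℝ := (spatialCov k N θ)⁻¹

/-- The matrix `Σ⁻¹ Σ' Σ⁻¹` of the quadratic form in the score. -/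
def scoreMat (k N : ℕ) (θ : ℝ) : Matrix (Fin k → Fin N) (Fin k → Fin N) ℝ :=
  prec k N θ * covDeriv k N 1 θ * prec k N θ

/-- The matrix `Σ⁻¹ Σ' Σ⁻¹ Σ' Σ⁻¹ - Σ⁻¹ Σ'' Σ⁻¹ / 2` of the quadratic form in the observed
information. -/
def hessMat (k N : ℕ) (θ : ℝ) : Matrix (Fin k → Fin N) (Fin k → Fin N) ℝ :=
  scoreMat k N θ * covDeriv k N 1 θ * prec k N θ -
    (1 / 2 : ℝ) • (prec k N θ * covDeriv k N 2 θ * prec k N θ)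

/-- The matrix `(Σ⁻¹ Σ'' - Σ⁻¹ Σ' Σ⁻¹ Σ') / 2`, whose trace is the deterministic part of the
observed information. -/
def traceMat (k N : ℕ) (θ : ℝ) : Matrix (Fin k → Fin N) (Fin k → Fin N) ℝ :=
  (1 / 2 : ℝ) • (prec k N θ * covDeriv k N 2 θ - scoreMat k N θ * covDeriv k N 1 θ)

/-- The derivative in `θ` of `-log f(x; θ)`. -/
def gradLoss (k N : ℕ) (θ : ℝ) (x : GridData k N) : ℝ :=
  (prec k N θ * covDeriv k N 1 θ).trace / 2 - quadForm (scoreMat k N θ) x / 2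

/-- The second derivative in `θ` of `-log f(x; θ)`. -/
def hessLoss (k N : ℕ) (θ : ℝ) (x : GridData k N) : ℝ :=
  (traceMat k N θ).trace + quadForm (hessMat k N θ) x

lemma covDeriv_zero (k N : ℕ) : covDeriv k N 0 = spatialCov k N := by
  ext θ i j
  simp [covDeriv, spatialCov]

lemma hasDerivAt_covDeriv (k N p : ℕ) (θ : ℝ) :
    HasDerivAt (covDeriv k N p) (covDeriv k N (p + 1) θ) θ := by
  rw [hasDerivAt_matrix_iff]
  intro i j
  simp only [covDeriv, of_apply]
  have h1 : HasDerivAt (fun s : ℝ => -s * gridDist i j) (-1 * gridDist i j) θ :=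
    (hasDerivAt_neg θ).mul_const _
  refine (h1.exp.const_mul _).congr_deriv ?_
  rw [pow_succ]; ring

lemma hasDerivAt_spatialCov (k N : ℕ) (θ : ℝ) :
    HasDerivAt (spatialCov k N) (covDeriv k N 1 θ) θ := by
  rw [← covDeriv_zero]
  exact hasDerivAt_covDeriv k N 0 θ

lemma det_spatialCov_pos (k N : ℕ) {θ : ℝ} (hθ : 0 < θ) : 0 < (spatialCov k N θ).det :=
  (posDef_spatialCov k N hθ).det_pos

lemma hasDerivAt_prec (k N : ℕ) {θ : ℝ} (hθ : 0 < θ) :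
    HasDerivAt (prec k N) (-scoreMat k N θ) θ :=
  hasDerivAt_matrix_inv (hasDerivAt_spatialCov k N θ) (det_spatialCov_pos k N hθ).ne'.isUnit

lemma card_grid (k N : ℕ) : (Fintype.card (Fin k → Fin N) : ℝ) = sampleSize k N := by
  simp [sampleSize]

lemma spatialDensity_pos (k N : ℕ) {θ : ℝ} (hθ : 0 < θ) (x : GridData k N) :
    0 < spatialDensity k N θ x := by
  have := det_spatialCov_pos k N hθ
  unfold spatialDensity
  positivity

lemma log_spatialDensity (k N : ℕ) {θ : ℝ} (hθ : 0 < θ) (x : GridData k N) :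
    Real.log (spatialDensity k N θ x) = -Real.log ((2 * Real.pi) ^ (sampleSize k N / 2)) -
      Real.log (spatialCov k N θ).det / 2 - quadForm (prec k N θ) x / 2 := by
  have hd := det_spatialCov_pos k N hθ
  have hs : 0 < √(spatialCov k N θ).det := Real.sqrt_pos.2 hd
  unfold spatialDensity
  rw [Real.log_mul (by positivity) (Real.exp_pos _).ne', Real.log_exp, one_div, Real.log_inv,
    Real.log_mul (by positivity) hs.ne', Real.log_sqrt hd.le, prec, quadForm]
  ring

lemma hasDerivAt_log_spatialDensity (k N : ℕ) {θ : ℝ} (hθ : 0 < θ) (x : GridData k N) :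
    HasDerivAt (fun t => Real.log (spatialDensity k N t x)) (-gradLoss k N θ x) θ := by
  have h1 := (hasDerivAt_log_det (hasDerivAt_spatialCov k N θ) (det_spatialCov_pos k N hθ).ne')
  have h2 := hasDerivAt_quadForm (hasDerivAt_prec k N hθ) x
  have h3 := ((h1.div_const 2).const_sub (-Real.log ((2 * Real.pi) ^ (sampleSize k N / 2)))).sub
    (h2.div_const 2)
  have h4 : (fun t => Real.log (spatialDensity k N t x)) =ᶠ[𝓝 θ] fun t =>
      -Real.log ((2 * Real.pi) ^ (sampleSize k N / 2)) -
      Real.log (spatialCov k N t).det / 2 - quadForm (prec k N t) x / 2 := by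
    filter_upwards [lt_mem_nhds hθ] with t ht using log_spatialDensity k N ht x
  refine (h3.congr_of_eventuallyEq h4).congr_deriv ?_
  have : quadForm (-scoreMat k N θ) x = -quadForm (scoreMat k N θ) x := by
    simp [quadForm, neg_mulVec]
  rw [this, gradLoss, prec]
  ring

lemma hasDerivAt_gradLoss (k N : ℕ) {θ : ℝ} (hθ : 0 < θ) (x : GridData k N) :
    HasDerivAt (fun t => gradLoss k N t x) (hessLoss k N θ x) θ := by
  have hP := hasDerivAt_prec k N hθ
  have hC := hasDerivAt_covDeriv k N 1 θ
  have h1 := hasDerivAt_trace (hP.mul hC)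
  have h2 := hasDerivAt_quadForm ((hP.mul hC).mul hP) x
  have h3 := (h1.div_const 2).sub (h2.div_const 2)
  refine h3.congr_deriv ?_
  rw [hessLoss, traceMat, trace_smul, smul_eq_mul]
  have e1 : (-scoreMat k N θ * covDeriv k N 1 θ + prec k N θ * covDeriv k N (1 + 1) θ) =
      prec k N θ * covDeriv k N 2 θ - scoreMat k N θ * covDeriv k N 1 θ := by
    rw [neg_mul]; abel
  have e2 : (-scoreMat k N θ * covDeriv k N 1 θ + prec k N θ * covDeriv k N (1 + 1) θ) *
      prec k N θ + (prec k N * covDeriv k N 1) θ * -scoreMat k N θ =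
      (-2 : ℝ) • hessMat k N θ := by
    rw [hessMat, Pi.mul_apply]
    have : prec k N θ * covDeriv k N 1 θ * scoreMat k N θ =
        scoreMat k N θ * covDeriv k N 1 θ * prec k N θ := by
      simp only [scoreMat, mul_assoc]
    rw [mul_neg, this, add_mul, neg_mul, neg_mul, smul_sub, smul_smul]
    norm_num
    rw [two_smul]
    abel
  rw [e2, e1, quadForm_smul]
  ring

lemma hasDerivAt_noisyLoss (k N : ℕ) {θ : ℝ} (hθ : 0 < θ) (σ : ℝ) (x : GridData k N) (w : ℝ) :
    HasDerivAt (fun t => noisyLoss (spatialDensity k N) 0 σ t x w)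
      (gradLoss k N θ x + σ * w) θ := by
  have h := ((hasDerivAt_log_spatialDensity k N hθ x).neg).add
    ((hasDerivAt_id θ).const_mul (σ * w))
  refine (h.congr_deriv (by ring)).congr_of_eventuallyEq (Eventually.of_forall fun t => ?_)
  simp [noisyLoss, loss]

lemma iteratedDeriv_two_noisyLoss (k N : ℕ) {θ : ℝ} (hθ : 0 < θ) (σ : ℝ) (x : GridData k N)
    (w : ℝ) :
    iteratedDeriv 2 (fun t => noisyLoss (spatialDensity k N) 0 σ t x w) θ = hessLoss k N θ x := by
  rw [iteratedDeriv_succ, iteratedDeriv_one]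
  have h : deriv (fun t => noisyLoss (spatialDensity k N) 0 σ t x w) =ᶠ[𝓝 θ]
      fun t => gradLoss k N t x + σ * w := by
    filter_upwards [lt_mem_nhds hθ] with t ht using (hasDerivAt_noisyLoss k N ht σ x w).deriv
  rw [h.deriv_eq]
  exact ((hasDerivAt_gradLoss k N hθ x).add_const _).deriv

lemma hess_eq (k N : ℕ) {θ : ℝ} (hθ : 0 < θ) (x : GridData k N) :
    hess (spatialDensity k N) θ x = hessLoss k N θ x := by
  rw [hess, iteratedDeriv_succ, iteratedDeriv_one]
  have h : deriv (fun t => Real.log (spatialDensity k N t x)) =ᶠ[𝓝 θ]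
      fun t => -gradLoss k N t x := by
    filter_upwards [lt_mem_nhds hθ] with t ht using (hasDerivAt_log_spatialDensity k N ht x).deriv
  rw [h.deriv_eq, (hasDerivAt_gradLoss k N hθ x).fun_neg.deriv, neg_neg]

lemma contDiff_det_of_entries {ι : Type*} [Fintype ι] [DecidableEq ι] {M : ℝ → Matrix ι ι ℝ}
    (h : ∀ i j, ContDiff ℝ 2 fun s => M s i j) : ContDiff ℝ 2 fun s => (M s).det := by
  simp_rw [det_apply']
  exact ContDiff.sum fun σ _ => contDiff_const.mul (contDiff_prod fun i _ => h _ _)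

/-- By Cramer's rule the precision matrix is an expression in determinants. -/
lemma contDiffOn_loss (k N : ℕ) (x : GridData k N) :
    ContDiffOn ℝ 2 (fun θ => loss (spatialDensity k N) 0 θ x) (Set.Ioi 0) := by
  have hentry : ∀ i j, ContDiff ℝ 2 fun s => spatialCov k N s i j := by
    intro i j
    simp only [spatialCov, of_apply]
    fun_prop
  have hdet := contDiff_det_of_entries hentry
  have hadj : ∀ i j, ContDiff ℝ 2 fun s => (spatialCov k N s).adjugate i j := by
    intro i j
    simp_rw [adjugate_apply]
    refine contDiff_det_of_entries fun a b => ?_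
    by_cases hab : a = j
    · subst hab
      simpa using contDiff_const
    · simpa [updateRow_ne hab] using hentry a b
  have hq : ContDiffOn ℝ 2 (fun s => (spatialCov k N s).det⁻¹ *
      ∑ i, x i * ∑ j, (spatialCov k N s).adjugate i j * x j) (Set.Ioi 0) := by
    refine ContDiffOn.mul (hdet.contDiffOn.inv fun s hs => (det_spatialCov_pos k N hs).ne') ?_
    exact (ContDiff.sum fun i _ => contDiff_const.mul
      (ContDiff.sum fun j _ => (hadj i j).mul contDiff_const)).contDiffOn
  have hl : ContDiffOn ℝ 2 (fun s => Real.log (spatialCov k N s).det) (Set.Ioi 0) :=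
    hdet.contDiffOn.log fun s hs => (det_spatialCov_pos k N hs).ne'
  refine ((contDiffOn_const (c := Real.log ((2 * Real.pi) ^ (sampleSize k N / 2)))).add
    ((hl.div_const 2).add (hq.div_const 2))).congr fun s hs => ?_
  have : quadForm (prec k N s) x = (spatialCov k N s).det⁻¹ *
      ∑ i, x i * ∑ j, (spatialCov k N s).adjugate i j * x j := by
    rw [prec, inv_def, quadForm_smul, Ring.inverse_eq_inv']
    rfl
  simp only [loss, Pi.zero_apply, add_zero]
  rw [log_spatialDensity k N hs, this]
  ring

lemma continuous_spatialDensity (k N : ℕ) (θ : ℝ) : Continuous (spatialDensity k N θ) := by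
  have := continuous_quadForm (spatialCov k N θ)⁻¹
  unfold quadForm at this
  unfold spatialDensity
  fun_prop

theorem regularityAssumption_spatial (k N : ℕ) :
    RegularityAssumption volume (spatialLaw k N) (spatialDensity k N) 0 (Set.Ioi 0) where
  convex := convex_Ioi 0
  isOpen := isOpen_Ioi
  measurable_density θ _ := (continuous_spatialDensity k N θ).measurable
  density_pos θ hθ x := spatialDensity_pos k N hθ x
  law_eq θ hθ := by
    rw [spatialLaw, multivariateGaussian_eq_withDensity (posDef_spatialCov k N hθ), card_grid]
    rfl
  contDiffOn := contDiffOn_loss k N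

end Likelihood

/-! ### Bounds uniform in the size of the grid -/

section Uniform

open Matrix
open scoped Matrix.Norms.L2Operator MatrixOrder

variable {k : ℕ}

/-- A family of matrix-valued functions on `S`, one for each size of the grid, which is bounded and
Lipschitz with respect to the operator norm, with a constant that does not depend on the size. -/
def UnifLip (S : Set ℝ) (F : ∀ N : ℕ, ℝ → Matrix (Fin k → Fin N) (Fin k → Fin N) ℝ) : Prop :=
  ∃ C : ℝ, 0 ≤ C ∧ ∀ N, ∀ θ ∈ S, ‖F N θ‖ ≤ C ∧ ∀ θ' ∈ S, ‖F N θ - F N θ'‖ ≤ C * |θ - θ'|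

namespace UnifLip

variable {S : Set ℝ} {F G : ∀ N : ℕ, ℝ → Matrix (Fin k → Fin N) (Fin k → Fin N) ℝ}

lemma mul (hF : UnifLip S F) (hG : UnifLip S G) : UnifLip S fun N θ => F N θ * G N θ := by
  obtain ⟨C, hC, hF⟩ := hF
  obtain ⟨D, hD, hG⟩ := hG
  refine ⟨2 * C * D, by positivity, fun N θ hθ => ⟨?_, fun θ' hθ' => ?_⟩⟩
  · calc ‖F N θ * G N θ‖ ≤ ‖F N θ‖ * ‖G N θ‖ := norm_mul_le _ _
      _ ≤ C * D := by gcongr; exacts [(hF N θ hθ).1, (hG N θ hθ).1]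
      _ ≤ 2 * C * D := by nlinarith [mul_nonneg hC hD]
  · have e : F N θ * G N θ - F N θ' * G N θ' =
        (F N θ - F N θ') * G N θ + F N θ' * (G N θ - G N θ') := by
      rw [sub_mul, mul_sub]; abel
    rw [e]
    calc _ ≤ ‖F N θ - F N θ'‖ * ‖G N θ‖ + ‖F N θ'‖ * ‖G N θ - G N θ'‖ :=
          (norm_add_le _ _).trans (add_le_add (norm_mul_le _ _) (norm_mul_le _ _))
      _ ≤ (C * |θ - θ'|) * D + C * (D * |θ - θ'|) := by
          gcongr
          exacts [(hF N θ hθ).2 θ' hθ', (hG N θ hθ).1, (hF N θ' hθ').1, (hG N θ hθ).2 θ' hθ']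
      _ = 2 * C * D * |θ - θ'| := by ring

lemma sub (hF : UnifLip S F) (hG : UnifLip S G) : UnifLip S fun N θ => F N θ - G N θ := by
  obtain ⟨C, hC, hF⟩ := hF
  obtain ⟨D, hD, hG⟩ := hG
  refine ⟨C + D, by positivity, fun N θ hθ => ⟨?_, fun θ' hθ' => ?_⟩⟩
  · exact (norm_sub_le _ _).trans (add_le_add (hF N θ hθ).1 (hG N θ hθ).1)
  · rw [sub_sub_sub_comm, add_mul]
    exact (norm_sub_le _ _).trans (add_le_add ((hF N θ hθ).2 θ' hθ') ((hG N θ hθ).2 θ' hθ'))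

lemma const_smul (c : ℝ) (hF : UnifLip S F) : UnifLip S fun N θ => c • F N θ := by
  obtain ⟨C, hC, hF⟩ := hF
  refine ⟨|c| * C, by positivity, fun N θ hθ => ⟨?_, fun θ' hθ' => ?_⟩⟩
  · rw [norm_smul, Real.norm_eq_abs]
    gcongr
    exact (hF N θ hθ).1
  · rw [← smul_sub, norm_smul, Real.norm_eq_abs, mul_assoc]
    gcongr
    exact (hF N θ hθ).2 θ' hθ'

lemma of_hasDerivAt (hS : Convex ℝ S)
    (hF : ∃ C, ∀ N, ∀ θ ∈ S, ‖F N θ‖ ≤ C) (hG : ∃ C, ∀ N, ∀ θ ∈ S, ‖G N θ‖ ≤ C)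
    (h : ∀ N, ∀ θ ∈ S, HasDerivAt (F N) (G N θ) θ) : UnifLip S F := by
  obtain ⟨C, hC⟩ := hF
  obtain ⟨D, hD⟩ := hG
  refine ⟨max (max C D) 0, le_max_right _ _, fun N θ hθ => ⟨?_, fun θ' hθ' => ?_⟩⟩
  · exact (hC N θ hθ).trans ((le_max_left _ _).trans (le_max_left _ _))
  · have := hS.norm_image_sub_le_of_norm_hasDerivWithin_le (f := F N) (f' := G N) (C := D)
      (fun t ht => (h N t ht).hasDerivWithinAt) (hD N) hθ' hθ
    rw [Real.norm_eq_abs] at this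
    refine this.trans ?_
    gcongr
    exact (le_max_right _ _).trans (le_max_left _ _)

end UnifLip

/-- Half of the exponential decay absorbs the power of the distance. -/
lemma exists_norm_covDeriv_le (k p : ℕ) {lo : ℝ} (hlo : 0 < lo) :
    ∃ C, ∀ N, ∀ θ ∈ Set.Ici lo, ‖covDeriv k N p θ‖ ≤ C := by
  obtain ⟨K, hK1, hK⟩ := exists_norm_le_of_exp_decay k (half_pos hlo)
  refine ⟨K * (p.factorial / (lo / 2) ^ p), fun N θ hθ => hK N _ _ (by positivity) fun i j => ?_⟩
  have hD := gridDist_nonneg i j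
  have h1 := Real.pow_div_factorial_le_exp (lo / 2 * gridDist i j) (by positivity) p
  rw [covDeriv, of_apply, abs_mul, abs_pow, abs_neg, abs_of_nonneg hD, abs_of_pos (Real.exp_pos _)]
  have h2 : gridDist i j ^ p ≤ (p.factorial / (lo / 2) ^ p) * Real.exp (lo / 2 * gridDist i j) := by
    rw [mul_pow, div_le_iff₀ (by positivity)] at h1
    rw [div_mul_eq_mul_div, le_div_iff₀ (by positivity)]
    linarith
  calc gridDist i j ^ p * Real.exp (-θ * gridDist i j)
      ≤ (p.factorial / (lo / 2) ^ p) * Real.exp (lo / 2 * gridDist i j) *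
        Real.exp (-lo * gridDist i j) := by
        gcongr
        exact Set.mem_Ici.1 hθ
    _ = (p.factorial / (lo / 2) ^ p) * Real.exp (-(lo / 2) * gridDist i j) := by
        rw [mul_assoc, ← Real.exp_add]
        congr 2; ring

lemma unifLip_covDeriv (k p : ℕ) {lo : ℝ} (hlo : 0 < lo) :
    UnifLip (Set.Ici lo) fun N => covDeriv k N p :=
  UnifLip.of_hasDerivAt (convex_Ici lo) (exists_norm_covDeriv_le k p hlo)
    (exists_norm_covDeriv_le k (p + 1) hlo) fun N θ _ => hasDerivAt_covDeriv k N p θ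

lemma unifLip_prec (k : ℕ) {lo : ℝ} (hlo : 0 < lo) :
    UnifLip (Set.Ici lo) fun N => prec k N := by
  obtain ⟨c, hc, hcoer⟩ := exists_spatialCov_coercive k hlo
  have hP : ∀ N, ∀ θ ∈ Set.Ici lo, ‖prec k N θ‖ ≤ c⁻¹ := fun N θ hθ =>
    norm_inv_le_of_coercive hc (det_spatialCov_pos k N (hlo.trans_le hθ)).ne'.isUnit (hcoer N θ hθ)
  obtain ⟨D, hD⟩ := exists_norm_covDeriv_le k 1 hlo
  refine UnifLip.of_hasDerivAt (G := fun N θ => -scoreMat k N θ) (convex_Ici lo) ⟨_, hP⟩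
    ⟨c⁻¹ * D * c⁻¹, fun N θ hθ => ?_⟩ fun N θ hθ => hasDerivAt_prec k N (hlo.trans_le hθ)
  have hD0 : 0 ≤ D := (norm_nonneg _).trans (hD N θ hθ)
  rw [norm_neg, scoreMat]
  calc _ ≤ ‖prec k N θ‖ * ‖covDeriv k N 1 θ‖ * ‖prec k N θ‖ :=
        (norm_mul_le _ _).trans (by gcongr; exact norm_mul_le _ _)
    _ ≤ c⁻¹ * D * c⁻¹ := by gcongr; exacts [hP N θ hθ, hD N θ hθ, hP N θ hθ]

lemma unifLip_scoreMat (k : ℕ) {lo : ℝ} (hlo : 0 < lo) :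
    UnifLip (Set.Ici lo) fun N => scoreMat k N :=
  ((unifLip_prec k hlo).mul (unifLip_covDeriv k 1 hlo)).mul (unifLip_prec k hlo)

lemma unifLip_hessMat (k : ℕ) {lo : ℝ} (hlo : 0 < lo) :
    UnifLip (Set.Ici lo) fun N => hessMat k N :=
  (((unifLip_scoreMat k hlo).mul (unifLip_covDeriv k 1 hlo)).mul (unifLip_prec k hlo)).sub
    ((((unifLip_prec k hlo).mul (unifLip_covDeriv k 2 hlo)).mul (unifLip_prec k hlo)).const_smul _)

lemma unifLip_traceMat (k : ℕ) {lo : ℝ} (hlo : 0 < lo) :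
    UnifLip (Set.Ici lo) fun N => traceMat k N :=
  (((unifLip_prec k hlo).mul (unifLip_covDeriv k 2 hlo)).sub
    ((unifLip_scoreMat k hlo).mul (unifLip_covDeriv k 1 hlo))).const_smul _

/-! ### The Fisher information grows linearly -/

lemma abs_trace_le {ι : Type*} [Fintype ι] [DecidableEq ι] (M : Matrix ι ι ℝ) :
    |M.trace| ≤ ‖M‖ * Fintype.card ι := by
  have h : ∀ i, |M i i| ≤ ‖M‖ := fun i => by
    have := abs_quadForm_le M (EuclideanSpace.single i 1)
    simpa [quadForm] using this
  calc |M.trace| ≤ ∑ i, |M i i| := Finset.abs_sum_le_sum_abs _ _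
    _ ≤ ∑ _i : ι, ‖M‖ := Finset.sum_le_sum fun i _ => h i
    _ = ‖M‖ * Fintype.card ι := by simp [mul_comm]

lemma trace_mul_nonneg_of_posSemidef {ι : Type*} [Fintype ι] [DecidableEq ι] {A B : Matrix ι ι ℝ}
    (hA : A.PosSemidef) (hB : B.PosSemidef) : 0 ≤ (A * B).trace := by
  obtain ⟨R, rfl⟩ := CStarAlgebra.nonneg_iff_eq_star_mul_self.mp hA.nonneg
  rw [mul_assoc, trace_mul_comm, star_eq_conjTranspose]
  exact (hB.mul_mul_conjTranspose_same R).trace_nonneg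

/-- `S⁻¹ ≥ K⁻¹` for a positive definite matrix `S` of norm at most `K`. -/
lemma posSemidef_inv_sub {ι : Type*} [Fintype ι] [DecidableEq ι] {S : Matrix ι ι ℝ}
    (hS : S.PosDef) {K : ℝ} (hK : 0 < K) (hSK : ‖S‖ ≤ K) :
    (S⁻¹ - K⁻¹ • (1 : Matrix ι ι ℝ)).PosSemidef := by
  set Q := CFC.sqrt S with hQ
  have hQQ : Q * Q = S := CFC.sqrt_mul_sqrt_self S hS.posSemidef.nonneg
  have hQt : Qᵀ = Q := by
    have := (CFC.sqrt_nonneg S).posSemidef.isHermitian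
    rwa [IsHermitian, conjTranspose_eq_transpose_of_trivial] at this
  have hdet : IsUnit S.det := hS.det_pos.ne'.isUnit
  refine PosSemidef.of_dotProduct_mulVec_nonneg
    (hS.inv.isHermitian.sub (by rw [IsHermitian, conjTranspose_smul, conjTranspose_one]; simp))
    fun x => ?_
  change 0 ≤ quadForm (S⁻¹ - K⁻¹ • (1 : Matrix ι ι ℝ)) (WithLp.toLp 2 x)
  set z : EuclideanSpace ℝ ι := WithLp.toLp 2 x
  rw [quadForm_sub, quadForm_smul, quadForm_one, sub_nonneg, inv_mul_le_iff₀ hK]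
  set y := toEuclideanCLM (𝕜 := ℝ) S⁻¹ z with hy
  have hz : z = toEuclideanCLM (𝕜 := ℝ) Q (toEuclideanCLM (𝕜 := ℝ) Q y) := by
    apply WithLp.ofLp_injective 2
    rw [hy, ofLp_toEuclideanCLM, ofLp_toEuclideanCLM, ofLp_toEuclideanCLM, mulVec_mulVec,
      mulVec_mulVec, hQQ, mul_nonsing_inv _ hdet, one_mulVec]
  have h1 : quadForm S⁻¹ z = ‖toEuclideanCLM (𝕜 := ℝ) Q y‖ ^ 2 := by
    have hSt : (S⁻¹)ᵀ = S⁻¹ := by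
      have := hS.inv.isHermitian
      rwa [IsHermitian, conjTranspose_eq_transpose_of_trivial] at this
    rw [← quadForm_one (toEuclideanCLM (𝕜 := ℝ) Q y), quadForm_toEuclideanCLM, hQt, mul_one, hQQ,
      hy, quadForm_toEuclideanCLM, hSt, mul_assoc, mul_nonsing_inv _ hdet, mul_one]
  have h2 : ‖Q‖ ^ 2 = ‖S‖ := by
    rw [sq, ← CStarRing.norm_star_mul_self, star_eq_conjTranspose,
      conjTranspose_eq_transpose_of_trivial, hQt, hQQ]
  rw [h1]
  calc ‖z‖ ^ 2 ≤ (‖Q‖ * ‖toEuclideanCLM (𝕜 := ℝ) Q y‖) ^ 2 := by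
        conv_lhs => rw [hz]
        gcongr
        exact (toEuclideanCLM (𝕜 := ℝ) Q).le_opNorm _
    _ = ‖S‖ * ‖toEuclideanCLM (𝕜 := ℝ) Q y‖ ^ 2 := by rw [mul_pow, h2]
    _ ≤ _ := by gcongr

/-- The bound `S⁻¹ ≥ K⁻¹` is applied to each of the two factors `S⁻¹` in turn. -/
lemma trace_inv_mul_inv_mul_ge {ι : Type*} [Fintype ι] [DecidableEq ι] {S D : Matrix ι ι ℝ}
    (hS : S.PosDef) (hD : D.IsHermitian) {K : ℝ} (hK : 0 < K) (hSK : ‖S‖ ≤ K) :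
    K⁻¹ ^ 2 * (D * D).trace ≤ (S⁻¹ * D * S⁻¹ * D).trace := by
  have hP := posSemidef_inv_sub hS hK hSK
  have h1 : 0 ≤ (D * (S⁻¹ - K⁻¹ • (1 : Matrix ι ι ℝ)) * D).trace := by
    have := hP.mul_mul_conjTranspose_same D
    rw [hD.eq] at this
    exact this.trace_nonneg
  have h2 : 0 ≤ ((S⁻¹ - K⁻¹ • (1 : Matrix ι ι ℝ)) * (D * S⁻¹ * D)).trace := by
    refine trace_mul_nonneg_of_posSemidef hP ?_
    have := hS.inv.posSemidef.mul_mul_conjTranspose_same D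
    rwa [hD.eq] at this
  simp only [mul_sub, sub_mul, trace_sub, mul_smul_comm, smul_mul_assoc, mul_one, one_mul,
    trace_smul, smul_eq_mul] at h1 h2
  have h3 : (S⁻¹ * (D * S⁻¹ * D)).trace = (S⁻¹ * D * S⁻¹ * D).trace := by
    simp only [mul_assoc]
  rw [h3] at h2
  have hK' : 0 < K⁻¹ := inv_pos.2 hK
  nlinarith [mul_le_mul_of_nonneg_left (sub_nonneg.1 h1) hK'.le]

/-- One coordinate is lowered by one, or raised to one if it vanishes. -/
lemma exists_gridDist_eq_one {N : ℕ} (hk : 1 ≤ k) (hN : 2 ≤ N) (i : Fin k → Fin N) :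
    ∃ j, gridDist i j = 1 := by
  set a : Fin k := ⟨0, hk⟩
  obtain ⟨m, hm⟩ : ∃ m : Fin N, (((i a : ℕ) : ℝ) - ((m : ℕ) : ℝ)) ^ 2 = 1 := by
    by_cases h0 : (i a : ℕ) = 0
    · exact ⟨⟨1, by omega⟩, by simp [h0]⟩
    · refine ⟨⟨(i a : ℕ) - 1, by omega⟩, ?_⟩
      rw [Nat.cast_sub (by omega)]
      simp
  refine ⟨Function.update i a m, ?_⟩
  have h : gridDist i (Function.update i a m) ^ 2 = 1 := by
    rw [gridDist_sq, Finset.sum_eq_single a, Function.update_self, hm]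
    · intro b _ hb
      rw [Function.update_of_ne hb, sub_self]
      simp
    · simp
  exact (pow_eq_one_iff_of_nonneg (gridDist_nonneg _ _) two_ne_zero).1 h

/-- The expected observed information at the true parameter is the Fisher information. -/
lemma traceMat_add_hessMat_mul_cov (k N : ℕ) {θ : ℝ} (hθ : 0 < θ) :
    (traceMat k N θ).trace + (hessMat k N θ * spatialCov k N θ).trace =
      (prec k N θ * covDeriv k N 1 θ * prec k N θ * covDeriv k N 1 θ).trace / 2 := by
  have hPS : prec k N θ * spatialCov k N θ = 1 :=
    nonsing_inv_mul _ (det_spatialCov_pos k N hθ).ne'.isUnit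
  have h : hessMat k N θ * spatialCov k N θ =
      scoreMat k N θ * covDeriv k N 1 θ - (1 / 2 : ℝ) • (prec k N θ * covDeriv k N 2 θ) := by
    rw [hessMat, sub_mul, mul_assoc _ (prec k N θ), hPS, mul_one, smul_mul_assoc,
      mul_assoc _ (prec k N θ), hPS, mul_one]
  rw [h, traceMat, scoreMat]
  simp only [trace_smul, trace_sub, smul_eq_mul]
  ring

lemma isHermitian_covDeriv (k N p : ℕ) (θ : ℝ) : (covDeriv k N p θ).IsHermitian := by
  ext i j
  rw [conjTranspose_apply, covDeriv, of_apply, of_apply, gridDist_comm j i, star_trivial]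

lemma transpose_covDeriv (k N p : ℕ) (θ : ℝ) : (covDeriv k N p θ)ᵀ = covDeriv k N p θ := by
  have := isHermitian_covDeriv k N p θ
  rwa [IsHermitian, conjTranspose_eq_transpose_of_trivial] at this

lemma transpose_prec (k N : ℕ) (θ : ℝ) : (prec k N θ)ᵀ = prec k N θ := by
  rw [prec, transpose_nonsing_inv, ← covDeriv_zero, transpose_covDeriv]

lemma transpose_scoreMat (k N : ℕ) (θ : ℝ) : (scoreMat k N θ)ᵀ = scoreMat k N θ := by
  simp only [scoreMat, transpose_mul, transpose_prec, transpose_covDeriv, mul_assoc]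

lemma transpose_hessMat (k N : ℕ) (θ : ℝ) : (hessMat k N θ)ᵀ = hessMat k N θ := by
  simp only [hessMat, scoreMat, transpose_sub, transpose_smul, transpose_mul, transpose_prec,
    transpose_covDeriv, mul_assoc]

/-- The Fisher information is at least proportional to the sample size: in
`tr (Σ⁻¹ Σ' Σ⁻¹ Σ') ≥ ‖Σ‖⁻² ∑ (Σ'_ij)²` every grid point has a neighbor at distance one. -/
lemma exists_information_ge (hk : 1 ≤ k) {θ : ℝ} (hθ : 0 < θ) :
    ∃ c : ℝ, 0 < c ∧ ∀ N, 2 ≤ N → c * sampleSize k N ≤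
      (traceMat k N θ).trace + (hessMat k N θ * spatialCov k N θ).trace := by
  obtain ⟨C, hC⟩ := exists_norm_covDeriv_le k 0 hθ
  set K := max C 1
  have hK : 0 < K := lt_of_lt_of_le one_pos (le_max_right _ _)
  refine ⟨K⁻¹ ^ 2 * Real.exp (-2 * θ) / 2, by positivity, fun N hN => ?_⟩
  rw [traceMat_add_hessMat_mul_cov k N hθ]
  have h1 := trace_inv_mul_inv_mul_ge (posDef_spatialCov k N hθ) (isHermitian_covDeriv k N 1 θ) hK
    (((congrArg (fun F => ‖F θ‖) (covDeriv_zero k N)).symm.le.trans (hC N θ Set.self_mem_Ici)).trans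
      (le_max_left _ _))
  have h2 : Real.exp (-2 * θ) * sampleSize k N ≤
      (covDeriv k N 1 θ * covDeriv k N 1 θ).trace := by
    rw [← card_grid, mul_comm, ← nsmul_eq_mul, ← Finset.card_univ, ← Finset.sum_const]
    simp only [trace, diag, Matrix.mul_apply]
    refine Finset.sum_le_sum fun i _ => ?_
    obtain ⟨j, hj⟩ := exists_gridDist_eq_one hk hN i
    refine le_trans (le_of_eq ?_) (Finset.single_le_sum (f := fun j =>
      covDeriv k N 1 θ i j * covDeriv k N 1 θ j i) (fun j _ => ?_) (Finset.mem_univ j))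
    · simp only [covDeriv, of_apply, gridDist_comm j i, hj]
      rw [mul_mul_mul_comm, ← Real.exp_add]
      norm_num
      ring
    · simp only [covDeriv, of_apply, gridDist_comm j i]
      exact mul_self_nonneg _
  have h3 := mul_le_mul_of_nonneg_left h2 (sq_nonneg K⁻¹)
  change _ ≤ (prec k N θ * covDeriv k N 1 θ * prec k N θ * covDeriv k N 1 θ).trace at h1
  linarith

/-! ### The neighbor average -/

/-- The adjacency matrix of the grid. -/
def adjMat (k N : ℕ) : Matrix (Fin k → Fin N) (Fin k → Fin N) ℝ := by
  classical exact Matrix.of fun i j => if gridDist i j = 1 then 1 else 0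

lemma transpose_adjMat (k N : ℕ) : (adjMat k N)ᵀ = adjMat k N := by
  ext i j
  simp only [adjMat, transpose_apply, of_apply, gridDist_comm j i]

lemma exists_norm_adjMat_le (k : ℕ) : ∃ C : ℝ, ∀ N, ‖adjMat k N‖ ≤ C := by
  obtain ⟨K, hK1, hK⟩ := exists_norm_le_of_exp_decay k one_pos
  refine ⟨K * Real.exp 1, fun N => hK N _ _ (Real.exp_pos _).le fun i j => ?_⟩
  simp only [adjMat, of_apply]
  split_ifs with h
  · rw [h, ← Real.exp_add]; simp
  · rw [abs_zero]; positivity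

lemma sum_neighborPairs (N : ℕ) (F : (Fin k → Fin N) → (Fin k → Fin N) → ℝ) :
    ∑ p ∈ neighborPairs k N, F p.1 p.2 = ∑ i, ∑ j, adjMat k N i j * F i j := by
  classical
  rw [neighborPairs, Finset.sum_filter, Fintype.sum_prod_type]
  refine Finset.sum_congr rfl fun i _ => Finset.sum_congr rfl fun j _ => ?_
  simp only [adjMat, of_apply, ite_mul, one_mul, zero_mul]

lemma neighborMean_eq {N : ℕ} (x : GridData k N) :
    neighborMean x = quadForm (adjMat k N) x / (neighborPairs k N).card := by
  rw [neighborMean, sum_neighborPairs N fun i j => x i * x j]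
  congr 1
  simp only [quadForm, dotProduct, mulVec, Finset.mul_sum]
  refine Finset.sum_congr rfl fun i _ => Finset.sum_congr rfl fun j _ => by ring

/-- The expectation of the sum of the products of neighbors. -/
lemma trace_adjMat_mul_cov (N : ℕ) (θ : ℝ) :
    (adjMat k N * spatialCov k N θ).trace = (neighborPairs k N).card * Real.exp (-θ) := by
  rw [← nsmul_eq_mul, ← Finset.sum_const, sum_neighborPairs N fun _ _ => Real.exp (-θ)]
  simp only [trace, diag, Matrix.mul_apply]
  refine Finset.sum_congr rfl fun i _ => Finset.sum_congr rfl fun j _ => ?_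
  simp only [adjMat, spatialCov, of_apply, gridDist_comm j i]
  split_ifs with h
  · rw [h]; simp
  · simp

lemma sampleSize_le_card_neighborPairs {N : ℕ} (hk : 1 ≤ k) (hN : 2 ≤ N) :
    sampleSize k N ≤ (neighborPairs k N).card := by
  choose nb hnb using exists_gridDist_eq_one (k := k) hk hN
  rw [← card_grid]
  norm_cast
  rw [← Finset.card_univ]
  refine Finset.card_le_card_of_injOn (fun i => (i, nb i)) (fun i _ => ?_) fun i _ j _ h => ?_
  · simp [neighborPairs, hnb]
  · exact (Prod.ext_iff.1 h).1

end Uniform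

/-! ### Moments and tails of Gaussian quadratic forms -/

section QuadraticForms

open Matrix
open scoped Matrix.Norms.L2Operator

variable {ι : Type*} [Fintype ι] [DecidableEq ι]

lemma integrable_quadForm (A S : Matrix ι ι ℝ) :
    Integrable (quadForm A) (multivariateGaussian 0 S) := by
  have h2 : Integrable (fun x : EuclideanSpace ℝ ι => ‖x‖ ^ 2) (multivariateGaussian 0 S) :=
    (IsGaussian.memLp_two_id (μ := multivariateGaussian (0 : EuclideanSpace ℝ ι) S)
      ).integrable_norm_pow two_ne_zero
  refine (h2.const_mul ‖A‖).mono' (continuous_quadForm A).aestronglyMeasurable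
    (Eventually.of_forall fun x => abs_quadForm_le A x)

lemma integral_quadForm (A : Matrix ι ι ℝ) {S : Matrix ι ι ℝ} (hS : S.PosSemidef) :
    ∫ x, quadForm A x ∂(multivariateGaussian 0 S) = (A * S).trace := by
  set μ := multivariateGaussian (0 : EuclideanSpace ℝ ι) S with hμ
  have hmem : ∀ i, MemLp (fun x : EuclideanSpace ℝ ι => x i) 2 μ := fun i =>
    (EuclideanSpace.proj (𝕜 := ℝ) i).comp_memLp' IsGaussian.memLp_two_id
  have hprod : ∀ i j, Integrable (fun x : EuclideanSpace ℝ ι => x i * x j) μ := fun i j =>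
    (hmem i).integrable_mul (hmem j)
  have hmean : ∀ i, ∫ x, x i ∂μ = 0 := fun i => by
    have := (EuclideanSpace.proj (𝕜 := ℝ) i).integral_comp_id_comm
      (μ := μ) IsGaussian.integrable_id
    simpa [hμ] using this
  have hcov : ∀ i j, ∫ x, x i * x j ∂μ = S i j := fun i j => by
    have h := covariance_eval_multivariateGaussian (μ := (0 : EuclideanSpace ℝ ι)) hS i j
    rw [covariance_eq_sub (hmem i) (hmem j), hmean, hmean, mul_zero, sub_zero] at h
    exact h
  obtain ⟨a, ha⟩ : ∃ a : ι → ι → ℝ, ∀ i j, A i j = a i j := ⟨fun i j => A i j, fun _ _ => rfl⟩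
  have hq : ∀ x : EuclideanSpace ℝ ι, quadForm A x = ∑ i, ∑ j, a i j * (x i * x j) := fun x => by
    simp only [quadForm, dotProduct, mulVec, Finset.mul_sum, ha]
    exact Finset.sum_congr rfl fun i _ => Finset.sum_congr rfl fun j _ => by ring
  simp_rw [hq]
  rw [integral_finsetSum _ fun i _ => integrable_finsetSum _ fun j _ => (hprod i j).const_mul _]
  simp only [trace, diag, Matrix.mul_apply, ha]
  refine Finset.sum_congr rfl fun i _ => ?_
  rw [integral_finsetSum _ fun j _ => (hprod i j).const_mul _]
  refine Finset.sum_congr rfl fun j _ => ?_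
  rw [integral_const_mul, hcov, ← hS.isHermitian.apply i j, star_trivial]

/-- Chernoff's bound, with a free exponent `t`, for a centred quadratic form in a Gaussian vector. -/
lemma measure_quadForm_ge_le {A S : Matrix ι ι ℝ} (hA : Aᵀ = A) (hS : S.PosSemidef)
    {b t u : ℝ} (hb : ‖A‖ * ‖S‖ ≤ b) (ht0 : 0 ≤ t) (ht : t * b ≤ 1 / 8) :
    multivariateGaussian 0 S {x | u ≤ |quadForm A x - (A * S).trace|} ≤
      ENNReal.ofReal (2 * Real.exp (-(t * u) + 2 * t ^ 2 * b ^ 2 * Fintype.card ι)) := by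
  have hside : ∀ s : ℝ, |s| = t →
      multivariateGaussian 0 S {x | t * u ≤ s * (quadForm A x - (A * S).trace)} ≤
        ENNReal.ofReal (Real.exp (-(t * u) + 2 * t ^ 2 * b ^ 2 * Fintype.card ι)) := by
    intro s hs
    have h1 := lintegral_exp_quadForm_le hA hS hb (t := s) (by rw [hs]; exact ht)
    rw [← sq_abs s, hs] at h1
    have hm := (continuous_quadForm A).measurable
    have h2 := mul_meas_ge_le_lintegral (μ := multivariateGaussian 0 S)
      (f := fun x => ENNReal.ofReal (Real.exp (s * (quadForm A x - (A * S).trace))))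
      (by fun_prop) (ENNReal.ofReal (Real.exp (t * u)))
    have h3 : {x | t * u ≤ s * (quadForm A x - (A * S).trace)} ⊆
        {x | ENNReal.ofReal (Real.exp (t * u)) ≤
          ENNReal.ofReal (Real.exp (s * (quadForm A x - (A * S).trace)))} := fun x hx =>
      ENNReal.ofReal_le_ofReal (Real.exp_le_exp.2 hx)
    have h4 : ENNReal.ofReal (Real.exp (t * u)) ≠ 0 := by simp [Real.exp_pos]
    calc _ ≤ _ := measure_mono h3
      _ ≤ ENNReal.ofReal (Real.exp (2 * t ^ 2 * b ^ 2 * Fintype.card ι)) /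
          ENNReal.ofReal (Real.exp (t * u)) := by
          rw [ENNReal.le_div_iff_mul_le (Or.inl h4) (Or.inl ENNReal.ofReal_ne_top), mul_comm]
          exact h2.trans h1
      _ = _ := by
          rw [← ENNReal.ofReal_div_of_pos (Real.exp_pos _), ← Real.exp_sub]
          congr 2; ring
  have hsub : {x | u ≤ |quadForm A x - (A * S).trace|} ⊆
      {x | t * u ≤ t * (quadForm A x - (A * S).trace)} ∪
      {x | t * u ≤ -t * (quadForm A x - (A * S).trace)} := by
    intro x hx
    rcases le_abs.1 (show u ≤ |quadForm A x - (A * S).trace| from hx) with h | h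
    · exact Or.inl (mul_le_mul_of_nonneg_left h ht0)
    · right
      change t * u ≤ -t * (quadForm A x - (A * S).trace)
      rw [neg_mul, ← mul_neg]
      exact mul_le_mul_of_nonneg_left h ht0
  refine (measure_mono hsub).trans ((measure_union_le _ _).trans ?_)
  rw [two_mul, ENNReal.ofReal_add (Real.exp_pos _).le (Real.exp_pos _).le]
  exact add_le_add (hside t (abs_of_nonneg ht0)) (hside (-t) (by rw [abs_neg, abs_of_nonneg ht0]))

/-- A centred quadratic form divided by the square root of the dimension, and the squared norm
divided by the dimension, have exponential moments bounded independently of the dimension. -/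
lemma lintegral_exp_abs_quadForm_add_norm_sq_le {A S : Matrix ι ι ℝ} (hA : Aᵀ = A)
    (hS : S.PosSemidef) (htr : S.trace = Fintype.card ι) (hn : 1 ≤ Fintype.card ι) {b τ : ℝ}
    (hb1 : 1 ≤ b) (hb : ‖A‖ * ‖S‖ ≤ b) (hb' : ‖S‖ ≤ b) (hτ : 0 < τ) (hτb : τ * b ≤ 1 / 16) :
    ∫⁻ x, ENNReal.ofReal (Real.exp (τ * |quadForm A x - (A * S).trace| / √(Fintype.card ι) +
      τ * ‖x‖ ^ 2 / Fintype.card ι + 1)) ∂(multivariateGaussian 0 S) ≤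
      ENNReal.ofReal (Real.exp 3) := by
  set n : ℝ := (Fintype.card ι : ℝ) with hndef
  have hn1 : 1 ≤ n := by rw [hndef]; exact_mod_cast hn
  have hsn : 1 ≤ √n := Real.one_le_sqrt.2 hn1
  have hsq : √n ^ 2 = n := Real.sq_sqrt (by linarith)
  have hτ1 : τ ≤ 1 / 16 := by nlinarith
  set Z : EuclideanSpace ℝ ι → ℝ := fun x => quadForm A x - (A * S).trace with hZ
  have hZm : Measurable Z := ((continuous_quadForm A).sub continuous_const).measurable
  have hmom : ∀ s : ℝ, |s| = 2 * τ / √n →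
      ∫⁻ x, ENNReal.ofReal (Real.exp (s * Z x)) ∂(multivariateGaussian 0 S) ≤
        ENNReal.ofReal (Real.exp 1) := by
    intro s hs
    refine (lintegral_exp_quadForm_le hA hS hb (t := s) ?_).trans
      (ENNReal.ofReal_le_ofReal (Real.exp_le_exp.2 ?_))
    · rw [hs, div_mul_eq_mul_div, div_le_iff₀ (by linarith)]
      nlinarith
    · rw [← sq_abs s, hs, div_pow, hsq, ← hndef]
      have : 2 * ((2 * τ) ^ 2 / n) * b ^ 2 * n = 8 * (τ * b) ^ 2 := by field_simp; ring
      rw [this]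
      have := pow_le_pow_left₀ (by positivity) hτb 2
      linarith
  have hnorm : ∫⁻ x, ENNReal.ofReal (Real.exp (2 * τ / n * ‖x‖ ^ 2)) ∂(multivariateGaussian 0 S) ≤
      ENNReal.ofReal (Real.exp 1) := by
    have h1 := lintegral_exp_quadForm_le (A := (1 : Matrix ι ι ℝ)) transpose_one hS
      (b := b) (t := 2 * τ / n) ?_ ?_
    · have hpt : ∀ x : EuclideanSpace ℝ ι, ENNReal.ofReal (Real.exp (2 * τ / n * ‖x‖ ^ 2)) =
          ENNReal.ofReal (Real.exp (2 * τ)) * ENNReal.ofReal (Real.exp (2 * τ / n *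
            (quadForm 1 x - ((1 : Matrix ι ι ℝ) * S).trace))) := by
        intro x
        rw [← ENNReal.ofReal_mul (Real.exp_pos _).le, ← Real.exp_add, quadForm_one, one_mul, htr]
        congr 2
        field_simp
        ring
      simp_rw [hpt]
      rw [lintegral_const_mul' _ _ ENNReal.ofReal_ne_top]
      refine (mul_le_mul_right h1 _).trans ?_
      rw [← ENNReal.ofReal_mul (Real.exp_pos _).le, ← Real.exp_add]
      refine ENNReal.ofReal_le_ofReal (Real.exp_le_exp.2 ?_)
      have : 2 * (2 * τ / n) ^ 2 * b ^ 2 * n = 8 * (τ * b) ^ 2 / n := by field_simp; ring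
      rw [← hndef, this]
      have h2 : 8 * (τ * b) ^ 2 / n ≤ 8 * (τ * b) ^ 2 := div_le_self (by positivity) hn1
      have := pow_le_pow_left₀ (by positivity) hτb 2
      linarith
    · refine le_trans ?_ hb'
      have : Nontrivial (Matrix ι ι ℝ) := by
        have : Nonempty ι := Fintype.card_pos_iff.1 hn
        infer_instance
      rw [CStarRing.norm_one, one_mul]
    · rw [abs_of_nonneg (by positivity), div_mul_eq_mul_div, div_le_iff₀ (by linarith)]
      nlinarith
  have hpt : ∀ x : EuclideanSpace ℝ ι,
      ENNReal.ofReal (Real.exp (τ * |Z x| / √n + τ * ‖x‖ ^ 2 / n + 1)) ≤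
        ENNReal.ofReal (Real.exp 1 / 2) * (ENNReal.ofReal (Real.exp ((2 * τ / √n) * Z x)) +
          ENNReal.ofReal (Real.exp (-(2 * τ / √n) * Z x)) +
          ENNReal.ofReal (Real.exp (2 * τ / n * ‖x‖ ^ 2))) := by
    intro x
    rw [← ENNReal.ofReal_add (Real.exp_pos _).le (Real.exp_pos _).le,
      ← ENNReal.ofReal_add (by positivity) (Real.exp_pos _).le,
      ← ENNReal.ofReal_mul (by positivity)]
    refine ENNReal.ofReal_le_ofReal ?_
    set p := τ * |Z x| / √n
    set q := τ * ‖x‖ ^ 2 / n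
    have h1 : Real.exp (2 * p) ≤ Real.exp (2 * τ / √n * Z x) +
        Real.exp (-(2 * τ / √n) * Z x) := by
      rcases abs_cases (Z x) with ⟨h, _⟩ | ⟨h, _⟩
      · have e : 2 * p = 2 * τ / √n * Z x := by simp only [p, h]; ring
        rw [e]; linarith [Real.exp_pos (-(2 * τ / √n) * Z x)]
      · have e : 2 * p = -(2 * τ / √n) * Z x := by simp only [p, h]; ring
        rw [e]; linarith [Real.exp_pos (2 * τ / √n * Z x)]
    have h2 : Real.exp (2 * τ / n * ‖x‖ ^ 2) = Real.exp q ^ 2 := by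
      rw [← Real.exp_nat_mul]
      congr 1
      simp only [q]; push_cast; ring
    have h3 : Real.exp (2 * p) = Real.exp p ^ 2 := by
      rw [← Real.exp_nat_mul]; norm_cast
    -- `exp p exp q ≤ (exp (2 p) + exp (2 q)) / 2` decouples the quadratic form from the norm
    rw [Real.exp_add, Real.exp_add, h2]
    rw [h3] at h1
    have h4 := sq_nonneg (Real.exp p - Real.exp q)
    have h5 := Real.exp_pos 1
    have h6 : Real.exp p * Real.exp q ≤ (Real.exp (2 * τ / √n * Z x) +
        Real.exp (-(2 * τ / √n) * Z x) + Real.exp q ^ 2) / 2 := by linarith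
    calc _ ≤ _ := mul_le_mul_of_nonneg_right h6 h5.le
      _ = _ := by ring
  calc _ ≤ _ := lintegral_mono hpt
    _ ≤ ENNReal.ofReal (Real.exp 1 / 2) * (ENNReal.ofReal (Real.exp 1) +
        ENNReal.ofReal (Real.exp 1) + ENNReal.ofReal (Real.exp 1)) := by
        rw [lintegral_const_mul' _ _ ENNReal.ofReal_ne_top,
          lintegral_add_left (by fun_prop), lintegral_add_left (by fun_prop)]
        gcongr
        · exact hmom _ (abs_of_nonneg (by positivity))
        · exact hmom _ (by rw [abs_neg]; exact abs_of_nonneg (by positivity))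
    _ ≤ ENNReal.ofReal (Real.exp 3) := by
        rw [← ENNReal.ofReal_add (Real.exp_pos _).le (Real.exp_pos _).le,
          ← ENNReal.ofReal_add (by positivity) (Real.exp_pos _).le,
          ← ENNReal.ofReal_mul (by positivity)]
        refine ENNReal.ofReal_le_ofReal ?_
        have h1 := Real.add_one_le_exp (1 : ℝ)
        have h2 : Real.exp 3 = Real.exp 1 ^ 3 := by rw [← Real.exp_nat_mul]; norm_num
        rw [h2]
        nlinarith [pow_pos (Real.exp_pos 1) 2]

end QuadraticForms

/-! ### Concentration of the observed information -/

section Hessian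

open Matrix
open scoped Matrix.Norms.L2Operator

instance isProbabilityMeasure_spatialLaw (k N : ℕ) (θ : ℝ) :
    IsProbabilityMeasure (spatialLaw k N θ) := by
  unfold spatialLaw
  infer_instance

lemma trace_spatialCov (k N : ℕ) (θ : ℝ) : (spatialCov k N θ).trace = sampleSize k N := by
  rw [← card_grid]
  simp [trace, spatialCov, gridDist_self]

lemma one_le_card_grid (k : ℕ) {N : ℕ} (hN : 1 ≤ N) : 1 ≤ Fintype.card (Fin k → Fin N) := by
  simpa using Nat.one_le_pow _ _ hN

lemma one_le_sampleSize (k : ℕ) {N : ℕ} (hN : 1 ≤ N) : 1 ≤ sampleSize k N :=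
  one_le_pow₀ (by exact_mod_cast hN)

lemma meanHess_eq (k N : ℕ) {θ₀ θ : ℝ} (hθ₀ : 0 < θ₀) (hθ : 0 < θ) :
    Integrable (hess (spatialDensity k N) θ) (spatialLaw k N θ₀) ∧
      meanHess (spatialLaw k N) (spatialDensity k N) θ₀ θ =
        (traceMat k N θ).trace + (hessMat k N θ * spatialCov k N θ₀).trace := by
  have hfun : hess (spatialDensity k N) θ = fun x =>
      (traceMat k N θ).trace + quadForm (hessMat k N θ) x := funext fun x => hess_eq k N hθ x
  have hint := integrable_quadForm (hessMat k N θ) (spatialCov k N θ₀)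
  refine ⟨?_, ?_⟩
  · rw [hfun]
    exact (integrable_const _).add hint
  · have : IsProbabilityMeasure (multivariateGaussian 0 (spatialCov k N θ₀)) := inferInstance
    rw [meanHess, hfun, spatialLaw, integral_add (integrable_const _) hint,
      integral_quadForm _ (posDef_spatialCov k N hθ₀).posSemidef]
    simp

/-- The fluctuation of the observed information at the true parameter. -/
def hessFluct (k N : ℕ) (θ₀ : ℝ) (x : GridData k N) : ℝ :=
  quadForm (hessMat k N θ₀) x - (hessMat k N θ₀ * spatialCov k N θ₀).trace

/-- The fluctuation of the observed information over a ball around the true parameter is controlled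
by that at the center, since the Hessian matrices are Lipschitz in the parameter. -/
lemma exists_hess_sub_meanHess_le (k : ℕ) {θ₀ : ℝ} (hθ₀ : 0 < θ₀) :
    ∃ C : ℝ, 0 < C ∧ ∀ N, ∀ θ, θ₀ / 2 ≤ θ → ∀ x : GridData k N,
      |hess (spatialDensity k N) θ x - meanHess (spatialLaw k N) (spatialDensity k N) θ₀ θ| ≤
        |hessFluct k N θ₀ x| + C * |θ - θ₀| * (‖x‖ ^ 2 + sampleSize k N) := by
  obtain ⟨C₁, hC₁, hH⟩ := unifLip_hessMat k (half_pos hθ₀)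
  obtain ⟨C₂, hC₂⟩ := exists_norm_covDeriv_le k 0 (half_pos hθ₀)
  have hmem : θ₀ ∈ Set.Ici (θ₀ / 2) := Set.mem_Ici.2 (by linarith)
  refine ⟨(C₁ + 1) * max C₂ 1, by positivity, fun N θ hθ x => ?_⟩
  have hθ' : 0 < θ := by linarith
  set ΔA := hessMat k N θ - hessMat k N θ₀ with hΔ
  have hΔn : ‖ΔA‖ ≤ (C₁ + 1) * |θ - θ₀| :=
    ((hH N θ hθ).2 θ₀ hmem).trans (by gcongr; linarith)
  rw [(meanHess_eq k N hθ₀ hθ').2, hess_eq k N hθ' x, hessLoss]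
  have e : (traceMat k N θ).trace + quadForm (hessMat k N θ) x -
      ((traceMat k N θ).trace + (hessMat k N θ * spatialCov k N θ₀).trace) =
      hessFluct k N θ₀ x + (quadForm ΔA x - (ΔA * spatialCov k N θ₀).trace) := by
    rw [hΔ, quadForm_sub, sub_mul, trace_sub, hessFluct]; ring
  rw [e]
  have hS : ‖spatialCov k N θ₀‖ ≤ max C₂ 1 := by
    rw [← covDeriv_zero]
    exact (hC₂ N θ₀ hmem).trans (le_max_left _ _)
  have h1 : |quadForm ΔA x| ≤ (C₁ + 1) * max C₂ 1 * |θ - θ₀| * ‖x‖ ^ 2 := by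
    refine (abs_quadForm_le ΔA x).trans ?_
    gcongr
    refine hΔn.trans ?_
    rw [mul_assoc]
    gcongr
    exact le_mul_of_one_le_left (abs_nonneg _) (le_max_right _ _)
  have h2 : |(ΔA * spatialCov k N θ₀).trace| ≤
      (C₁ + 1) * max C₂ 1 * |θ - θ₀| * sampleSize k N := by
    refine (abs_trace_le _).trans ?_
    rw [card_grid]
    have : 0 ≤ sampleSize k N := by unfold sampleSize; positivity
    gcongr
    calc ‖ΔA * spatialCov k N θ₀‖ ≤ ‖ΔA‖ * ‖spatialCov k N θ₀‖ := norm_mul_le _ _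
      _ ≤ ((C₁ + 1) * |θ - θ₀|) * max C₂ 1 := by gcongr
      _ = _ := by ring
  calc _ ≤ |hessFluct k N θ₀ x| + |quadForm ΔA x - (ΔA * spatialCov k N θ₀).trace| :=
        abs_add_le _ _
    _ ≤ |hessFluct k N θ₀ x| + (|quadForm ΔA x| + |(ΔA * spatialCov k N θ₀).trace|) := by
        gcongr; exact abs_sub _ _
    _ ≤ _ := by rw [mul_add]; gcongr

/-- Concentration of the observed information on a ball of radius `r`. The supremum of
`r² |H(θ; X) - H(θ)|` is at most `η V` for a variable `V` with a bounded exponential moment, and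
`exp (η V) ≤ 1 - η + η exp V` by convexity. -/
theorem exists_hessian_concentration (k : ℕ) {θ₀ : ℝ} (hθ₀ : 0 < θ₀) :
    ∃ L : ℝ, 0 < L ∧ ∀ N, 1 ≤ N → ∀ r η : ℝ, 0 < r → r ≤ θ₀ / 2 → η ≤ 1 →
      L * (r ^ 2 * √(sampleSize k N) + r ^ 3 * sampleSize k N) ≤ η →
      (∀ θ ∈ Metric.closedBall θ₀ r ∩ Set.Ioi 0,
        Integrable (hess (spatialDensity k N) θ) (spatialLaw k N θ₀)) ∧
      ∫⁻ x, hessSup (spatialLaw k N) (spatialDensity k N) (Set.Ioi 0) θ₀ r (-1) x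
        ∂(spatialLaw k N θ₀) ≤ ENNReal.ofReal (η * Real.exp 3) ∧
      ∫⁻ x, EReal.exp
        (hessSup (spatialLaw k N) (spatialDensity k N) (Set.Ioi 0) θ₀ r 1 x : EReal)
        ∂(spatialLaw k N θ₀) ≤ ENNReal.ofReal (Real.exp (η * Real.exp 3)) := by
  obtain ⟨C, hC, hdev⟩ := exists_hess_sub_meanHess_le k hθ₀
  obtain ⟨C₁, hC₁, hH⟩ := unifLip_hessMat k hθ₀
  obtain ⟨C₂, hC₂⟩ := exists_norm_covDeriv_le k 0 hθ₀
  set D := max C₂ 1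
  set b := (C₁ + 1) * D with hb
  have hD1 : 1 ≤ D := le_max_right _ _
  have hb1 : 1 ≤ b := by nlinarith
  have hbD : D ≤ b := by nlinarith
  set τ := 1 / (16 * b) with hτ
  have hτ0 : 0 < τ := by positivity
  have hτb : τ * b = 1 / 16 := by rw [hτ]; field_simp
  have hτ1 : τ ≤ 1 := by nlinarith
  refine ⟨(1 + C) / τ, by positivity, fun N hN r η hr hr2 hη1 hη => ?_⟩
  set n := sampleSize k N with hn
  have hn1 : 1 ≤ n := one_le_sampleSize k hN
  have hn0 : 0 < n := by linarith
  have hS : ‖spatialCov k N θ₀‖ ≤ D := by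
    rw [← covDeriv_zero]
    exact (hC₂ N θ₀ Set.self_mem_Ici).trans (le_max_left _ _)
  have hA : ‖hessMat k N θ₀‖ ≤ C₁ := (hH N θ₀ Set.self_mem_Ici).1
  set V : GridData k N → ℝ := fun x =>
    τ * |hessFluct k N θ₀ x| / √n + τ * ‖x‖ ^ 2 / n + 1 with hV
  have hV0 : ∀ x, 0 ≤ V x := fun x => by positivity
  have hexpV : ∫⁻ x, ENNReal.ofReal (Real.exp (V x)) ∂(spatialLaw k N θ₀) ≤
      ENNReal.ofReal (Real.exp 3) := by
    have := lintegral_exp_abs_quadForm_add_norm_sq_le (transpose_hessMat k N θ₀)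
      (posDef_spatialCov k N hθ₀).posSemidef (by rw [trace_spatialCov, card_grid])
      (one_le_card_grid k hN) hb1 ?_ (hS.trans hbD) hτ0 hτb.le
    · rw [card_grid] at this
      exact this
    · rw [hb]
      gcongr
      linarith
  have hη0 : 0 < η := lt_of_lt_of_le (by positivity) hη
  have hη' : (1 + C) * (r ^ 2 * √n + r ^ 3 * n) ≤ η * τ := by
    rwa [div_mul_eq_mul_div, div_le_iff₀ hτ0] at hη
  have hsup : ∀ s : ℝ, |s| = 1 → ∀ x, hessSup (spatialLaw k N) (spatialDensity k N) (Set.Ioi 0)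
      θ₀ r s x ≤ ENNReal.ofReal (η * V x) := by
    intro s hs x
    refine iSup₂_le fun θ hθ => ENNReal.ofReal_le_ofReal ?_
    have hθr : |θ - θ₀| ≤ r := by
      have := hθ.1
      rwa [Metric.mem_closedBall, Real.dist_eq] at this
    have h1 := hdev N θ (by linarith [(abs_le.1 hθr).1]) x
    set d := hess (spatialDensity k N) θ x -
      meanHess (spatialLaw k N) (spatialDensity k N) θ₀ θ
    have h2 : max (s * d) 0 ≤ |d| := by
      refine max_le ((le_abs_self _).trans ?_) (abs_nonneg _)
      rw [abs_mul, hs, one_mul]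
    have h3 : C * |θ - θ₀| * (‖x‖ ^ 2 + n) ≤ C * r * (‖x‖ ^ 2 + n) := by gcongr
    have h4 : r ^ 2 * |hessFluct k N θ₀ x| ≤ η * (τ * |hessFluct k N θ₀ x| / √n) := by
      rw [← mul_div_assoc, le_div_iff₀ (by positivity)]
      have : r ^ 2 * √n ≤ η * τ := by
        refine le_trans ?_ hη'
        have : 0 ≤ r ^ 3 * n := by positivity
        have h0 : 0 ≤ r ^ 2 * √n := by positivity
        nlinarith
      nlinarith [mul_le_mul_of_nonneg_right this (abs_nonneg (hessFluct k N θ₀ x))]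
    have h5 : C * (r ^ 3 * n) ≤ η * τ := by
      refine le_trans ?_ hη'
      have : 0 ≤ r ^ 3 * n := by positivity
      have h0 : 0 ≤ r ^ 2 * √n := by positivity
      nlinarith
    have h6 : r ^ 2 * (C * r * ‖x‖ ^ 2) ≤ η * (τ * ‖x‖ ^ 2 / n) := by
      rw [← mul_div_assoc, le_div_iff₀ hn0]
      nlinarith [mul_le_mul_of_nonneg_right h5 (sq_nonneg ‖x‖)]
    have h7 : r ^ 2 * (C * r * n) ≤ η * 1 := by
      nlinarith
    calc r ^ 2 * max (s * d) 0 ≤ r ^ 2 * (|hessFluct k N θ₀ x| + C * r * (‖x‖ ^ 2 + n)) := by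
          gcongr
          exact h2.trans (h1.trans (add_le_add le_rfl h3))
      _ = r ^ 2 * |hessFluct k N θ₀ x| + r ^ 2 * (C * r * ‖x‖ ^ 2) + r ^ 2 * (C * r * n) := by ring
      _ ≤ η * (τ * |hessFluct k N θ₀ x| / √n) + η * (τ * ‖x‖ ^ 2 / n) + η * 1 := by gcongr
      _ = η * V x := by rw [hV]; ring
  refine ⟨fun θ hθ => (meanHess_eq k N hθ₀ hθ.2).1, ?_, ?_⟩
  · calc _ ≤ ∫⁻ x, ENNReal.ofReal η * ENNReal.ofReal (Real.exp (V x)) ∂(spatialLaw k N θ₀) := by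
          refine lintegral_mono fun x => (hsup (-1) (by simp) x).trans ?_
          rw [← ENNReal.ofReal_mul hη0.le]
          refine ENNReal.ofReal_le_ofReal ?_
          gcongr
          linarith [Real.add_one_le_exp (V x)]
      _ ≤ ENNReal.ofReal (η * Real.exp 3) := by
          rw [lintegral_const_mul' _ _ ENNReal.ofReal_ne_top, ENNReal.ofReal_mul hη0.le]
          gcongr
  · calc _ ≤ ∫⁻ x, (ENNReal.ofReal (1 - η) + ENNReal.ofReal η * ENNReal.ofReal (Real.exp (V x)))
          ∂(spatialLaw k N θ₀) := by
          refine lintegral_mono fun x => ?_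
          have h1 : (hessSup (spatialLaw k N) (spatialDensity k N) (Set.Ioi 0) θ₀ r 1 x : EReal) ≤
              ((η * V x : ℝ) : EReal) := by
            refine (EReal.coe_ennreal_le_coe_ennreal_iff.2 (hsup 1 (by simp) x)).trans ?_
            rw [EReal.coe_ennreal_ofReal, max_eq_left (mul_nonneg hη0.le (hV0 x))]
          refine (EReal.exp_monotone h1).trans ?_
          rw [EReal.exp_coe, ← ENNReal.ofReal_mul hη0.le,
            ← ENNReal.ofReal_add (by linarith) (by positivity)]
          refine ENNReal.ofReal_le_ofReal ?_
          have := convexOn_exp.2 (Set.mem_univ 0) (Set.mem_univ (V x)) (sub_nonneg.2 hη1) hη0.le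
            (by ring)
          simpa using this
      _ ≤ ENNReal.ofReal (1 - η) + ENNReal.ofReal η * ENNReal.ofReal (Real.exp 3) := by
          rw [lintegral_add_left measurable_const, lintegral_const_mul' _ _ ENNReal.ofReal_ne_top,
            lintegral_const, measure_univ, mul_one]
          gcongr
      _ ≤ ENNReal.ofReal (Real.exp (η * Real.exp 3)) := by
          rw [← ENNReal.ofReal_mul hη0.le, ← ENNReal.ofReal_add (by linarith) (by positivity)]
          refine ENNReal.ofReal_le_ofReal ?_
          linarith [Real.add_one_le_exp (η * Real.exp 3)]

end Hessian

/-! ### Existence of admissible estimators -/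

section Existence

open Matrix

/-- Measurable selection of a first-order stationary point on `[0, 1]` of a function whose
derivative `h a` is continuous: the first point at which the derivative is nonnegative, or `1` if
there is none. -/
lemma exists_measurable_stationary {α : Type*} [MeasurableSpace α] {h : α → ℝ → ℝ}
    (hm : ∀ s, Measurable fun a => h a s) (hc : ∀ a, ContinuousOn (h a) (Set.Icc 0 1)) :
    ∃ T : α → ℝ, Measurable T ∧ ∀ a, T a ∈ Set.Icc (0 : ℝ) 1 ∧
      ∀ s ∈ Set.Icc (0 : ℝ) 1, 0 ≤ h a (T a) * (s - T a) := by
  set A : α → Set ℝ := fun a => {s ∈ Set.Icc (0 : ℝ) 1 | 0 ≤ h a s} ∪ {1} with hA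
  have hAsub : ∀ a, A a ⊆ Set.Icc 0 1 := by
    rintro a s (hs | rfl)
    · exact hs.1
    · simp
  have hAbdd : ∀ a, BddBelow (A a) := fun a => ⟨0, fun s hs => (hAsub a hs).1⟩
  have hAne : ∀ a, (A a).Nonempty := fun a => ⟨1, Or.inr rfl⟩
  have hAclosed : ∀ a, IsClosed (A a) := fun a =>
    ((hc a).preimage_isClosed_of_isClosed isClosed_Icc isClosed_Ici).union isClosed_singleton
  have hTmem : ∀ a, sInf (A a) ∈ A a := fun a => (hAclosed a).csInf_mem (hAne a) (hAbdd a)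
  refine ⟨fun a => sInf (A a), ?_, fun a => ⟨hAsub a (hTmem a), fun s hs => ?_⟩⟩
  · refine measurable_of_Iic fun c => ?_
    rcases lt_or_ge c 0 with hc0 | hc0
    · convert MeasurableSet.empty
      ext a
      simp only [Set.mem_preimage, Set.mem_Iic, Set.mem_empty_iff_false, iff_false, not_le]
      exact hc0.trans_le (hAsub a (hTmem a)).1
    rcases le_or_gt 1 c with hc1 | hc1
    · convert MeasurableSet.univ
      ext a
      simp only [Set.mem_preimage, Set.mem_Iic, Set.mem_univ, iff_true]
      exact (hAsub a (hTmem a)).2.trans hc1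
    have hmap : ∀ s : Set.Icc (0 : ℝ) 1, c * s ∈ Set.Icc (0 : ℝ) 1 := fun s =>
      ⟨mul_nonneg hc0 s.2.1, by nlinarith [s.2.1, s.2.2]⟩
    have hcont : ∀ a, Continuous fun s : Set.Icc (0 : ℝ) 1 => h a (c * s) := fun a =>
      (hc a).comp_continuous (by fun_prop) hmap
    -- for `0 ≤ c < 1`, the first nonnegative point is at most `c` if and only if the maximum of `h a`
    -- on `[0, c]` is nonnegative, which is a countable condition by continuity
    have heq : (fun a => sInf (A a)) ⁻¹' Set.Iic c = ⋂ n : ℕ, ⋃ m : ℕ,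
        {a | -(1 / ((n : ℝ) + 1)) <
          h a (c * (TopologicalSpace.denseSeq (Set.Icc (0 : ℝ) 1) m : ℝ))} := by
      ext a
      simp only [Set.mem_preimage, Set.mem_Iic, Set.mem_iInter, Set.mem_iUnion]
      constructor
      · intro hle n
        have h1 : sInf (A a) ∈ {s ∈ Set.Icc (0 : ℝ) 1 | 0 ≤ h a s} := by
          rcases hTmem a with h | h
          · exact h
          · rw [Set.mem_singleton_iff.1 h] at hle
            linarith
        obtain ⟨s, hs⟩ : ∃ s : Set.Icc (0 : ℝ) 1, c * s = sInf (A a) := by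
          rcases hc0.eq_or_lt with rfl | hc0
          · exact ⟨⟨0, by simp⟩, by simpa using le_antisymm h1.1.1 hle⟩
          · exact ⟨⟨sInf (A a) / c, div_nonneg h1.1.1 hc0.le, (div_le_one hc0).2 hle⟩, by
              simp only; field_simp⟩
        have hopen : IsOpen {s : Set.Icc (0 : ℝ) 1 | -(1 / ((n : ℝ) + 1)) < h a (c * s)} :=
          isOpen_lt continuous_const (hcont a)
        have hpos : (0 : ℝ) < 1 / ((n : ℝ) + 1) := by positivity
        obtain ⟨m, hm⟩ := (TopologicalSpace.denseRange_denseSeq (Set.Icc (0 : ℝ) 1)).exists_mem_open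
          hopen ⟨s, by
            change -(1 / ((n : ℝ) + 1)) < h a (c * s)
            rw [hs]; linarith [h1.2]⟩
        exact ⟨m, hm⟩
      · intro hn
        obtain ⟨s, -, hs⟩ := isCompact_univ.exists_isMaxOn
          (Set.univ_nonempty (α := Set.Icc (0 : ℝ) 1)) (hcont a).continuousOn
        have hnn : 0 ≤ h a (c * s) := by
          by_contra hneg
          obtain ⟨n, hn'⟩ := exists_nat_one_div_lt (neg_pos.2 (not_le.1 hneg))
          obtain ⟨m, hm'⟩ := hn n
          have h1 : h a (c * (TopologicalSpace.denseSeq (Set.Icc (0 : ℝ) 1) m : ℝ)) ≤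
            h a (c * s) := hs (Set.mem_univ _)
          have h2 : -(1 / ((n : ℝ) + 1)) <
            h a (c * (TopologicalSpace.denseSeq (Set.Icc (0 : ℝ) 1) m : ℝ)) := hm'
          linarith
        refine (csInf_le (hAbdd a) (Or.inl ⟨hmap s, hnn⟩)).trans ?_
        exact mul_le_of_le_one_right hc0 s.2.2
    rw [heq]
    exact MeasurableSet.iInter fun n => MeasurableSet.iUnion fun m =>
      measurableSet_lt measurable_const (hm _)
  · change 0 ≤ h a (sInf (A a)) * (s - sInf (A a))
    have hTa := hTmem a
    have hlb : ∀ u ∈ A a, sInf (A a) ≤ u := fun u hu => csInf_le (hAbdd a) hu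
    generalize sInf (A a) = T at hTa hlb ⊢
    have hT01 := hAsub a hTa
    have hneg : ∀ u ∈ Set.Ico 0 T, h a u < 0 := by
      intro u hu
      by_contra hu'
      have := hlb u (Or.inl ⟨⟨hu.1, hu.2.le.trans hT01.2⟩, not_lt.1 hu'⟩)
      exact absurd hu.2 (not_lt.2 this)
    -- at an endpoint the direction of descent points outwards; in between, the gradient vanishes
    rcases hT01.1.eq_or_lt with h0 | h0
    · have h1 : 0 ≤ h a T := by
        rcases hTa with h | h
        · exact h.2
        · rw [Set.mem_singleton_iff, ← h0] at h
          exact absurd h zero_ne_one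
      exact mul_nonneg h1 (by rw [← h0]; linarith [hs.1])
    · have hle : h a T ≤ 0 := by
        have hcT : ContinuousWithinAt (h a) (Set.Ico 0 T) T :=
          ((hc a) T hT01).mono fun u hu => ⟨hu.1, hu.2.le.trans hT01.2⟩
        have hcl : T ∈ closure (Set.Ico 0 T) := by
          rw [closure_Ico h0.ne]
          exact ⟨h0.le, le_rfl⟩
        exact hcT.closure_le hcl continuousWithinAt_const fun u hu => (hneg u hu).le
      rcases hTa with h | h
      · rw [le_antisymm hle h.2, zero_mul]
      · rw [Set.mem_singleton_iff] at h
        exact mul_nonneg_of_nonpos_of_nonpos hle (by rw [h]; linarith [hs.2])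

variable {k N : ℕ}

lemma measurable_det_of_entries {ι α : Type*} [Fintype ι] [DecidableEq ι] [MeasurableSpace α]
    {M : α → Matrix ι ι ℝ} (h : ∀ i j, Measurable fun s => M s i j) :
    Measurable fun s => (M s).det := by
  simp_rw [det_apply']
  exact Finset.measurable_sum _ fun σ _ => (Finset.measurable_prod _ fun i _ => h _ _).const_mul _

lemma measurable_mul_entries {ι α : Type*} [Fintype ι] [MeasurableSpace α]
    {A B : α → Matrix ι ι ℝ} (hA : ∀ i j, Measurable fun s => A s i j)
    (hB : ∀ i j, Measurable fun s => B s i j) (i j : ι) :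
    Measurable fun s => (A s * B s) i j := by
  simp_rw [Matrix.mul_apply]
  exact Finset.measurable_sum _ fun l _ => (hA i l).mul (hB l j)

lemma measurable_covDeriv (k N p : ℕ) (i j : Fin k → Fin N) :
    Measurable fun s => covDeriv k N p s i j := by
  simp only [covDeriv, of_apply]
  fun_prop

lemma measurable_prec (k N : ℕ) (i j : Fin k → Fin N) : Measurable fun s => prec k N s i j := by
  have hcov : ∀ i j, Measurable fun s => spatialCov k N s i j := by
    rw [← covDeriv_zero]
    exact measurable_covDeriv k N 0
  have h : ∀ s, prec k N s i j = (spatialCov k N s).det⁻¹ * (spatialCov k N s).adjugate i j :=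
    fun s => by rw [prec, inv_def, Ring.inverse_eq_inv', Matrix.smul_apply, smul_eq_mul]
  simp_rw [h, adjugate_apply]
  refine (measurable_det_of_entries hcov).inv.mul (measurable_det_of_entries fun a b => ?_)
  by_cases hab : a = j
  · subst hab
    simp
  · simpa [updateRow_ne hab] using hcov a b

/-- The derivative of the loss is jointly measurable in the parameter and the data. -/
lemma measurable_gradLoss {α : Type*} [MeasurableSpace α] {t : α → ℝ} {x : α → GridData k N}
    (ht : Measurable t) (hx : Measurable x) : Measurable fun a => gradLoss k N (t a) (x a) := by
  have h1 := measurable_mul_entries (measurable_prec k N) (measurable_covDeriv k N 1)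
  have h2 := measurable_mul_entries h1 (measurable_prec k N)
  have hx' : ∀ i, Measurable fun a => x a i := fun i => by fun_prop
  unfold gradLoss
  refine ((Finset.measurable_sum _ fun i _ => (h1 i i).comp ht).div_const 2).sub
    (Measurable.div_const ?_ 2)
  simp only [quadForm, dotProduct, mulVec]
  exact Finset.measurable_sum _ fun i _ => (hx' i).mul
    (Finset.measurable_sum _ fun j _ => ((h2 i j).comp ht).mul (hx' j))

lemma measurable_neighborMean : Measurable (neighborMean : GridData k N → ℝ) := by
  unfold neighborMean
  fun_prop

lemma measurable_initEstimator : Measurable (initEstimator : GridData k N → ℝ) :=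
  (Real.measurable_log.comp measurable_neighborMean).neg

lemma closedBall_subset_Ioi_iff {c r : ℝ} (hr : 0 ≤ r) :
    Metric.closedBall c r ⊆ Set.Ioi 0 ↔ 0 < c - r := by
  rw [Real.closedBall_eq_Icc]
  constructor
  · intro h
    exact h ⟨le_rfl, by linarith⟩
  · intro h t ht
    exact h.trans_le ht.1

lemma isConstrainedFOSP_iff (σ w : ℝ) (x : GridData k N) {B : Set ℝ} (hB : B ⊆ Set.Ioi 0) (θ : ℝ) :
    IsConstrainedFOSP (spatialDensity k N) 0 σ x w B θ ↔
      θ ∈ B ∧ ∀ t ∈ B, 0 ≤ (gradLoss k N θ x + σ * w) * (t - θ) := by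
  refine and_congr_right fun hθ => ?_
  rw [(hasDerivAt_noisyLoss k N (hB hθ) σ x w).deriv]

/-- An admissible estimator, with the value `1` where the ball is not contained in `(0, ∞)`. -/
theorem exists_isLocalEstimator (k N : ℕ) (σ : ℝ) {rad : ℝ} (hrad : 0 < rad) :
    ∃ est, IsLocalEstimator k N σ rad est := by
  classical
  set U : Set (GridData k N × ℝ) :=
    {p | 0 < neighborMean p.1 ∧ 0 < initEstimator p.1 - rad} with hU
  have hUm : MeasurableSet U :=
    (measurableSet_lt measurable_const (measurable_neighborMean.comp measurable_fst)).inter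
      (measurableSet_lt measurable_const
        ((measurable_initEstimator.comp measurable_fst).sub_const rad))
  -- the ball around the initial estimate is parametrized by `[0, 1]`
  set pt : GridData k N × ℝ → ℝ → ℝ := fun p s => initEstimator p.1 - rad + 2 * rad * s with hpt
  set h : GridData k N × ℝ → ℝ → ℝ := fun p s =>
    if p ∈ U then gradLoss k N (pt p s) p.1 + σ * p.2 else 0 with hh
  have hptm : ∀ s, Measurable fun p => pt p s := fun s =>
    ((measurable_initEstimator.comp measurable_fst).sub_const rad).add_const _
  have hhm : ∀ s, Measurable fun p => h p s := fun s =>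
    Measurable.ite hUm ((measurable_gradLoss (hptm s) measurable_fst).add
      (measurable_snd.const_mul σ)) measurable_const
  have hhc : ∀ p, ContinuousOn (h p) (Set.Icc 0 1) := by
    intro p
    by_cases hp : p ∈ U
    · simp only [hh, hp, if_true]
      intro s hs
      have hpos : 0 < pt p s := by
        have h1 := hp.2
        have h2 : 0 ≤ 2 * rad * s := mul_nonneg (by linarith) hs.1
        simp only [hpt]; linarith
      have h1 : ContinuousAt (fun s => gradLoss k N (pt p s) p.1) s :=
        ContinuousAt.comp (f := fun s => pt p s) (g := fun t => gradLoss k N t p.1)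
          (hasDerivAt_gradLoss k N hpos p.1).continuousAt
          (by simp only [hpt]; fun_prop)
      exact (h1.add continuousAt_const).continuousWithinAt
    · simp only [hh, hp, if_false]
      exact continuousOn_const
  obtain ⟨T, hTm, hT⟩ := exists_measurable_stationary hhm hhc
  refine ⟨fun x w => if (x, w) ∈ U then pt (x, w) (T (x, w)) else 1, ?_, ?_, ?_⟩
  · have h1 : Measurable fun p : GridData k N × ℝ => if p ∈ U then pt p (T p) else 1 :=
      Measurable.ite hUm (((measurable_initEstimator.comp measurable_fst).sub_const rad).add
        (hTm.const_mul _)) measurable_const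
    exact h1.aemeasurable
  · intro x w
    by_cases hp : (x, w) ∈ U
    · simp only [hp, if_true, Set.mem_Ioi, hpt]
      have h1 : 0 < initEstimator x - rad := hp.2
      have h2 : 0 ≤ 2 * rad * T (x, w) := mul_nonneg (by linarith) (hT (x, w)).1.1
      linarith
    · simp [hp]
  · intro x w hx hball
    have hp : (x, w) ∈ U := ⟨hx, (closedBall_subset_Ioi_iff hrad.le).1 hball⟩
    rw [isConstrainedFOSP_iff σ w x hball]
    simp only [hp, if_true]
    obtain ⟨⟨hT0, hT1⟩, hTs⟩ := hT (x, w)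
    rw [Real.closedBall_eq_Icc]
    refine ⟨⟨?_, ?_⟩, fun t ht => ?_⟩
    · simp only [hpt]
      nlinarith
    · simp only [hpt]
      nlinarith
    · have h1 := hTs ((t - (initEstimator x - rad)) / (2 * rad))
        ⟨div_nonneg (by linarith [ht.1]) (by linarith),
          (div_le_one (by linarith)).2 (by linarith [ht.2])⟩
      simp only [hh, hp, if_true] at h1
      have h2 : t - pt (x, w) (T (x, w)) =
          2 * rad * ((t - (initEstimator x - rad)) / (2 * rad) - T (x, w)) := by
        simp only [hpt]
        field_simp
        ring
      rw [h2, mul_left_comm]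
      exact mul_nonneg (by linarith) h1

end Existence

/-! ### Stationary points of strongly convex functions -/

section Deterministic

/-- If the derivative `g` of a function is strongly increasing near `θ₀` and small at `θ₀`, then
every constrained first-order stationary point in a ball that contains `θ₀` well inside is an
interior stationary point close to `θ₀`. -/
lemma stationary_of_strongly_monotone {g H : ℝ → ℝ} {θ₀ a c₀ ρ c M t : ℝ}
    (hg : ∀ s, |s - θ₀| ≤ a → HasDerivAt g (H s) s) (hc : 0 < c)
    (hH : ∀ s, |s - θ₀| ≤ a → c ≤ H s) (hc₀ : |c₀ - θ₀| ≤ ρ / 2) (hρ : 3 * ρ / 2 ≤ a)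
    (hM : |g θ₀| ≤ M) (hMρ : M / c < ρ / 2)
    (ht : t ∈ Metric.closedBall c₀ ρ) (hst : ∀ s ∈ Metric.closedBall c₀ ρ, 0 ≤ g t * (s - t)) :
    |t - θ₀| ≤ M / c ∧ g t = 0 := by
  rw [Real.closedBall_eq_Icc] at ht hst
  obtain ⟨h1, h2⟩ := abs_le.1 hc₀
  have hρ0 : 0 ≤ ρ := by linarith [abs_nonneg (c₀ - θ₀)]
  have hmono : ∀ x ∈ Set.Icc (θ₀ - a) (θ₀ + a), ∀ y ∈ Set.Icc (θ₀ - a) (θ₀ + a), x ≤ y →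
      c * (y - x) ≤ g y - g x := by
    have habs : ∀ s ∈ Set.Icc (θ₀ - a) (θ₀ + a), |s - θ₀| ≤ a := fun s hs =>
      abs_le.2 ⟨by linarith [hs.1], by linarith [hs.2]⟩
    refine (convex_Icc _ _).mul_sub_le_image_sub_of_le_deriv
      (fun s hs => (hg s (habs s hs)).continuousAt.continuousWithinAt)
      (fun s hs => (hg s (habs s (interior_subset hs))).differentiableAt.differentiableWithinAt)
      fun s hs => ?_
    rw [(hg s (habs s (interior_subset hs))).deriv]
    exact hH s (habs s (interior_subset hs))
  have htI : t ∈ Set.Icc (θ₀ - a) (θ₀ + a) := ⟨by linarith [ht.1], by linarith [ht.2]⟩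
  have h0I : θ₀ ∈ Set.Icc (θ₀ - a) (θ₀ + a) := ⟨by linarith, by linarith⟩
  have h0B : θ₀ ∈ Set.Icc (c₀ - ρ) (c₀ + ρ) := ⟨by linarith, by linarith⟩
  have hst0 := hst θ₀ h0B
  have hkey : c * |t - θ₀| ≤ M := by
    obtain ⟨hM1, hM2⟩ := abs_le.1 hM
    rcases lt_trichotomy t θ₀ with h | h | h
    · have h3 := hmono t htI θ₀ h0I h.le
      have h4 : 0 ≤ g t := nonneg_of_mul_nonneg_left hst0 (by linarith)
      rw [abs_of_neg (by linarith)]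
      linarith
    · rw [h, sub_self, abs_zero, mul_zero]
      exact (abs_nonneg _).trans hM
    · have h3 := hmono θ₀ h0I t htI h.le
      have h4 : g t ≤ 0 := by
        by_contra h5
        nlinarith [mul_pos (not_le.1 h5) (sub_pos.2 h)]
      rw [abs_of_pos (by linarith)]
      linarith
  have hclose : |t - θ₀| ≤ M / c := by rwa [le_div_iff₀ hc, mul_comm]
  refine ⟨hclose, ?_⟩
  obtain ⟨h3, h4⟩ := abs_lt.1 (hclose.trans_lt hMρ)
  have h5 := hst (c₀ - ρ) ⟨le_rfl, by linarith⟩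
  have h6 := hst (c₀ + ρ) ⟨by linarith, le_rfl⟩
  -- `t` is interior, so that the variational inequality at both endpoints forces `g t = 0`
  refine le_antisymm ?_ (nonneg_of_mul_nonneg_left h6 (by linarith))
  by_contra h7
  nlinarith [mul_pos (not_le.1 h7) (show 0 < t - (c₀ - ρ) by linarith)]

/-- Stability of the initial estimator: an error `ε` in the neighbor average, whose mean is
`exp (-θ)`, becomes an error `O(ε)` in `θ`. -/
lemma abs_neg_log_sub_le {m θ ε : ℝ} (hm : |m - Real.exp (-θ)| ≤ ε)
    (hε : ε ≤ Real.exp (-θ) / 2) :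
    0 < m ∧ |-Real.log m - θ| ≤ 2 * Real.exp θ * ε := by
  obtain ⟨h1, h2⟩ := abs_le.1 hm
  have he := Real.exp_pos (-θ)
  have hm0 : 0 < m := by linarith
  have hee : Real.exp θ * Real.exp (-θ) = 1 := by rw [← Real.exp_add]; simp
  have heθ := Real.exp_pos θ
  refine ⟨hm0, ?_⟩
  set u := Real.exp θ * m with hu
  have hu0 : 0 < u := by positivity
  have hlog : Real.log u = θ + Real.log m := by
    rw [hu, Real.log_mul heθ.ne' hm0.ne', Real.log_exp]
  have hu1 : |u - 1| ≤ Real.exp θ * ε := by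
    rw [hu, ← hee, ← mul_sub, abs_mul, abs_of_pos heθ]
    gcongr
  have hu2 : 1 / 2 ≤ u := by nlinarith
  have h3 := Real.log_le_sub_one_of_pos hu0
  have h4 := Real.one_sub_inv_le_log_of_pos hu0
  have h5 : u⁻¹ ≤ 2 := by
    rw [inv_le_comm₀ hu0 two_pos]; linarith
  obtain ⟨h6, h7⟩ := abs_le.1 hu1
  rw [show -Real.log m - θ = -Real.log u by rw [hlog]; ring, abs_neg, abs_le]
  have h8 : 1 - u⁻¹ = u⁻¹ * (u - 1) := by field_simp
  have h9 : 0 < u⁻¹ := inv_pos.2 hu0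
  have h10 : -(2 * Real.exp θ * ε) ≤ u⁻¹ * (u - 1) := by
    rcases le_or_gt 0 (u - 1) with h | h
    · have : 0 ≤ u⁻¹ * (u - 1) := mul_nonneg h9.le h
      nlinarith [abs_nonneg (u - 1)]
    · nlinarith
  constructor
  · linarith
  · nlinarith [abs_nonneg (u - 1)]

end Deterministic

/-! ### Consistency of admissible estimators -/

section Consistency

open Matrix
open scoped Matrix.Norms.L2Operator

/-- The rate `√(log n / n)`. -/
def rate (k N : ℕ) : ℝ := √(Real.log (sampleSize k N) / sampleSize k N)

lemma rate_nonneg (k N : ℕ) : 0 ≤ rate k N := Real.sqrt_nonneg _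

lemma sampleSize_mul_rate_sq (k : ℕ) {N : ℕ} (hN : 1 ≤ N) :
    sampleSize k N * rate k N ^ 2 = Real.log (sampleSize k N) := by
  have h1 := one_le_sampleSize k hN
  have h2 := Real.log_nonneg h1
  rw [rate, Real.sq_sqrt (by positivity)]
  field_simp

/-- On the event that the fluctuation of the observed information at `θ₀` and the norm of the data
are moderate, the negative log-likelihood is strongly convex near `θ₀`. -/
lemma exists_hessLoss_ge {k : ℕ} (hk : 1 ≤ k) {θ₀ : ℝ} (hθ₀ : 0 < θ₀) :
    ∃ c a : ℝ, 0 < c ∧ 0 < a ∧ a ≤ θ₀ / 2 ∧ ∀ N, 2 ≤ N → ∀ x : GridData k N,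
      |hessFluct k N θ₀ x| ≤ c * sampleSize k N → ‖x‖ ^ 2 ≤ 2 * sampleSize k N →
      ∀ θ, |θ - θ₀| ≤ a → c * sampleSize k N ≤ hessLoss k N θ x := by
  obtain ⟨C, hC, hdev⟩ := exists_hess_sub_meanHess_le k hθ₀
  obtain ⟨c, hc, hinfo⟩ := exists_information_ge hk hθ₀
  obtain ⟨C₁, hC₁, hH⟩ := unifLip_hessMat k (half_pos hθ₀)
  obtain ⟨C₃, hC₃, hT⟩ := unifLip_traceMat k (half_pos hθ₀)
  obtain ⟨C₂', hC₂'⟩ := exists_norm_covDeriv_le k 0 (half_pos hθ₀)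
  set C₂ := max C₂' 1
  have hC₂0 : 0 < C₂ := lt_of_lt_of_le one_pos (le_max_right _ _)
  have hmem : θ₀ ∈ Set.Ici (θ₀ / 2) := Set.mem_Ici.2 (by linarith)
  set D := C₃ + C₁ * C₂ + 3 * C with hD
  have hD0 : 0 < D := by positivity
  refine ⟨c / 4, min (θ₀ / 2) (c / (4 * D)), by positivity, by positivity, min_le_left _ _,
    fun N hN x hZ hx θ hθ => ?_⟩
  set n := sampleSize k N
  have hn : 0 < n := lt_of_lt_of_le one_pos (one_le_sampleSize k (by omega))
  have hθ1 : |θ - θ₀| ≤ θ₀ / 2 := hθ.trans (min_le_left _ _)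
  have hθ2 : |θ - θ₀| * D ≤ c / 4 := by
    have := hθ.trans (min_le_right _ _)
    rw [le_div_iff₀ (by positivity)] at this
    linarith
  have hθmem : θ₀ / 2 ≤ θ := by linarith [(abs_le.1 hθ1).1]
  have hθ0 : 0 < θ := by linarith
  have h1 := hdev N θ hθmem x
  rw [hess_eq k N hθ0, (meanHess_eq k N hθ₀ hθ0).2] at h1
  have h2 := hinfo N hN
  have h3 : |(traceMat k N θ).trace - (traceMat k N θ₀).trace| ≤ C₃ * |θ - θ₀| * n := by
    rw [← trace_sub]
    refine (abs_trace_le _).trans ?_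
    rw [card_grid]
    gcongr
    exact (hT N θ hθmem).2 θ₀ hmem
  have h4 : |(hessMat k N θ * spatialCov k N θ₀).trace -
      (hessMat k N θ₀ * spatialCov k N θ₀).trace| ≤ C₁ * C₂ * |θ - θ₀| * n := by
    rw [← trace_sub, ← sub_mul]
    refine (abs_trace_le _).trans ?_
    rw [card_grid]
    gcongr
    have hS : ‖spatialCov k N θ₀‖ ≤ C₂ := by
      rw [← covDeriv_zero]
      exact (hC₂' N θ₀ hmem).trans (le_max_left _ _)
    calc _ ≤ ‖hessMat k N θ - hessMat k N θ₀‖ * ‖spatialCov k N θ₀‖ := norm_mul_le _ _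
      _ ≤ (C₁ * |θ - θ₀|) * C₂ := by gcongr; exact (hH N θ hθmem).2 θ₀ hmem
      _ = _ := by ring
  have h5 : C * |θ - θ₀| * (‖x‖ ^ 2 + n) ≤ 3 * C * |θ - θ₀| * n := by
    have : C * |θ - θ₀| * (‖x‖ ^ 2 + n) ≤ C * |θ - θ₀| * (2 * n + n) := by gcongr
    linarith
  have h6 : |θ - θ₀| * D * n ≤ c / 4 * n := by gcongr
  rw [hD] at h6
  have h7 := (abs_le.1 h1).1
  have h8 := (abs_le.1 h3).1
  have h9 := (abs_le.1 h4).1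
  linarith [mul_pos hc hn]

/-- Tails of Gaussian quadratic forms on the scale `n · √(log n / n)`. -/
lemma measureReal_quadForm_ge_rate_le {k N : ℕ} (hN : 1 ≤ N) {θ₀ : ℝ} (hθ₀ : 0 < θ₀)
    {A : Matrix (Fin k → Fin N) (Fin k → Fin N) ℝ} (hA : Aᵀ = A) {b : ℝ}
    (hb : ‖A‖ * ‖spatialCov k N θ₀‖ ≤ b) (hrate : rate k N * b ≤ 1 / 8) :
    (spatialLaw k N θ₀).real {x | (1 + 2 * b ^ 2) * (sampleSize k N * rate k N) ≤
      |quadForm A x - (A * spatialCov k N θ₀).trace|} ≤ 2 / sampleSize k N := by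
  have hn := one_le_sampleSize k hN
  have h1 := measure_quadForm_ge_le hA (posDef_spatialCov k N hθ₀).posSemidef
    (u := (1 + 2 * b ^ 2) * (sampleSize k N * rate k N)) hb (Real.sqrt_nonneg _) hrate
  refine (ENNReal.toReal_le_of_le_ofReal (by positivity) h1).trans (le_of_eq ?_)
  have h2 := sampleSize_mul_rate_sq k hN
  rw [rate] at h2
  rw [card_grid, rate]
  set s := √(Real.log (sampleSize k N) / sampleSize k N)
  have h3 : -(s * ((1 + 2 * b ^ 2) * (sampleSize k N * s))) + 2 * s ^ 2 * b ^ 2 * sampleSize k N =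
      -Real.log (sampleSize k N) := by
    rw [← h2]; ring
  rw [h3, Real.exp_neg, Real.exp_log (by linarith), div_eq_mul_inv]

lemma measureReal_abs_gaussianReal_ge_le {u : ℝ} (hu : 0 ≤ u) :
    (gaussianReal 0 1).real {w | u ≤ |w|} ≤ 2 * Real.exp (-(u ^ 2) / 2) := by
  have h1 := measure_ge_le_exp_mul_mgf (μ := gaussianReal 0 1) (X := id) u hu
    (by simpa using integrable_exp_mul_gaussianReal (μ := 0) (v := 1) u)
  have h2 := measure_le_le_exp_mul_mgf (μ := gaussianReal 0 1) (X := id) (-u) (t := -u)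
    (by linarith) (by simpa using integrable_exp_mul_gaussianReal (μ := 0) (v := 1) (-u))
  rw [mgf_id_gaussianReal, ← Real.exp_add] at h1 h2
  have e1 : -u * u + (0 * u + ((1 : NNReal) : ℝ) * u ^ 2 / 2) = -(u ^ 2) / 2 := by
    simp only [NNReal.coe_one]; ring
  have e2 : - -u * -u + (0 * -u + ((1 : NNReal) : ℝ) * (-u) ^ 2 / 2) = -(u ^ 2) / 2 := by
    simp only [NNReal.coe_one]; ring
  rw [e1] at h1
  rw [e2] at h2
  have hsub : {w : ℝ | u ≤ |w|} ⊆ {w | u ≤ id w} ∪ {w | id w ≤ -u} := by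
    intro w hw
    rcases le_abs.1 (show u ≤ |w| from hw) with h | h
    · exact Or.inl h
    · exact Or.inr (show w ≤ -u by linarith)
  have h3 := (measureReal_mono (μ := gaussianReal 0 1) hsub).trans (measureReal_union_le _ _)
  linarith

/-- The constants bounding all the quadratic forms that enter the analysis of the estimator. -/
lemma exists_common_bound (k : ℕ) {θ₀ : ℝ} (hθ₀ : 0 < θ₀) :
    ∃ b : ℝ, 1 ≤ b ∧ ∀ N, 1 ≤ N →
      ‖scoreMat k N θ₀‖ * ‖spatialCov k N θ₀‖ ≤ b ∧ ‖hessMat k N θ₀‖ * ‖spatialCov k N θ₀‖ ≤ b ∧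
      ‖adjMat k N‖ * ‖spatialCov k N θ₀‖ ≤ b ∧
      ‖(1 : Matrix (Fin k → Fin N) (Fin k → Fin N) ℝ)‖ * ‖spatialCov k N θ₀‖ ≤ b := by
  obtain ⟨C₁, hC₁, h1⟩ := unifLip_scoreMat k hθ₀
  obtain ⟨C₂, hC₂, h2⟩ := unifLip_hessMat k hθ₀
  obtain ⟨C₃, h3⟩ := exists_norm_adjMat_le k
  obtain ⟨C₄, h4⟩ := exists_norm_covDeriv_le k 0 hθ₀
  set A := 1 + C₁ + C₂ + |C₃|
  set S := 1 + |C₄|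
  have hA : 1 ≤ A := by simp only [A]; linarith [abs_nonneg C₃]
  have hS : 1 ≤ S := by simp only [S]; linarith [abs_nonneg C₄]
  refine ⟨A * S, by nlinarith, fun N hN => ?_⟩
  have hcov : ‖spatialCov k N θ₀‖ ≤ S := by
    rw [← covDeriv_zero]
    have := h4 N θ₀ Set.self_mem_Ici
    simp only [S]
    linarith [le_abs_self C₄]
  have h5 := (h1 N θ₀ Set.self_mem_Ici).1
  have h6 := (h2 N θ₀ Set.self_mem_Ici).1
  have h7 := (h3 N).trans (le_abs_self _)
  have h8 : ‖(1 : Matrix (Fin k → Fin N) (Fin k → Fin N) ℝ)‖ ≤ 1 := by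
    have : Nontrivial (Matrix (Fin k → Fin N) (Fin k → Fin N) ℝ) := by
      have : Nonempty (Fin k → Fin N) := Fintype.card_pos_iff.1 (one_le_card_grid k hN)
      infer_instance
    rw [CStarRing.norm_one]
  have habs := abs_nonneg C₃
  refine ⟨?_, ?_, ?_, ?_⟩ <;> refine mul_le_mul ?_ hcov (norm_nonneg _) (by linarith) <;>
    simp only [A] <;> linarith

lemma tendsto_sampleSize {k : ℕ} (hk : 1 ≤ k) : Tendsto (sampleSize k) atTop atTop :=
  (tendsto_pow_atTop (by omega)).comp tendsto_natCast_atTop_atTop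

lemma tendsto_rate {k : ℕ} (hk : 1 ≤ k) : Tendsto (rate k) atTop (𝓝 0) := by
  have h1 : Tendsto (fun x : ℝ => Real.log x / x) atTop (𝓝 0) :=
    Real.isLittleO_log_id_atTop.tendsto_div_nhds_zero
  have h2 := (h1.comp (tendsto_sampleSize hk)).sqrt
  rw [Real.sqrt_zero] at h2
  exact h2

/-- Consistency of admissible estimators at the rate `√(log n / n)`. Up to an event of probability
`O(1 / n)`, the initial estimator is closer to `θ₀` than half the radius of the ball, the loss is
strongly convex on the ball, and its perturbed gradient at `θ₀` is `O(√(n log n))`. -/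
theorem exists_estimator_rate {k : ℕ} (hk : 1 ≤ k) {σ rad : ℕ → ℝ}
    (hσ : σ =O[atTop] fun N => √(sampleSize k N))
    (hrad_pos : ∀ N, 0 < rad N) (hrad_zero : Tendsto rad atTop (𝓝 0))
    (hrad : (rate k) =o[atTop] rad) {θ₀ : ℝ} (hθ₀ : 0 < θ₀) :
    ∃ R : ℝ, 0 < R ∧ ∀ᶠ N in atTop, ∀ est, IsLocalEstimator k N (σ N) (rad N) est →
      1 - 10 / sampleSize k N ≤ ((spatialLaw k N θ₀).prod (gaussianReal 0 1)).real
        {p | |est p.1 p.2 - θ₀| ≤ R * rate k N ∧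
          IsSSOSP (spatialDensity k N) 0 (σ N) p.1 p.2 (est p.1 p.2)} := by
  obtain ⟨c, a, hc, ha, haθ, hhess⟩ := exists_hessLoss_ge hk hθ₀
  obtain ⟨b, hb1, hb⟩ := exists_common_bound k hθ₀
  obtain ⟨Cσ, hCσ, hσ⟩ := hσ.exists_pos
  set M₀ := 1 + 2 * b ^ 2 with hM₀
  have hM₀0 : 0 < M₀ := by positivity
  set M₁ := M₀ + 2 * Cσ with hM₁
  have hM₁0 : 0 < M₁ := by positivity
  set e := Real.exp (-θ₀) with he
  have he0 : 0 < e := Real.exp_pos _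
  have hsmall : ∀ C ε : ℝ, 0 < ε → ∀ᶠ N in atTop, C * rate k N < ε := fun C ε hε => by
    have := (tendsto_rate hk).const_mul C
    rw [mul_zero] at this
    exact this.eventually_lt_const hε
  have hsmall' : ∀ C : ℝ, 0 < C → ∀ᶠ N in atTop, C * rate k N < rad N / 2 := fun C hC => by
    filter_upwards [hrad.bound (show 0 < 1 / (4 * C) by positivity)] with N hN
    rw [Real.norm_eq_abs, Real.norm_eq_abs, abs_of_nonneg (rate_nonneg k N),
      abs_of_pos (hrad_pos N), one_div, inv_mul_eq_div, le_div_iff₀ (by positivity)] at hN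
    linarith [hrad_pos N]
  refine ⟨M₁ / c, by positivity, ?_⟩
  filter_upwards [eventually_ge_atTop 2, hσ.bound, hsmall b (1 / 8) (by norm_num), hsmall M₀ c hc,
    hsmall M₀ 1 one_pos, hsmall M₀ (e / 2) (by positivity),
    hsmall' (2 * Real.exp θ₀ * M₀) (by positivity), hsmall' (M₁ / c) (by positivity),
    hrad_zero.eventually_lt_const (show 0 < 2 * a / 3 by positivity)]
    with N hN hσN hℓb hℓc hℓ1 hℓe hℓinit hℓR hrada est hest
  have hN1 : 1 ≤ N := by omega
  set n := sampleSize k N with hndef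
  set ℓ := rate k N with hℓdef
  have hn1 : 1 ≤ n := one_le_sampleSize k hN1
  have hn0 : 0 < n := by linarith
  have hℓ0 : 0 ≤ ℓ := rate_nonneg k N
  have hnℓ := sampleSize_mul_rate_sq k hN1
  rw [← hndef, ← hℓdef] at hnℓ
  obtain ⟨hb_score, hb_hess, hb_adj, hb_one⟩ := hb N hN1
  set S := spatialCov k N θ₀ with hS
  set bad : Matrix (Fin k → Fin N) (Fin k → Fin N) ℝ → Set (GridData k N) := fun A =>
    {x | M₀ * (n * ℓ) ≤ |quadForm A x - (A * S).trace|} with hbad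
  set badW : Set ℝ := {w | 2 * (√n * ℓ) ≤ |w|} with hbadW
  have hprob : ∀ A : Matrix (Fin k → Fin N) (Fin k → Fin N) ℝ, Aᵀ = A → ‖A‖ * ‖S‖ ≤ b →
      (spatialLaw k N θ₀).real (bad A) ≤ 2 / n := fun A hA hAb =>
    measureReal_quadForm_ge_rate_le hN1 hθ₀ hA hAb (by linarith)
  have hprobW : (gaussianReal 0 1).real badW ≤ 2 / n := by
    refine (measureReal_abs_gaussianReal_ge_le (by positivity)).trans ?_
    have h1 : -(2 * (√n * ℓ)) ^ 2 / 2 = -(2 * Real.log n) := by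
      rw [mul_pow, mul_pow, Real.sq_sqrt hn0.le, ← hnℓ]; ring
    rw [h1, div_eq_mul_inv]
    gcongr
    calc Real.exp (-(2 * Real.log n)) ≤ Real.exp (-Real.log n) := by
          rw [Real.exp_le_exp]; linarith [Real.log_nonneg hn1]
      _ = n⁻¹ := by rw [Real.exp_neg, Real.exp_log hn0]
  set target : Set (GridData k N × ℝ) := {p | |est p.1 p.2 - θ₀| ≤ M₁ / c * ℓ ∧
    IsSSOSP (spatialDensity k N) 0 (σ N) p.1 p.2 (est p.1 p.2)} with htarget
  set μ := (spatialLaw k N θ₀).prod (gaussianReal 0 1) with hμ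
  -- outside the five bad events, each of probability at most `2 / n`, the conclusion holds
  have hcover : (Set.univ : Set (GridData k N × ℝ)) ⊆ target ∪
      ((bad (scoreMat k N θ₀) ∪ bad (hessMat k N θ₀) ∪ bad (adjMat k N) ∪ bad 1) ×ˢ Set.univ ∪
        Set.univ ×ˢ badW) := by
    rintro ⟨x, w⟩ -
    by_contra hcon
    simp only [Set.mem_union, Set.mem_prod, Set.mem_univ, and_true, true_and, not_or] at hcon
    obtain ⟨hnt, ⟨⟨⟨hx1, hx2⟩, hx3⟩, hx4⟩, hw⟩ := hcon
    replace hx1 : |quadForm (scoreMat k N θ₀) x - (scoreMat k N θ₀ * S).trace| < M₀ * (n * ℓ) :=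
      not_le.1 hx1
    replace hx2 : |hessFluct k N θ₀ x| < M₀ * (n * ℓ) := not_le.1 hx2
    replace hx3 : |quadForm (adjMat k N) x - (adjMat k N * S).trace| < M₀ * (n * ℓ) :=
      not_le.1 hx3
    replace hx4 : |quadForm 1 x - ((1 : Matrix (Fin k → Fin N) (Fin k → Fin N) ℝ) * S).trace| <
      M₀ * (n * ℓ) := not_le.1 hx4
    replace hw : |w| < 2 * (√n * ℓ) := not_le.1 hw
    have hgrad : |gradLoss k N θ₀ x + σ N * w| ≤ M₁ * (n * ℓ) := by
      have e1 : (scoreMat k N θ₀ * S).trace = (prec k N θ₀ * covDeriv k N 1 θ₀).trace := by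
        have hPS : prec k N θ₀ * S = 1 :=
          nonsing_inv_mul _ (det_spatialCov_pos k N hθ₀).ne'.isUnit
        rw [scoreMat, mul_assoc, hPS, mul_one]
      have e2 : gradLoss k N θ₀ x =
          -(quadForm (scoreMat k N θ₀) x - (scoreMat k N θ₀ * S).trace) / 2 := by
        rw [gradLoss, e1]; ring
      have h1 : |gradLoss k N θ₀ x| ≤ M₀ * (n * ℓ) := by
        rw [e2, abs_div, abs_neg, abs_two]
        have := abs_nonneg (quadForm (scoreMat k N θ₀) x - (scoreMat k N θ₀ * S).trace)
        linarith
      have h2 : |σ N * w| ≤ 2 * Cσ * (n * ℓ) := by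
        rw [Real.norm_eq_abs, Real.norm_eq_abs, abs_of_nonneg (Real.sqrt_nonneg _)] at hσN
        rw [abs_mul]
        calc |σ N| * |w| ≤ (Cσ * √n) * (2 * (√n * ℓ)) :=
              mul_le_mul hσN hw.le (abs_nonneg _) (by positivity)
          _ = 2 * Cσ * ((√n * √n) * ℓ) := by ring
          _ = 2 * Cσ * (n * ℓ) := by rw [Real.mul_self_sqrt hn0.le]
      calc _ ≤ |gradLoss k N θ₀ x| + |σ N * w| := abs_add_le _ _
        _ ≤ _ := by rw [hM₁]; linarith
    have hnorm : ‖x‖ ^ 2 ≤ 2 * n := by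
      rw [quadForm_one, one_mul, hS, trace_spatialCov, ← hndef] at hx4
      have := (abs_lt.1 hx4).2
      nlinarith
    have hfl : |hessFluct k N θ₀ x| ≤ c * n := by nlinarith
    have hE : n ≤ (neighborPairs k N).card := sampleSize_le_card_neighborPairs hk hN
    have hE0 : (0 : ℝ) < (neighborPairs k N).card := hn0.trans_le hE
    have hmean : |neighborMean x - e| ≤ M₀ * ℓ := by
      rw [trace_adjMat_mul_cov] at hx3
      have e3 : neighborMean x - e =
          (quadForm (adjMat k N) x - (neighborPairs k N).card * e) / (neighborPairs k N).card := by
        rw [neighborMean_eq]; field_simp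
      rw [e3, abs_div, abs_of_pos hE0, div_le_iff₀ hE0]
      calc _ ≤ M₀ * (n * ℓ) := hx3.le
        _ = M₀ * ℓ * n := by ring
        _ ≤ _ := by gcongr
    obtain ⟨hmpos, hinit⟩ := abs_neg_log_sub_le hmean hℓe.le
    have hinit' : |initEstimator x - θ₀| ≤ rad N / 2 := by
      refine hinit.trans ?_
      rw [← mul_assoc]
      exact hℓinit.le
    have hball : Metric.closedBall (initEstimator x) (rad N) ⊆ Set.Ioi 0 := by
      rw [closedBall_subset_Ioi_iff (hrad_pos N).le]
      linarith [(abs_le.1 hinit').1]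
    have hst := (isConstrainedFOSP_iff (σ N) w x hball (est x w)).1
      (hest.stationary x w hmpos hball)
    have hpos : ∀ s, |s - θ₀| ≤ a → 0 < s := fun s hs => by linarith [(abs_le.1 hs).1]
    have hcn : 0 < c * n := by positivity
    have hdiv : M₁ * (n * ℓ) / (c * n) = M₁ / c * ℓ := by field_simp
    have hres := stationary_of_strongly_monotone (g := fun s => gradLoss k N s x + σ N * w)
      (H := fun s => hessLoss k N s x) (M := M₁ * (n * ℓ))
      (fun s hs => (hasDerivAt_gradLoss k N (hpos s hs) x).add_const _) hcn
      (fun s hs => hhess N hN x hfl hnorm s hs) hinit' (by linarith) hgrad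
      (by rw [hdiv]; exact hℓR) hst.1 hst.2
    rw [hdiv] at hres
    refine hnt ⟨hres.1, ?_, ?_⟩
    · rw [(hasDerivAt_noisyLoss k N (hest.mem x w) (σ N) x w).deriv]
      exact hres.2
    · change 0 < iteratedDeriv 2 (fun t => noisyLoss (spatialDensity k N) 0 (σ N) t x w) (est x w)
      rw [iteratedDeriv_two_noisyLoss k N (hest.mem x w)]
      refine hcn.trans_le (hhess N hN x hfl hnorm _ (hres.1.trans ?_))
      linarith [hrad_pos N]
  have h1 := measureReal_mono (μ := μ) hcover
  rw [probReal_univ] at h1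
  have h2 : μ.real ((bad (scoreMat k N θ₀) ∪ bad (hessMat k N θ₀) ∪ bad (adjMat k N) ∪ bad 1) ×ˢ
      Set.univ) ≤ 8 / n := by
    rw [hμ, measureReal_prod_prod, probReal_univ, mul_one]
    have hU := fun s t : Set (GridData k N) => measureReal_union_le (μ := spatialLaw k N θ₀) s t
    have e1 := hprob _ (transpose_scoreMat k N θ₀) hb_score
    have e2 := hprob _ (transpose_hessMat k N θ₀) hb_hess
    have e3 := hprob _ (transpose_adjMat k N) hb_adj
    have e4 := hprob 1 transpose_one hb_one
    have e5 : 8 / n = 2 / n + 2 / n + 2 / n + 2 / n := by ring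
    rw [e5]
    refine (hU _ _).trans (add_le_add ((hU _ _).trans (add_le_add ((hU _ _).trans
      (add_le_add e1 e2)) e3)) e4)
  have h3 : μ.real (Set.univ ×ˢ badW) ≤ 2 / n := by
    rw [hμ, measureReal_prod_prod, probReal_univ, one_mul]
    exact hprobW
  have h4 := h1.trans ((measureReal_union_le _ _).trans
    (add_le_add le_rfl (measureReal_union_le _ _)))
  have h5 : 10 / n = 8 / n + 2 / n := by ring
  rw [h5]
  linarith

end Consistency

/-! ### Choice of the radius and the error terms -/

section Assembly

/-- Up to a constant factor, the size of the fluctuations of the observed information, scaled by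
`r²`, over a ball of radius `r` in the parameter space. -/
def hessError (n r : ℝ) : ℝ := r ^ 2 * √n + r ^ 3 * n

lemma hessError_rate_le {n R : ℝ} (hn : 1 ≤ n) (hlog : 1 ≤ Real.log n) (hR : 0 < R) :
    hessError n (R * √(Real.log n / n)) ≤
      (R ^ 2 + R ^ 3) * (n ^ (-(1 / 2) : ℝ) * Real.log n ^ 2) := by
  have hn0 : 0 < n := by linarith
  have hs : 0 < √n := Real.sqrt_pos.2 hn0
  have hsq : √n ^ 2 = n := Real.sq_sqrt hn0.le
  set y := √(Real.log n) with hy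
  have hysq : y ^ 2 = Real.log n := Real.sq_sqrt (by linarith)
  have hy1 : 1 ≤ y := Real.one_le_sqrt.2 hlog
  have hpow : n ^ (-(1 / 2) : ℝ) = (√n)⁻¹ := by
    rw [Real.rpow_neg hn0.le, ← Real.sqrt_eq_rpow]
  have h1 : hessError n (R * √(Real.log n / n)) = (R ^ 2 * y ^ 2 + R ^ 3 * y ^ 3) * (√n)⁻¹ := by
    rw [hessError, Real.sqrt_div (by linarith), ← hy]
    have hmul : n * (√n)⁻¹ ^ 2 = 1 := by rw [inv_pow, hsq, mul_inv_cancel₀ hn0.ne']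
    have hmul' : √n * (√n)⁻¹ = 1 := mul_inv_cancel₀ hs.ne'
    rw [div_eq_mul_inv]
    linear_combination (R ^ 2 * y ^ 2 * (√n)⁻¹) * hmul' + (R ^ 3 * y ^ 3 * (√n)⁻¹) * hmul
  rw [h1, hpow, ← hysq, ← pow_mul]
  have h2 : y ^ 2 ≤ y ^ 4 := pow_le_pow_right₀ hy1 (by norm_num)
  have h3 : y ^ 3 ≤ y ^ 4 := pow_le_pow_right₀ hy1 (by norm_num)
  calc _ ≤ (R ^ 2 * y ^ 4 + R ^ 3 * y ^ 4) * (√n)⁻¹ := by gcongr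
    _ = _ := by ring

lemma tendsto_rpow_mul_log_sq :
    Tendsto (fun x : ℝ => x ^ (-(1 / 2) : ℝ) * Real.log x ^ 2) atTop (𝓝 0) := by
  have h := (isLittleO_log_rpow_rpow_atTop (s := 1 / 2) 2 (by norm_num)).tendsto_div_nhds_zero
  refine h.congr' ?_
  filter_upwards [eventually_gt_atTop 0] with x hx
  rw [Real.rpow_neg hx.le, div_eq_inv_mul, Real.rpow_two]

/-- For a fixed true parameter the radius is of the order of `√(log n / n)`, the estimation error
of admissible estimators. For the finitely many small grids, where no estimate is available, the
radius is taken so small that the fluctuation of the observed information is under control. -/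
theorem exists_radius {k : ℕ} (hk : 1 ≤ k) {σ rad : ℕ → ℝ}
    (hσ : σ =O[atTop] fun N => √(sampleSize k N))
    (hrad_pos : ∀ N, 0 < rad N) (hrad_zero : Tendsto rad atTop (𝓝 0))
    (hrad : (rate k) =o[atTop] rad) {θ₀ : ℝ} (hθ₀ : 0 < θ₀) :
    ∃ r δ ε : ℕ → ℝ,
      ((∀ N, 0 < r N) ∧
        IsSoftO (sampleSize k) r (fun N => sampleSize k N ^ (-(1 / 2) : ℝ)) ∧
        δ =O[atTop] (fun N => (sampleSize k N)⁻¹) ∧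
        IsSoftO (sampleSize k) ε (fun N => sampleSize k N ^ (-(1 / 2) : ℝ))) ∧
      ∀ N, 1 ≤ N →
        ((∀ θ ∈ Metric.closedBall θ₀ (r N) ∩ Set.Ioi 0,
            Integrable (hess (spatialDensity k N) θ) (spatialLaw k N θ₀)) ∧
          ∫⁻ x, hessSup (spatialLaw k N) (spatialDensity k N) (Set.Ioi 0) θ₀ (r N) (-1) x
            ∂(spatialLaw k N θ₀) ≤ ENNReal.ofReal (ε N) ∧
          ∫⁻ x, EReal.exp
            (hessSup (spatialLaw k N) (spatialDensity k N) (Set.Ioi 0) θ₀ (r N) 1 x : EReal)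
            ∂(spatialLaw k N θ₀) ≤ ENNReal.ofReal (Real.exp (ε N))) ∧
        ∀ est, IsLocalEstimator k N (σ N) (rad N) est →
          1 - δ N ≤ ((spatialLaw k N θ₀).prod (gaussianReal 0 1)).real
            {p | |est p.1 p.2 - θ₀| ≤ r N ∧
              IsSSOSP (spatialDensity k N) 0 (σ N) p.1 p.2 (est p.1 p.2)} := by
  obtain ⟨L, hL, hhess⟩ := exists_hessian_concentration k hθ₀
  obtain ⟨R, hR, hest⟩ := exists_estimator_rate hk hσ hrad_pos hrad_zero hrad hθ₀
  have hn := tendsto_sampleSize hk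
  have hlog : ∀ᶠ N in atTop, 1 ≤ Real.log (sampleSize k N) :=
    (Real.tendsto_log_atTop.comp hn).eventually_ge_atTop 1
  have hsmall : ∀ᶠ N in atTop, R * rate k N < θ₀ / 2 := by
    have := (tendsto_rate hk).const_mul R
    rw [mul_zero] at this
    exact this.eventually_lt_const (half_pos hθ₀)
  have hsmall' : ∀ᶠ N in atTop, L * ((R ^ 2 + R ^ 3) *
      (sampleSize k N ^ (-(1 / 2) : ℝ) * Real.log (sampleSize k N) ^ 2)) < 1 := by
    have := (((tendsto_rpow_mul_log_sq).comp hn).const_mul (R ^ 2 + R ^ 3)).const_mul L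
    rw [mul_zero, mul_zero] at this
    exact this.eventually_lt_const one_pos
  obtain ⟨N₀, hN₀⟩ := eventually_atTop.1
    (hest.and (hlog.and (hsmall.and (hsmall'.and (eventually_ge_atTop 1)))))
  -- below `N₀` the estimator is not controlled, and `L * hessError n r ≤ 2 L n r ≤ 1`
  set r : ℕ → ℝ := fun N => if N₀ ≤ N then R * rate k N else
    min (θ₀ / 2) (min 1 (1 / (2 * L * (sampleSize k N + 1)))) with hr
  have hr_large : ∀ N, N₀ ≤ N → r N = R * rate k N := fun N hN => if_pos hN
  have hn_nonneg : ∀ N, 0 ≤ sampleSize k N := fun N => by unfold sampleSize; positivity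
  have hrpos : ∀ N, 0 < r N := by
    intro N
    by_cases hN : N₀ ≤ N
    · rw [hr_large N hN]
      obtain ⟨-, h1, -, -, h2⟩ := hN₀ N hN
      have h3 := one_le_sampleSize k h2
      have : 0 < rate k N := Real.sqrt_pos.2 (by positivity)
      positivity
    · have := hn_nonneg N
      simp only [hr, hN, if_false]
      positivity
  have herr_large : ∀ N, N₀ ≤ N → hessError (sampleSize k N) (r N) ≤ (R ^ 2 + R ^ 3) *
      (sampleSize k N ^ (-(1 / 2) : ℝ) * Real.log (sampleSize k N) ^ 2) := by
    intro N hN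
    obtain ⟨-, h1, -, -, h2⟩ := hN₀ N hN
    rw [hr_large N hN]
    exact hessError_rate_le (one_le_sampleSize k h2) h1 hR
  have herr0 : ∀ N, 0 ≤ hessError (sampleSize k N) (r N) := fun N => by
    have h1 := hrpos N
    have h2 := hn_nonneg N
    unfold hessError
    positivity
  refine ⟨r, fun N => if N₀ ≤ N then 10 / sampleSize k N else 1,
    fun N => L * hessError (sampleSize k N) (r N) * Real.exp 3, ⟨hrpos, ?_, ?_, ?_⟩,
    fun N hN => ⟨?_, ?_⟩⟩
  · refine ⟨1, IsBigO.of_bound R ?_⟩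
    filter_upwards [eventually_ge_atTop N₀] with N hN
    obtain ⟨-, h1, -, -, h2⟩ := hN₀ N hN
    have hn1 := one_le_sampleSize k h2
    have hn0 : 0 < sampleSize k N := by linarith
    rw [Real.norm_eq_abs, Real.norm_eq_abs, abs_of_pos (hrpos N), hr_large N hN,
      abs_of_nonneg (by positivity), pow_one, rate, Real.sqrt_div (by linarith),
      Real.rpow_neg hn0.le, ← Real.sqrt_eq_rpow, div_eq_inv_mul]
    gcongr
    rw [Real.sqrt_le_left (by linarith)]
    nlinarith
  · refine IsBigO.of_bound 10 ?_
    filter_upwards [eventually_ge_atTop N₀] with N hN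
    have := hn_nonneg N
    rw [if_pos hN, Real.norm_eq_abs, Real.norm_eq_abs, abs_of_nonneg (by positivity),
      abs_of_nonneg (by positivity), div_eq_mul_inv]
  · refine ⟨2, IsBigO.of_bound (L * (R ^ 2 + R ^ 3) * Real.exp 3) ?_⟩
    filter_upwards [eventually_ge_atTop N₀] with N hN
    have h1 := hn_nonneg N
    have h2 := herr0 N
    rw [Real.norm_eq_abs, Real.norm_eq_abs, abs_of_nonneg (by positivity),
      abs_of_nonneg (by positivity)]
    calc L * hessError (sampleSize k N) (r N) * Real.exp 3 ≤
          L * ((R ^ 2 + R ^ 3) * (sampleSize k N ^ (-(1 / 2) : ℝ) *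
            Real.log (sampleSize k N) ^ 2)) * Real.exp 3 := by gcongr; exact herr_large N hN
      _ = _ := by ring
  · refine hhess N hN (r N) (L * hessError (sampleSize k N) (r N)) (hrpos N) ?_ ?_ le_rfl
    · by_cases hN' : N₀ ≤ N
      · rw [hr_large N hN']
        exact (hN₀ N hN').2.2.1.le
      · simp only [hr, hN', if_false]
        exact min_le_left _ _
    · by_cases hN' : N₀ ≤ N
      · exact (mul_le_mul_of_nonneg_left (herr_large N hN') hL.le).trans (hN₀ N hN').2.2.2.1.le
      · set n := sampleSize k N with hndef
        have hn1 : 1 ≤ n := one_le_sampleSize k hN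
        have hr1 : r N ≤ 1 := by
          simp only [hr, hN', if_false]
          exact (min_le_right _ _).trans (min_le_left _ _)
        have hr2 : r N * (2 * L * (n + 1)) ≤ 1 := by
          rw [← le_div_iff₀ (by positivity)]
          simp only [hr, hN', if_false]
          exact (min_le_right _ _).trans (min_le_right _ _)
        have hr0 := hrpos N
        have hsn : √n ≤ n := Real.sqrt_le_left (by linarith) |>.2 (by nlinarith)
        have e1 : r N ^ 2 * √n ≤ r N * n := by
          have : r N ^ 2 ≤ r N := by nlinarith
          gcongr
        have e2 : r N ^ 3 * n ≤ r N * n := by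
          have : r N ^ 3 ≤ r N := pow_le_of_le_one hr0.le hr1 (by norm_num)
          gcongr
        rw [hessError]
        calc L * (r N ^ 2 * √n + r N ^ 3 * n) ≤ L * (r N * n + r N * n) := by gcongr
          _ ≤ r N * (2 * L * (n + 1)) := by nlinarith [mul_pos hL hr0]
          _ ≤ 1 := hr2
  · intro est hloc
    by_cases hN' : N₀ ≤ N
    · simp only [hN', if_true]
      rw [hr_large N hN']
      exact (hN₀ N hN').1 est hloc
    · simp only [hN', if_false, sub_self]
      exact measureReal_nonneg

end Assembly

end ACSS

end

theorem mainTheorem6 (k : ℕ) (hk : 1 ≤ k) (σ rad : ℕ → ℝ)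
    (hσ_pos : ∀ N, 0 < σ N)
    (hσ : σ =O[atTop] fun N => √(ACSS.sampleSize k N))
    (hrad_pos : ∀ N, 0 < rad N)
    (hrad_zero : Tendsto rad atTop (𝓝 0))
    (hrad : (fun N => √(Real.log (ACSS.sampleSize k N) / ACSS.sampleSize k N)) =o[atTop] rad) :
    ∃ r δ ε : ℕ → ℝ → ℝ,
      (∀ θ₀ ∈ Set.Ioi (0 : ℝ),
        (∀ N, 0 < r N θ₀) ∧
        ACSS.IsSoftO (ACSS.sampleSize k) (fun N => r N θ₀)
          (fun N => ACSS.sampleSize k N ^ (-(1 / 2) : ℝ)) ∧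
        (fun N => δ N θ₀) =O[atTop] (fun N => (ACSS.sampleSize k N)⁻¹) ∧
        ACSS.IsSoftO (ACSS.sampleSize k) (fun N => ε N θ₀)
          (fun N => ACSS.sampleSize k N ^ (-(1 / 2) : ℝ))) ∧
      ∀ N, 1 ≤ N →
        ACSS.RegularityAssumption volume (ACSS.spatialLaw k N) (ACSS.spatialDensity k N) 0
          (Set.Ioi 0) ∧
        ACSS.HessianAssumption (ACSS.spatialLaw k N) (ACSS.spatialDensity k N) (Set.Ioi 0)
          (r N) (ε N) ∧
        (∃ est, ACSS.IsLocalEstimator k N (σ N) (rad N) est) ∧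
        ∀ est, ACSS.IsLocalEstimator k N (σ N) (rad N) est →
          ACSS.EstimatorAssumption (ACSS.spatialLaw k N) (ACSS.spatialDensity k N) 0
            (Set.Ioi 0) (σ N) est (r N) (δ N) := by
  have h : ∀ θ₀ : Set.Ioi (0 : ℝ), _ := fun θ₀ =>
    ACSS.exists_radius hk hσ hrad_pos hrad_zero hrad θ₀.2
  choose r δ ε hasymp hfin using h
  -- the functions are extended by zero outside the parameter set
  have hext : ∀ (f : Set.Ioi (0 : ℝ) → ℕ → ℝ), ∃ g : ℕ → ℝ → ℝ,
      ∀ (θ₀ : Set.Ioi (0 : ℝ)) N, g N θ₀ = f θ₀ N := by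
    classical
    exact fun f => ⟨fun N θ => if hθ : θ ∈ Set.Ioi (0 : ℝ) then f ⟨θ, hθ⟩ N else 0,
      fun θ₀ N => by simp only [θ₀.2, dif_pos]⟩
  obtain ⟨r', hr'⟩ := hext r
  obtain ⟨δ', hδ'⟩ := hext δ
  obtain ⟨ε', hε'⟩ := hext ε
  refine ⟨r', δ', ε', fun θ₀ hθ₀ => ?_, fun N hN => ⟨ACSS.regularityAssumption_spatial k N,
    fun θ₀ hθ₀ => ?_, ACSS.exists_isLocalEstimator k N (σ N) (hrad_pos N),
    fun est hest θ₀ hθ₀ => ?_⟩⟩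
  · simp only [hr' ⟨θ₀, hθ₀⟩, hδ' ⟨θ₀, hθ₀⟩, hε' ⟨θ₀, hθ₀⟩]
    exact hasymp ⟨θ₀, hθ₀⟩
  · rw [hr' ⟨θ₀, hθ₀⟩, hε' ⟨θ₀, hθ₀⟩]
    exact (hfin ⟨θ₀, hθ₀⟩ N hN).1
  · rw [hr' ⟨θ₀, hθ₀⟩, hδ' ⟨θ₀, hθ₀⟩]
    exact (hfin ⟨θ₀, hθ₀⟩ N hN).2 est hest
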